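/- **Setting.** Let $\delta>0$. An isoradial lattice of mesh $\delta$ is given by an edge-to-edge tiling of $\mathbb C$ by rhombi $z$ of side $\delta$ whose vertices are properly coloured primal ($u\in\Gamma$) and dual ($w\in\Gamma^*$); primal (dual) edges are the primal (dual) diagonals of the rhombi, and corners $\xi=\langle uw\rangle$ are the sides of the rhombi, with direction $\nu_\xi=(w-u)/|w-u|$. The half-angle $\bar\theta_z$ is the angle between the primal diagonal of $z$ and its sides; for some $\eta>0$ all $\bar\theta_z\in[\eta,\frac{\pi}{2}-\eta]$. For $k\in[0,1)$ put $u(\varphi|k)=\int_0^\varphi(1-k^2\sin^2\theta)^{-1/2}d\theta$, $K(k)=u(\frac{\pi}{2}|k)$, $q=\exp[-\pi K(\sqrt{1-k^2})/K(k)]$ ($q=0$ if $k=0$), and let $\hat\theta_z\in[0,\frac\pi2]$ be the solution of $u(\hat\theta_z|k)=\frac{K(k)}{\pi/2}\bar\theta_z$. The mass $m\ge0$ is such that $q\le m\delta$. Let $\Omega^\delta$ be a simply connected discrete domain, composed of finitely many non-overlapping interior rhombi and boundary half-rhombi pasted along common sides. A boundary half-rhombus is half of a rhombus $z$ bisected by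 a boundary edge: a primal edge (wired) or a dual edge (free); the vertex of $z$ off the boundary edge and in the domain is $z_{\rm int}$, the opposite one is $z_{\rm ext}$. The boundary $\partial\Omega^\delta$ consists of the boundary edges and of those corners that have the domain on one side only. A vertex is counted once for every way of access from inside the domain, and exterior vertices are counted once for every boundary edge. Let $F$ be massive s-holomorphic, i.e. for every interior rhombus $z$ and each of its four sides $\xi$, $$\mathrm{Proj}\big[F(z);(i\nu_{\hat\xi})^{-1/2}\mathbb R\big]=(\nu_{\hat\xi}/\nu_\xi)^{-1/2}F(\xi),\qquad \nu_{\hat\xi}=e^{\pm i(\hat\theta_z-\bar\theta_z)}\nu_\xi,$$ where the sign is $+$ (resp. $-$) if, seen from its primal end, $\xi$ lies counterclockwise (resp. clockwise) of the primal diagonal of $z$, and the root has positive real part. Let $H=\mathrm{Im}\int^\delta F^2dz$ be its square integral, i.e. a real function on the vertices of $\Omega^\delta$ with $H(u)-H(w)=2\delta|F(\xi)|^2$ for every corner $\xi=\langle uw\rangle$ of $\Omega^\delta$. Let $S^\delta\subset\partial\Omega^\delta$ be a non-empty set of boundary elements (for instance a boundary segment) on which $H$ takes a constant boundary value $H(S^\delta)$: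 at both ends of every boundary edge or corner of $S^\delta$, $H$ is equal to $H(S^\delta)$, and for every boundary edge $z$ of $S^\delta$, $F$ and $H$ are extended to $z$ and $z_{\rm ext}$ such that the above relation for $F(z)$ holds with the two corners of the half-rhombus, $H(z_{\rm ext})=H(S^\delta)$, and $$H(z_{\rm ext})-H(z_{\rm int})=\kappa_z\,\mathrm{Im}\big[(z_{\rm ext}-z_{\rm int})F(z)^2\big],$$ with $\kappa_z=\frac{(\sin\hat\theta_z+1)/2}{\sin\bar\theta_z}$ on wired and $\kappa_z=\frac{(\cos\hat\theta_z+1)/2}{\cos\bar\theta_z}$ on free edges. **Proposition.** There is a universal exponent $\beta_0>0$, and for every $\eta>0$ a constant $C(\eta)>0$ that depends only on $\eta$, such that in the above setting, for every vertex $v$ of $\Omega^\delta$ with $\mathrm{dist}(v,\partial\Omega^\delta\setminus S^\delta)>0$ (and $\partial\Omega^\delta\setminus S^\delta\neq\emptyset$), $$|H(v)-H(S^\delta)|\le C(\eta)\,\operatorname{osc}_{\Omega^\delta}H\,\Big(1+\big(m\,\mathrm{dist}(v,\partial\Omega^\delta\setminus S^\delta)\big)^2\Big)\left(\frac{\mathrm{dist}(v,S^\delta)}{\mathrm{dist}(v,\partial\Omega^\delta\setminus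 S^\delta)}\right)^{\beta_0},$$ where $\operatorname{osc}_{\Omega^\delta}H$ is the difference of the largest and the smallest value of $H$ at the vertices of $\Omega^\delta$, and distances are Euclidean distances in the plane. -/

import Mathlib

open Complex Set

noncomputable section

/-! ### Elliptic parametrisation of the weights -/

/-- The incomplete elliptic integral `u(φ | k) = ∫₀^φ dθ / √(1 - k² sin² θ)`. -/
def ellipticU (φ k : ℝ) : ℝ := ∫ θ in (0 : ℝ)..φ, 1 / Real.sqrt (1 - k ^ 2 * Real.sin θ ^ 2)

/-- The quarter-period `K(k) = u(π/2 | k)`. -/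
def ellipticK (k : ℝ) : ℝ := ellipticU (Real.pi / 2) k

/-- The nome `q = exp(-π K(√(1-k²)) / K(k))` for `0 < k < 1`; as `K(1) = ∞`, it is `0` at `k = 0`. -/
def nome (k : ℝ) : ℝ :=
  if k = 0 then 0
  else Real.exp (-Real.pi * ellipticK (Real.sqrt (1 - k ^ 2)) / ellipticK k)

/-- The abstract angle of modulus `k` belonging to the geometric half-angle `θ`: the (unique, for
`0 ≤ k < 1` and `0 ≤ θ ≤ π/2`) `φ ∈ [0, π/2]` with `u(φ | k) = (K(k) / (π/2)) θ`. -/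
def abstractAngle (k θ : ℝ) : ℝ :=
  Function.invFunOn (fun φ => ellipticU φ k) (Icc 0 (Real.pi / 2))
    (ellipticK k / (Real.pi / 2) * θ)

/-! ### Isoradial lattices -/

/-- An isoradial lattice of mesh `δ`, given by its rhombi: an edge-to-edge tiling of the plane by
rhombi of side `δ` with a proper two-colouring of the vertices. `E` indexes the rhombi (that is, the
edges of the lattice); the vertices `vert z 0, vert z 1, vert z 2, vert z 3` of the rhombus `z` are
in counterclockwise order, those with even index are primal and those with odd index are dual. -/
structure IsoradialLattice (δ : ℝ) where
  E : Type
  vert : E → Fin 4 → ℂ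
  side_length : ∀ z i, ‖vert z (i + 1) - vert z i‖ = δ
  parallelogram : ∀ z, vert z 0 + vert z 2 = vert z 1 + vert z 3
  counterclockwise : ∀ z,
    0 < ((starRingEnd ℂ) (vert z 1 - vert z 0) * (vert z 3 - vert z 0)).im
  cover : ⋃ z, convexHull ℝ (range (vert z)) = univ
  disjoint_interior : ∀ z z', z ≠ z' →
    Disjoint (interior (convexHull ℝ (range (vert z)))) (interior (convexHull ℝ (range (vert z'))))
  /-- A vertex that lies in a closed rhombus is one of its four vertices, with the same colour. -/
  proper : ∀ z z' i, vert z' i ∈ convexHull ℝ (range (vert z)) →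
    ∃ j, vert z' i = vert z j ∧ (i : ℕ) % 2 = (j : ℕ) % 2

namespace IsoradialLattice

variable {δ : ℝ} (L : IsoradialLattice δ)

/-- The half-angle `θ̄_z` between the primal diagonal of the rhombus `z` and its sides. -/
def halfAngle (z : L.E) : ℝ :=
  InnerProductGeometry.angle (L.vert z 2 - L.vert z 0) (L.vert z 1 - L.vert z 0)

/-- The uniform angle bound `θ̄_z ∈ [η, π/2 - η]`. -/
def AngleBound (η : ℝ) : Prop :=
  ∀ z, L.halfAngle z ∈ Icc η (Real.pi / 2 - η)

/-- The abstract angle `θ̂_z`. -/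
def hatAngle (k : ℝ) (z : L.E) : ℝ := abstractAngle k (L.halfAngle z)

/-- The `i`-th side of a rhombus joins the vertices `i` and `i + 1`; this is the index of its
primal end. -/
def primalEnd (i : Fin 4) : Fin 4 := if (i : ℕ) % 2 = 0 then i else i + 1

/-- The index of the dual end of the `i`-th side. -/
def dualEnd (i : Fin 4) : Fin 4 := if (i : ℕ) % 2 = 0 then i + 1 else i

/-- The direction `ν(ξ) = (w - u) / |w - u|` of the corner `ξ = ⟨u w⟩` that is the `i`-th side
of `z`. -/
def cornerDir (z : L.E) (i : Fin 4) : ℂ :=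
  (L.vert z (dualEnd i) - L.vert z (primalEnd i)) /
    ((‖L.vert z (dualEnd i) - L.vert z (primalEnd i)‖ : ℝ) : ℂ)

/-- `-1` or `1` according to whether, seen from its primal end, the `i`-th side is turned clockwise
or counterclockwise (by the angle `θ̄_z`) from the primal diagonal. -/
def turnSign (i : Fin 4) : ℝ := if (i : ℕ) % 2 = 0 then -1 else 1

/-- The direction `ν(ξ̂) = e^{± i (θ̂_z - θ̄_z)} ν(ξ)` of the side `ξ` in the virtual rhombus in which
`θ̄_z` is replaced by `θ̂_z`. -/
def virtualDir (k : ℝ) (z : L.E) (i : Fin 4) : ℂ :=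
  exp (I * ((turnSign i * (L.hatAngle k z - L.halfAngle z) : ℝ) : ℂ)) * L.cornerDir z i

/-! ### Discrete domains -/

/-- The pieces of which discrete domains are composed: `(z, none)` is the rhombus `z`, as an
interior rhombus; `(z, some j)` is `z` as a boundary rhombus, bisected by the diagonal that joins
the vertices `j - 1` and `j + 1`, with interior vertex `z_int = vert z j` and exterior vertex
`z_ext = vert z (j + 2)`. The bisecting diagonal is a primal (wired) boundary edge if `j` is odd and
a dual (free) boundary edge if `j` is even. -/
abbrev Piece : Type := L.E × Option (Fin 4)

variable {L}

/-- The indices of the vertices of a piece that are inside or on the boundary of the domain: all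
four of an interior rhombus, all but `z_ext` of a boundary rhombus. -/
def Piece.verts (P : L.Piece) : Set (Fin 4) := {i | P.2 ≠ some (i + 2)}

/-- The `i`-th side is a side of the rhombus or of the inner half-rhombus. -/
def Piece.HasSide (P : L.Piece) (i : Fin 4) : Prop := i ∈ P.verts ∧ i + 1 ∈ P.verts

/-- The closed rhombus or the closed inner half-rhombus. -/
def Piece.shape (P : L.Piece) : Set ℂ := convexHull ℝ (L.vert P.1 '' P.verts)

/-- The bisecting diagonal of a boundary rhombus. -/
def Piece.cut (P : L.Piece) : Set ℂ :=
  {x | ∃ j, P.2 = some j ∧ x ∈ segment ℝ (L.vert P.1 (j - 1)) (L.vert P.1 (j + 1))}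

/-- The `i`-th side of `P` and the `i'`-th side of `P'` are the same corner, seen from its two
sides. -/
def Piece.Opposite (P : L.Piece) (i : Fin 4) (P' : L.Piece) (i' : Fin 4) : Prop :=
  L.vert P.1 i = L.vert P'.1 (i' + 1) ∧ L.vert P.1 (i + 1) = L.vert P'.1 i'

variable (L)

/-- A simply connected discrete domain: finitely many interior rhombi and boundary half-rhombi that
do not overlap, pasted together along their common sides. The domain, as a planar region, is the
interior of the union of the pieces without the boundary edges (which matters only if both sides of
a boundary edge belong to the domain). -/
structure DiscreteDomain where
  pieces : Finset L.Piece
  disjoint_interior : ∀ P ∈ pieces, ∀ P' ∈ pieces, P ≠ P' →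
    Disjoint (interior P.shape) (interior P'.shape)
  simplyConnected :
    IsSimplyConnected (interior (⋃ P ∈ pieces, P.shape) \ ⋃ P ∈ pieces, P.cut)

/-- Candidates for the elements of the boundary: the boundary edge that bisects a boundary rhombus,
or a corner (the `i`-th side of a piece). -/
inductive BoundaryElement where
  | edge (P : L.Piece) : BoundaryElement
  | corner (P : L.Piece) (i : Fin 4) : BoundaryElement

variable {L}

/-- The closed line segment of a boundary element. -/
def BoundaryElement.seg : L.BoundaryElement → Set ℂ
  | .edge P => P.cut
  | .corner P i => segment ℝ (L.vert P.1 i) (L.vert P.1 (i + 1))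

/-- The boundary of a discrete domain: its (wired and free) boundary edges, and those corners that
have the domain on one side only (the marked corners between wired and free arcs). -/
def DiscreteDomain.boundary (Ω : L.DiscreteDomain) : Set L.BoundaryElement
  | .edge P => P ∈ Ω.pieces ∧ P.2 ≠ none
  | .corner P i => P ∈ Ω.pieces ∧ P.HasSide i ∧
      ∀ P' ∈ Ω.pieces, ∀ i', P'.HasSide i' → ¬ P.Opposite i P' i'

/-- The planar set covered by a set of boundary elements. -/
def carrier (S : Set L.BoundaryElement) : Set ℂ := ⋃ s ∈ S, s.seg

/-! ### Massive s-holomorphic functions and their square integrals -/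

variable (L)

/-- A complex function on rhombi (edges) and on corners: `corner u w` is the value at the corner
`⟨u w⟩` with primal end `u` and dual end `w`. -/
structure LatticeFunction where
  edge : L.Piece → ℂ
  corner : ℂ → ℂ → ℂ

variable {L}

/-- The value of `F` at the corner that is the `i`-th side of `P`. -/
def LatticeFunction.atSide (F : L.LatticeFunction) (P : L.Piece) (i : Fin 4) : ℂ :=
  F.corner (L.vert P.1 (primalEnd i)) (L.vert P.1 (dualEnd i))

end IsoradialLattice

/-- The orthogonal projection of `F` to the line `(i ν)^{-1/2} ℝ`, for a unit vector `ν`. -/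
def projLine (ν F : ℂ) : ℂ := (F + (I * ν)⁻¹ * (starRingEnd ℂ) F) / 2

theorem projLine_eq_starProjection (ν F : ℂ) (hν : ‖ν‖ = 1) :
    projLine ν F = (Submodule.span ℝ {(I * ν) ^ (-(1 / 2) : ℂ)}).starProjection F := by
  have hne : I * ν ≠ 0 := by
    rw [← norm_pos_iff]; simp [hν]
  have hsq : (I * ν) ^ (-(1 / 2) : ℂ) * (I * ν) ^ (-(1 / 2) : ℂ) = (I * ν)⁻¹ := by
    rw [← cpow_add _ _ hne, ← cpow_neg_one]; norm_num
  set e : ℂ := (I * ν) ^ (-(1 / 2) : ℂ) with he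
  have hee : ‖e‖ = 1 := by
    have h : ‖e‖ * ‖e‖ = 1 := by rw [← norm_mul, hsq]; simp [hν]
    nlinarith [norm_nonneg e]
  have hcc : e * (starRingEnd ℂ) e = 1 := by rw [mul_conj, normSq_eq_norm_sq, hee]; simp
  have hin : ((inner ℝ e F : ℝ) : ℂ) =
      ((starRingEnd ℂ) e * F + e * (starRingEnd ℂ) F) / 2 := by
    rw [Complex.inner, re_eq_add_conj]; simp; ring
  rw [Submodule.starProjection_unit_singleton ℝ hee, real_smul, hin, projLine, ← hsq]
  linear_combination (-F / 2) * hcc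

namespace IsoradialLattice

variable {δ : ℝ} {L : IsoradialLattice δ}

/-- The massive s-holomorphicity relation between the value at (the centre of) `P` and the values at
the sides of `P`:
`Proj[F(z); (i ν(ξ̂))^{-1/2} ℝ] = (ν(ξ̂) / ν(ξ))^{-1/2} F(ξ)`, with the root of positive real part. -/
def SHolAt (k : ℝ) (F : L.LatticeFunction) (P : L.Piece) : Prop :=
  ∀ i, P.HasSide i →
    projLine (L.virtualDir k P.1 i) (F.edge P) =
      exp (-I * ((turnSign i * (L.hatAngle k P.1 - L.halfAngle P.1) / 2 : ℝ) : ℂ)) * F.atSide P i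

/-- `F` is massive s-holomorphic in the domain: the relation holds at every interior rhombus. -/
def IsMassiveSHol (k : ℝ) (Ω : L.DiscreteDomain) (F : L.LatticeFunction) : Prop :=
  ∀ P ∈ Ω.pieces, P.2 = none → SHolAt k F P

/-- `H` is a square integral `Im ∫ F² dz` on the domain. The number `H P i` is the value at the
`i`-th vertex of the piece `P`. Pieces that are pasted together along a corner have the same values
at its ends; so `H` is a function on the vertices of the domain, where a point of the plane at
which the boundary touches itself is counted once for every way of access from inside the domain,
and the exterior vertex of a boundary rhombus is counted once for every boundary edge. -/
structure IsSquareIntegral (Ω : L.DiscreteDomain) (F : L.LatticeFunction)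
    (H : L.Piece → Fin 4 → ℝ) : Prop where
  glue : ∀ P ∈ Ω.pieces, ∀ P' ∈ Ω.pieces, ∀ i i', P.HasSide i → P'.HasSide i' →
    P.Opposite i P' i' → H P i = H P' (i' + 1) ∧ H P (i + 1) = H P' i'
  increment : ∀ P ∈ Ω.pieces, ∀ i, P.HasSide i →
    H P (primalEnd i) - H P (dualEnd i) = 2 * δ * ‖F.atSide P i‖ ^ 2

/-- The coefficient in
`H(z_ext) - H(z_int) = coefficient * Im[(z_ext - z_int) F(z)²]` at a boundary rhombus with interior
vertex of index `j`, after the boundary modification: `sin θ̂` is replaced by `(sin θ̂ + 1) / 2`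
on wired and `cos θ̂` by `(cos θ̂ + 1) / 2` on free boundary edges. -/
def boundaryCoeff (L : IsoradialLattice δ) (k : ℝ) (z : L.E) (j : Fin 4) : ℝ :=
  if (j : ℕ) % 2 = 1 then ((Real.sin (L.hatAngle k z) + 1) / 2) / Real.sin (L.halfAngle z)
  else ((Real.cos (L.hatAngle k z) + 1) / 2) / Real.cos (L.halfAngle z)

/-- The boundary condition "`H` has the value `c`" at a boundary element. At a boundary edge, this
is the discrete Riemann-Hilbert condition: `F` is extended to the boundary edge by
s-holomorphicity with its two interior corners, `H` is equal to `c` at both ends of the edge and at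
`z_ext`, and the normal increment of `H` is consistent with the value of `F` at the edge. -/
def HasBoundaryValue (k : ℝ) (F : L.LatticeFunction) (H : L.Piece → Fin 4 → ℝ) (c : ℝ) :
    L.BoundaryElement → Prop
  | .edge P => ∀ j, P.2 = some j →
      SHolAt k F P ∧ H P (j - 1) = c ∧ H P (j + 1) = c ∧ H P (j + 2) = c ∧
      H P (j + 2) - H P j = boundaryCoeff L k P.1 j *
        ((L.vert P.1 (j + 2) - L.vert P.1 j) * F.edge P ^ 2).im
  | .corner P i => H P i = c ∧ H P (i + 1) = c

/-- The oscillation of `H` over the vertices of the domain. -/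
def osc (Ω : L.DiscreteDomain) (H : L.Piece → Fin 4 → ℝ) : ℝ :=
  Metric.diam {h : ℝ | ∃ P ∈ Ω.pieces, ∃ i ∈ P.verts, h = H P i}

end IsoradialLattice

end

/-! Put `σ = 1` at primal and `σ = -1` at dual vertices, and `τ = m δ`. The proof shows that `σ (H -
c)` is almost subharmonic for both colours, and replaces an estimate of harmonic measure near the
boundary by a crossing argument for lattice paths.

Almost subharmonicity. Around an interior vertex the corner values of `F`, multiplied by square
roots of the directions, are real numbers that change sign after a full turn. Each increment of `H`
across a rhombus is, up to a positive factor, a quadratic form in two consecutive ones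
(`cornerForm`). For an angle `θ` below `π` this form is the least value of `∫ (f'² - f²)` over an
interval of length `θ` with given end values, so the sum over a fan of total angle `π` with
antiperiodic values is non-negative. The mass enters because the forms carry the virtual angles,
whereas the fan closes up with the true ones. The two differ by `O(k²) = O(q) = O(τ)`, and the
perturbation is absorbed into an error of order `τ` times the sum of the absolute increments
(`sum_sin_mul_ge`, `IsFan.weighted_increments_ge`). The modified boundary coefficients let boundary
half-rhombi take part in this sum with adjusted weights.

Barriers. Let `M` bound `σ (H - c)` near `x₀`, so that `w = M - σ (H - c)` is non-negative and
almost superharmonic. Linear and complex quadratic functions are exactly discrete harmonic on an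
isoradial lattice; hence, if `ψ` is strictly subharmonic at a scale `r` with `m r` and `δ / r`
small, `w - ψ` has no local minimum at which `w < ψ ≤ M / 2`. A boundary half-rhombus does not
interfere, because `w` rises there by at least `M / 2`. So every vertex with `w < ψ` starts a
lattice path with `w < ψ` that leaves the set where `ψ` is strictly subharmonic
(`exists_path_of_lt`).

Topology. Let `x₀` lie on the boundary and suppose that `w` is tiny at a vertex at distance about `r
/ 2` from it. Gaussian barriers carry the smallness through a chain of discs, at the cost of a fixed
factor for each step, and give paths inside the domain that follow the chain inwards, outwards, or
around `x₀` by an angle above `2 π`. The domain is simply connected and omits `x₀`, so it has a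
branch of `log (z - x₀)`. In this coordinate the circular path crosses the translate by `2 π i` of
the radial one (`exists_eq_of_crossing`), and a point of the domain gets two values of one branch.
Therefore `w` is at least a fixed fraction of `M` at distance about `r / 2`, and a quadratic barrier
extends this to the smaller ball (`le_of_dist_lt`).

Conclusion. Each halving of the radius multiplies the bound by `decayFactor`. That number depends
only on the Gaussian and on the number of steps, and so the exponent is universal; `η` enters only
through the smallness thresholds. The opposite bound at a vertex comes from a neighbour of the other
colour, as `H` is larger at the primal end of a corner. Starting at the scale `r` of order `d / (1 +
m d)`, with `d` the distance to the rest of the boundary, produces the factor `1 + (m d)²`. -/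

noncomputable section

/-! ### The quadratic form of corner values around a vertex -/

/-- The form `cot θ (x² + y²) - 2 x y / sin θ` in two neighbouring corner values. -/
def cornerForm (θ x y : ℝ) : ℝ :=
  Real.cos θ / Real.sin θ * (x ^ 2 + y ^ 2) - 2 * (x * y) / Real.sin θ

/-- As the least value of `∫ (f'² - f²)` with given end values, the form can only decrease when the
constraint at an intermediate point is dropped. In formulas, the difference is a square over a
product of positive sines. -/
theorem cornerForm_add_le {a b : ℝ} (ha : 0 < a) (hb : 0 < b) (hab : a + b < Real.pi)
    (x y z : ℝ) : cornerForm (a + b) x z ≤ cornerForm a x y + cornerForm b y z := by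
  have h1 : 0 < Real.sin a := Real.sin_pos_of_pos_of_lt_pi ha (by linarith)
  have h2 : 0 < Real.sin b := Real.sin_pos_of_pos_of_lt_pi hb (by linarith)
  have h3 : 0 < Real.sin (a + b) := Real.sin_pos_of_pos_of_lt_pi (by linarith) hab
  have key : cornerForm a x y + cornerForm b y z - cornerForm (a + b) x z =
      (y * Real.sin (a + b) - (x * Real.sin b + z * Real.sin a)) ^ 2 /
        (Real.sin a * Real.sin b * Real.sin (a + b)) := by
    unfold cornerForm
    field_simp
    rw [Real.sin_add, Real.cos_add]
    linear_combination x ^ 2 * Real.sin b ^ 2 * Real.sin_sq_add_cos_sq a +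
      Real.sin a ^ 2 * z ^ 2 * Real.sin_sq_add_cos_sq b
  have : 0 ≤ cornerForm a x y + cornerForm b y z - cornerForm (a + b) x z := by
    rw [key]; positivity
  linarith

/-- The form of antiperiodic corner values around a vertex of total angle `π` is non-negative. -/
theorem sum_cornerForm_nonneg {n : ℕ} (hn : 2 ≤ n) (α X : ℕ → ℝ) (hα : ∀ s, 0 < α s)
    (hsum : ∑ s ∈ Finset.range n, α s = Real.pi) (hX : X n = -X 0) :
    0 ≤ ∑ s ∈ Finset.range n, cornerForm (α s) (X s) (X (s + 1)) := by
  have step : ∀ j, j + 1 < n →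
      cornerForm (∑ s ∈ Finset.range (j + 1), α s) (X 0) (X (j + 1)) ≤
        ∑ s ∈ Finset.range (j + 1), cornerForm (α s) (X s) (X (s + 1)) := by
    intro j
    induction j with
    | zero => intro _; simp
    | succ j ih =>
      intro hj
      have hlt : ∑ s ∈ Finset.range (j + 2), α s < Real.pi := by
        rw [← hsum]
        refine Finset.sum_lt_sum_of_subset (i := j + 2) ?_ ?_ ?_ (hα _) (fun k _ _ => (hα k).le)
        · exact Finset.range_mono (by omega)
        · simpa using hj
        · simp
      rw [Finset.sum_range_succ _ (j + 1)] at hlt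
      rw [Finset.sum_range_succ _ (j + 1), Finset.sum_range_succ _ (j + 1)]
      refine (cornerForm_add_le (Finset.sum_pos (fun k _ => hα k) (by simp)) (hα _) hlt
        (X 0) (X (j + 1)) (X (j + 2))).trans ?_
      have := ih (by omega)
      linarith
  obtain ⟨j, rfl⟩ : ∃ j, n = j + 2 := ⟨n - 2, by omega⟩
  have h1 := step j (by omega)
  rw [Finset.sum_range_succ] at hsum ⊢
  rw [hX]
  have h2 : ∑ s ∈ Finset.range (j + 1), α s = Real.pi - α (j + 1) := by linarith
  rw [h2] at h1
  -- The form degenerates at angle `π`, and so the merging stops one sector short. The merged sector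
  -- and the last one have supplementary angles, and cancel by antiperiodicity.
  have h3 : cornerForm (Real.pi - α (j + 1)) (X 0) (X (j + 1)) +
      cornerForm (α (j + 1)) (X (j + 1)) (-X 0) = 0 := by
    unfold cornerForm
    rw [Real.sin_pi_sub, Real.cos_pi_sub]
    ring
  linarith

theorem abs_cornerForm_sub_le {s ψ α κ : ℝ} (hs : 0 < s) (hψ : s ≤ Real.sin ψ)
    (hα : s ≤ Real.sin α) (hκ : |ψ - α| ≤ κ) (x y : ℝ) :
    |cornerForm ψ x y - cornerForm α x y| ≤ 2 * κ / s ^ 2 * (x ^ 2 + y ^ 2) := by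
  have h1 : 0 < Real.sin ψ := by linarith
  have h2 : 0 < Real.sin α := by linarith
  have hκ0 : 0 ≤ κ := (abs_nonneg _).trans hκ
  have hprod : s ^ 2 ≤ Real.sin ψ * Real.sin α := by rw [sq]; gcongr
  have e1 : |Real.cos ψ / Real.sin ψ - Real.cos α / Real.sin α| ≤ κ / s ^ 2 := by
    have : Real.cos ψ / Real.sin ψ - Real.cos α / Real.sin α =
        -Real.sin (ψ - α) / (Real.sin ψ * Real.sin α) := by
      rw [Real.sin_sub]; field_simp; ring
    rw [this, abs_div, abs_neg, abs_of_pos (mul_pos h1 h2)]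
    gcongr
    exact Real.abs_sin_le_abs.trans hκ
  have e2 : |1 / Real.sin ψ - 1 / Real.sin α| ≤ κ / s ^ 2 := by
    have : 1 / Real.sin ψ - 1 / Real.sin α =
        -(Real.sin ψ - Real.sin α) / (Real.sin ψ * Real.sin α) := by
      field_simp; ring
    rw [this, abs_div, abs_neg, abs_of_pos (mul_pos h1 h2)]
    gcongr
    exact (Real.abs_sin_sub_sin_le ψ α).trans hκ
  have e3 : cornerForm ψ x y - cornerForm α x y =
      (Real.cos ψ / Real.sin ψ - Real.cos α / Real.sin α) * (x ^ 2 + y ^ 2) -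
        (1 / Real.sin ψ - 1 / Real.sin α) * (2 * (x * y)) := by
    unfold cornerForm; ring
  have e4 : |2 * (x * y)| ≤ x ^ 2 + y ^ 2 := by
    rw [abs_le]; constructor <;> nlinarith [sq_nonneg (x - y), sq_nonneg (x + y)]
  rw [e3]
  refine (abs_sub _ _).trans ?_
  rw [abs_mul, abs_mul, abs_of_nonneg (by positivity : 0 ≤ x ^ 2 + y ^ 2)]
  have : 2 * κ / s ^ 2 * (x ^ 2 + y ^ 2) =
    κ / s ^ 2 * (x ^ 2 + y ^ 2) + κ / s ^ 2 * (x ^ 2 + y ^ 2) := by ring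
  rw [this]
  gcongr

/-- Three successive corner values bound the middle one through the forms and the jump `J` of the
slope. -/
theorem sq_le_of_cornerForms {a b g s : ℝ} (hs : 0 < s) (hg : 0 < g) (hg1 : g ≤ 1)
    (ha : s ≤ Real.sin a) (hb : s ≤ Real.sin b) (hab : g ≤ Real.sin (a + b)) (x y z : ℝ) :
    y ^ 2 ≤ 4 / (g * s) * (|cornerForm a x y| + |cornerForm b y z|) +
      48 / g ^ 2 * ((z - y * Real.cos b) / Real.sin b - (y * Real.cos a - x) / Real.sin a) ^ 2 := by
  have h1 : 0 < Real.sin a := by linarith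
  have h2 : 0 < Real.sin b := by linarith
  -- For the interpolation by solutions of `f'' + f = 0`, `p` and `p + J` are the slopes to the left
  -- and right of the middle point. Up to the error `e` caused by `J`, both forms are linear in `p²
  -- - y²` and `2 y p`, the real and imaginary parts of `(p + i y)²`. The system has determinant
  -- `sin (a + b)`, and `|p + i y|² = |(p + i y)²|` then bounds `y²`.
  set p := (y * Real.cos a - x) / Real.sin a with hp
  set J := (z - y * Real.cos b) / Real.sin b - p with hJ
  have hx : x = y * Real.cos a - p * Real.sin a := by rw [hp]; field_simp; ring
  have hz : z = y * Real.cos b + (p + J) * Real.sin b := by rw [hJ]; field_simp; ring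
  set Y1 := (p ^ 2 - y ^ 2) * Real.cos a + 2 * (y * p) * Real.sin a with hY1
  set Y2 := ((p + J) ^ 2 - y ^ 2) * Real.cos b - 2 * (y * (p + J)) * Real.sin b with hY2
  have q1 : cornerForm a x y = Real.sin a * Y1 := by
    rw [hx, hY1]; unfold cornerForm
    field_simp
    linear_combination (y ^ 2 * Real.cos a - 2 * y * p * Real.sin a) * Real.sin_sq_add_cos_sq a
  have q2 : cornerForm b y z = Real.sin b * Y2 := by
    rw [hz, hY2]; unfold cornerForm
    field_simp
    linear_combination (y ^ 2 * Real.cos b + 2 * y * (p + J) * Real.sin b) *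
      Real.sin_sq_add_cos_sq b
  set e := (2 * p * J + J ^ 2) * Real.cos b - 2 * y * J * Real.sin b with he
  have i1 : (p ^ 2 - y ^ 2) * Real.sin (a + b) = Y1 * Real.sin b + (Y2 - e) * Real.sin a := by
    rw [Real.sin_add, hY1, hY2, he]; ring
  have i2 : 2 * (y * p) * Real.sin (a + b) = Y1 * Real.cos b - (Y2 - e) * Real.cos a := by
    rw [Real.sin_add, hY1, hY2, he]; ring
  have ple : ∀ u v : ℝ, |v| ≤ 1 → |u * v| ≤ |u| := fun u v hv => by
    rw [abs_mul]; exact mul_le_of_le_one_right (abs_nonneg _) hv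
  have cE : |e| ≤ g / 8 * (p ^ 2 + y ^ 2) + 17 / g * J ^ 2 := by
    have t1 : |e| ≤ |2 * p * J + J ^ 2| + |2 * y * J| :=
      (abs_sub _ _).trans (add_le_add (ple _ _ (Real.abs_cos_le_one b))
        (ple _ _ (Real.abs_sin_le_one b)))
    have t0 : ∀ u : ℝ, |2 * u * J| ≤ g / 8 * u ^ 2 + 8 / g * J ^ 2 := fun u => by
      have e1 : g / 8 * u ^ 2 + 8 / g * J ^ 2 - 2 * u * J = (g * u - 8 * J) ^ 2 / (8 * g) := by
        field_simp; ring
      have e2 : g / 8 * u ^ 2 + 8 / g * J ^ 2 + 2 * u * J = (g * u + 8 * J) ^ 2 / (8 * g) := by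
        field_simp; ring
      have p1 : 0 ≤ (g * u - 8 * J) ^ 2 / (8 * g) := by positivity
      have p2 : 0 ≤ (g * u + 8 * J) ^ 2 / (8 * g) := by positivity
      rw [abs_le]; constructor <;> linarith
    have t2 : |2 * p * J + J ^ 2| ≤ |2 * p * J| + J ^ 2 := by
      refine (abs_add_le _ _).trans ?_
      rw [abs_of_nonneg (sq_nonneg J)]
    have t3 : J ^ 2 ≤ 1 / g * J ^ 2 :=
      le_mul_of_one_le_left (sq_nonneg _) (by rw [le_div_iff₀ hg]; linarith)
    have := t0 p
    have := t0 y
    have e5 : 17 / g * J ^ 2 = 8 / g * J ^ 2 + 8 / g * J ^ 2 + 1 / g * J ^ 2 := by ring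
    linarith
  have habs : p ^ 2 + y ^ 2 ≤ |p ^ 2 - y ^ 2| + |2 * (y * p)| := by
    refine abs_le_of_sq_le_sq' ?_ (by positivity) |>.2
    have := abs_nonneg (p ^ 2 - y ^ 2)
    have := abs_nonneg (2 * (y * p))
    have h5 := sq_abs (p ^ 2 - y ^ 2)
    have h6 := sq_abs (2 * (y * p))
    have h7 : 0 ≤ |p ^ 2 - y ^ 2| * |2 * (y * p)| := by positivity
    nlinarith
  have j1 : g * |p ^ 2 - y ^ 2| ≤ |Y1| + (|Y2| + |e|) := by
    calc g * |p ^ 2 - y ^ 2| ≤ |(p ^ 2 - y ^ 2) * Real.sin (a + b)| := by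
          rw [abs_mul, abs_of_pos (lt_of_lt_of_le hg hab), mul_comm]; gcongr
      _ ≤ _ := by
          rw [i1]
          refine (abs_add_le _ _).trans (add_le_add (ple _ _ (Real.abs_sin_le_one b))
            ((ple _ _ (Real.abs_sin_le_one a)).trans (abs_sub _ _)))
  have j2 : g * |2 * (y * p)| ≤ |Y1| + (|Y2| + |e|) := by
    calc g * |2 * (y * p)| ≤ |2 * (y * p) * Real.sin (a + b)| := by
          rw [abs_mul _ (Real.sin (a + b)), abs_of_pos (lt_of_lt_of_le hg hab),
            mul_comm]; gcongr
      _ ≤ _ := by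
          rw [i2]
          refine (abs_sub _ _).trans (add_le_add (ple _ _ (Real.abs_cos_le_one b))
            ((ple _ _ (Real.abs_cos_le_one a)).trans (abs_sub _ _)))
  have k1 : |Y1| ≤ 1 / s * |cornerForm a x y| := by
    rw [q1, abs_mul, abs_of_pos h1, ← mul_assoc]
    exact le_mul_of_one_le_left (abs_nonneg _) (by
      rw [one_div, inv_mul_eq_div, le_div_iff₀ hs]; linarith)
  have k2 : |Y2| ≤ 1 / s * |cornerForm b y z| := by
    rw [q2, abs_mul, abs_of_pos h2, ← mul_assoc]
    exact le_mul_of_one_le_left (abs_nonneg _) (by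
      rw [one_div, inv_mul_eq_div, le_div_iff₀ hs]; linarith)
  have l0 : g * (p ^ 2 + y ^ 2) ≤ g * |p ^ 2 - y ^ 2| + g * |2 * (y * p)| := by
    rw [← mul_add]; gcongr
  have e1 : 0 ≤ g * p ^ 2 := by positivity
  have e4 : 0 ≤ 1 / g * J ^ 2 := by positivity
  have e5 : 17 / g * J ^ 2 = 17 * (1 / g * J ^ 2) := by ring
  have l2 : g * y ^ 2 ≤ 4 * (1 / s * |cornerForm a x y| + 1 / s * |cornerForm b y z|) +
      48 * (1 / g * J ^ 2) := by
    have e2 : 0 ≤ |Y1| := abs_nonneg _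
    have e3 : 0 ≤ |Y2| := abs_nonneg _
    linarith
  calc y ^ 2 = 1 / g * (g * y ^ 2) := by field_simp
    _ ≤ 1 / g * (4 * (1 / s * |cornerForm a x y| + 1 / s * |cornerForm b y z|) +
      48 * (1 / g * J ^ 2)) := by gcongr
    _ = _ := by field_simp

theorem sum_range_add_of_periodic {n : ℕ} {f : ℕ → ℝ} (hf : ∀ s, f (s + n) = f s) (j : ℕ) :
    ∑ s ∈ Finset.range n, f (s + j) = ∑ s ∈ Finset.range n, f s := by
  induction j with
  | zero => simp
  | succ j ih =>
    rw [← ih]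
    have h1 := Finset.sum_range_succ (fun s => f (s + j)) n
    have h2 := Finset.sum_range_succ' (fun s => f (s + j)) n
    have h3 : f (n + j) = f j := by rw [add_comm, hf]
    simp only [h3, zero_add] at h1 h2
    have h4 : ∀ s, s + 1 + j = s + (j + 1) := fun s => by ring
    simp only [h4] at h2
    linarith

/-- A bound for a corner value by the forms around the vertex. -/
theorem sq_le_sum_cornerForm {n : ℕ} (hn : 2 ≤ n) {η : ℝ} (hη : 0 < η) (α X : ℕ → ℝ)
    (hα : ∀ s, α s ∈ Icc η (Real.pi / 2 - η))
    (hsum : ∑ s ∈ Finset.range n, α s = Real.pi) (hX : X n = -X 0) :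
    X 1 ^ 2 ≤ 4 / (Real.sin η * Real.sin η) *
        (|cornerForm (α 0) (X 0) (X 1)| + |cornerForm (α 1) (X 1) (X 2)|) +
      48 / Real.sin η ^ 2 * (2 / Real.sin η *
        ∑ s ∈ Finset.range n, cornerForm (α s) (X s) (X (s + 1))) := by
  have hη2 : η ≤ Real.pi / 4 := by have := hα 0; have := this.1.trans this.2; linarith
  have hpi := Real.pi_pos
  have hs : 0 < Real.sin η := Real.sin_pos_of_pos_of_lt_pi hη (by linarith)
  have hsin : ∀ s, Real.sin η ≤ Real.sin (α s) := fun s =>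
    Real.sin_le_sin_of_le_of_le_pi_div_two (by linarith) (by linarith [(hα s).2]) (hα s).1
  have hab : Real.sin η ≤ Real.sin (α 0 + α 1) := by
    rcases le_total (α 0 + α 1) (Real.pi / 2) with h | h
    · exact Real.sin_le_sin_of_le_of_le_pi_div_two (by linarith) h
        (by linarith [(hα 0).1, (hα 1).1])
    · rw [← Real.sin_pi_sub (α 0 + α 1)]
      exact Real.sin_le_sin_of_le_of_le_pi_div_two (by linarith) (by linarith)
        (by linarith [(hα 0).2, (hα 1).2])
  refine (sq_le_of_cornerForms hs hs (Real.sin_le_one η) (hsin 0) (hsin 1) hab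
    (X 0) (X 1) (X 2)).trans ?_
  set J := (X 2 - X 1 * Real.cos (α 1)) / Real.sin (α 1) -
    (X 1 * Real.cos (α 0) - X 0) / Real.sin (α 0) with hJ
  set Q := ∑ s ∈ Finset.range n, cornerForm (α s) (X s) (X (s + 1)) with hQ
  set A := Real.cos (α 0) / Real.sin (α 0) + Real.cos (α 1) / Real.sin (α 1) with hA
  have hα0 : ∀ s, 0 < α s := fun s => hη.trans_le (hα s).1
  have s0 : 0 < Real.sin (α 0) := hs.trans_le (hsin 0)
  have s1 : 0 < Real.sin (α 1) := hs.trans_le (hsin 1)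
  -- Moving only the value at index 1 keeps antiperiodicity, as `n ≥ 2`. The sum of the forms is
  -- thus a quadratic polynomial in `t` without negative values, and its discriminant bounds the
  -- jump `J`.
  have pert : ∀ t : ℝ, 0 ≤ Q - 2 * t * J + t ^ 2 * A := by
    intro t
    set X' : ℕ → ℝ := Function.update X 1 (X 1 + t) with hX'
    have h := sum_cornerForm_nonneg hn α X' hα0 hsum (by
      rw [hX', Function.update_of_ne (by omega), Function.update_of_ne (by omega), hX])
    obtain ⟨k, rfl⟩ : ∃ k, n = k + 2 := ⟨n - 2, by omega⟩
    rw [Finset.sum_range_succ', Finset.sum_range_succ'] at h hQ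
    have hrest : ∀ s, cornerForm (α (s + 1 + 1)) (X' (s + 1 + 1)) (X' (s + 1 + 1 + 1)) =
        cornerForm (α (s + 1 + 1)) (X (s + 1 + 1)) (X (s + 1 + 1 + 1)) := fun s => by
      rw [hX', Function.update_of_ne (by omega), Function.update_of_ne (by omega)]
    simp only [hrest] at h
    have v0 : X' 0 = X 0 := by rw [hX', Function.update_of_ne (by omega)]
    have v1 : X' 1 = X 1 + t := by rw [hX', Function.update_self]
    have v2 : X' 2 = X 2 := by rw [hX', Function.update_of_ne (by omega)]
    simp only [zero_add, Nat.reduceAdd, v0, v1, v2] at h hQ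
    have e : cornerForm (α 1) (X 1 + t) (X 2) + cornerForm (α 0) (X 0) (X 1 + t) =
        cornerForm (α 1) (X 1) (X 2) + cornerForm (α 0) (X 0) (X 1) - 2 * t * J + t ^ 2 * A := by
      rw [hJ, hA]; unfold cornerForm; field_simp; ring
    linarith
  have hApos : 0 < A := by
    have c0 : 0 < Real.cos (α 0) := Real.cos_pos_of_mem_Ioo ⟨by linarith [hα0 0],
      by linarith [(hα 0).2]⟩
    have c1 : 0 < Real.cos (α 1) := Real.cos_pos_of_mem_Ioo ⟨by linarith [hα0 1],
      by linarith [(hα 1).2]⟩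
    positivity
  have hJQ : J ^ 2 ≤ A * Q := by
    have h := pert (J / A)
    have e : Q - 2 * (J / A) * J + (J / A) ^ 2 * A = (A * Q - J ^ 2) / A := by field_simp; ring
    rw [e, le_div_iff₀ hApos] at h
    linarith
  have hQ0 : 0 ≤ Q := by have := pert 0; linarith
  have hA2 : A ≤ 2 / Real.sin η := by
    have b : ∀ s, Real.cos (α s) / Real.sin (α s) ≤ 1 / Real.sin η := fun s =>
      div_le_div₀ (by norm_num) (Real.cos_le_one _) hs (hsin s)
    have := b 0
    have := b 1
    have e : 2 / Real.sin η = 1 / Real.sin η + 1 / Real.sin η := by ring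
    linarith
  gcongr
  exact hJQ.trans (by gcongr)

/-- Approximate subharmonicity at a vertex: if the corner values `X` are related to `B` by the
forms of the angles `ψ` close to `α`, then `∑ sin α B` is almost non-negative. -/
theorem sum_sin_mul_ge {η : ℝ} (hη : 0 < η) : ∃ C κ₀ : ℝ, 0 < C ∧ 0 < κ₀ ∧ κ₀ ≤ η / 2 ∧
    ∀ (n : ℕ) (α ψ B X : ℕ → ℝ) (κ : ℝ), κ ≤ κ₀ →
      (∀ s, α s ∈ Icc η (Real.pi / 2 - η)) → (∀ s, α (s + n) = α s) → (∀ s, B (s + n) = B s) →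
      (∀ s, X (s + n) = -X s) → ∑ s ∈ Finset.range n, α s = Real.pi →
      (∀ s, |ψ s - α s| ≤ κ) →
      (∀ s, Real.sin (ψ s) * B s = cornerForm (ψ s) (X s) (X (s + 1))) →
      -(C * κ * ∑ s ∈ Finset.range n, |B s|) ≤ ∑ s ∈ Finset.range n, Real.sin (α s) * B s := by
  have hpi := Real.pi_pos
  by_cases hη2 : η ≤ Real.pi / 4
  swap
  · refine ⟨1, η / 2, one_pos, by linarith, le_rfl, fun n α ψ B X κ _ hα => ?_⟩
    exfalso
    have := (hα 0).1.trans (hα 0).2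
    linarith
  have hs : 0 < Real.sin (η / 2) := Real.sin_pos_of_pos_of_lt_pi (by linarith) (by linarith)
  have hsη : 0 < Real.sin η := Real.sin_pos_of_pos_of_lt_pi hη (by linarith)
  set C₁ := 2 / Real.sin (η / 2) ^ 2 with hC₁
  set K₁ := 4 / (Real.sin η * Real.sin η) with hK₁
  set K₂ := 48 / Real.sin η ^ 2 * (2 / Real.sin η) with hK₂
  set N := Real.pi / η with hN
  have pC : 0 < C₁ := by positivity
  have pK : 0 < K₁ := by positivity
  have pK2 : 0 < K₂ := by positivity
  have pN : 0 < N := by positivity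
  -- The second threshold absorbs the part of `∑ X²` that returns on the right of its own bound; the
  -- third makes the multiple of the non-negative sum `Q` of the unperturbed forms that is lost at
  -- most `Q` itself. `N` bounds the number of sectors, since each has half-angle at least `η`.
  refine ⟨8 * C₁ * K₁ + 1, min (η / 2) (min (1 / (8 * K₁ * C₁)) (1 / (4 * C₁ * N * K₂))),
    by positivity, by positivity, min_le_left _ _, ?_⟩
  intro n α ψ B X κ hκ hα hαn hBn hXn hsum hψ hB
  have hκ0 : 0 ≤ κ := (abs_nonneg _).trans (hψ 0)
  have hκη : κ ≤ η / 2 := hκ.trans (min_le_left _ _)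
  have hκ1 : κ * (8 * K₁ * C₁) ≤ 1 := by
    rw [← le_div_iff₀ (by positivity)]
    exact hκ.trans ((min_le_right _ _).trans (min_le_left _ _))
  have hκ2 : κ * (4 * C₁ * N * K₂) ≤ 1 := by
    rw [← le_div_iff₀ (by positivity)]
    exact hκ.trans ((min_le_right _ _).trans (min_le_right _ _))
  have hn : 2 ≤ n := by
    by_contra hn
    have : n = 0 ∨ n = 1 := by omega
    rcases this with rfl | rfl
    · simp at hsum; linarith
    · simp at hsum; linarith [(hα 0).2]
  have hnN : (n : ℝ) ≤ N := by
    rw [hN, le_div_iff₀ hη, ← hsum]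
    have := Finset.card_nsmul_le_sum (Finset.range n) α η (fun s _ => (hα s).1)
    simpa using this
  have hsin : ∀ s, Real.sin (η / 2) ≤ Real.sin (α s) := fun s =>
    Real.sin_le_sin_of_le_of_le_pi_div_two (by linarith) (by linarith [(hα s).2])
      (by linarith [(hα s).1])
  have hsinψ : ∀ s, Real.sin (η / 2) ≤ Real.sin (ψ s) := fun s => by
    have h1 := abs_le.1 (hψ s)
    exact Real.sin_le_sin_of_le_of_le_pi_div_two (by linarith) (by linarith [(hα s).2])
      (by linarith [(hα s).1])
  set q : ℕ → ℝ := fun s => cornerForm (α s) (X s) (X (s + 1)) with hq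
  have hX2 : ∀ s, X (s + n) ^ 2 = X s ^ 2 := fun s => by rw [hXn]; ring
  have hqn : ∀ s, q (s + n) = q s := fun s => by
    have e : s + n + 1 = s + 1 + n := by ring
    simp only [hq, hαn, e, hXn]
    unfold cornerForm; ring
  set Q := ∑ s ∈ Finset.range n, q s with hQ
  set T := ∑ s ∈ Finset.range n, X s ^ 2 with hT
  set SB := ∑ s ∈ Finset.range n, |B s| with hSB
  have hT1 : ∑ s ∈ Finset.range n, X (s + 1) ^ 2 = T :=
    sum_range_add_of_periodic (f := fun s => X s ^ 2) hX2 1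
  have hd : ∀ s, |Real.sin (ψ s) * B s - q s| ≤ C₁ * κ * (X s ^ 2 + X (s + 1) ^ 2) := fun s => by
    rw [hB]
    refine (abs_cornerForm_sub_le hs (hsinψ s) (hsin s) (hψ s) _ _).trans (le_of_eq ?_)
    rw [hC₁]; ring
  have hqB : ∀ s, |q s| ≤ |B s| + C₁ * κ * (X s ^ 2 + X (s + 1) ^ 2) := fun s => by
    have h1 : |Real.sin (ψ s) * B s| ≤ |B s| := by
      rw [abs_mul]; exact mul_le_of_le_one_left (abs_nonneg _) (Real.abs_sin_le_one _)
    have h2 := abs_sub_abs_le_abs_sub (q s) (Real.sin (ψ s) * B s)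
    rw [abs_sub_comm] at h2
    linarith [hd s]
  -- The bound for the value at index 1, applied to the fan shifted by `j`; periodicity keeps the
  -- total angle and `Q` the same.
  have hXb : ∀ j, X (j + 1) ^ 2 ≤ K₁ * (|q j| + |q (j + 1)|) + K₂ * Q := fun j => by
    have := sq_le_sum_cornerForm hn hη (fun s => α (s + j)) (fun s => X (s + j))
      (fun s => hα _) ((sum_range_add_of_periodic hαn j).trans hsum)
      (by simp only [zero_add]; rw [add_comm n j, hXn])
    have e1 : ∑ s ∈ Finset.range n, cornerForm (α (s + j)) (X (s + j)) (X (s + 1 + j)) = Q := by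
      rw [hQ, ← sum_range_add_of_periodic hqn j]
      refine Finset.sum_congr rfl fun s _ => ?_
      simp only [hq]
      rw [show s + 1 + j = s + j + 1 by ring]
    rw [e1] at this
    simp only [zero_add, add_comm 1 j, add_comm 2 j, ← mul_assoc] at this
    exact this
  have hQ0 : 0 ≤ Q := sum_cornerForm_nonneg hn α X (fun s => hη.trans_le (hα s).1) hsum
    (by simpa using hXn 0)
  have hSq : ∑ s ∈ Finset.range n, |q s| ≤ SB + C₁ * κ * (T + T) := by
    refine (Finset.sum_le_sum fun s _ => hqB s).trans (le_of_eq ?_)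
    rw [Finset.sum_add_distrib, ← Finset.mul_sum, Finset.sum_add_distrib, hT1]
  have hSB0 : 0 ≤ SB := Finset.sum_nonneg fun s _ => abs_nonneg _
  have hT0 : 0 ≤ T := Finset.sum_nonneg fun s _ => sq_nonneg _
  have hTb : T ≤ K₁ * (2 * ∑ s ∈ Finset.range n, |q s|) + N * (K₂ * Q) := by
    calc T = ∑ s ∈ Finset.range n, X (s + 1) ^ 2 := hT1.symm
      _ ≤ ∑ s ∈ Finset.range n, (K₁ * (|q s| + |q (s + 1)|) + K₂ * Q) :=
          Finset.sum_le_sum fun s _ => hXb s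
      _ = K₁ * (2 * ∑ s ∈ Finset.range n, |q s|) + n * (K₂ * Q) := by
          rw [Finset.sum_add_distrib, ← Finset.mul_sum, Finset.sum_add_distrib,
            sum_range_add_of_periodic (f := fun s => |q s|) (fun s => by rw [hqn]) 1]
          rw [Finset.sum_const, Finset.card_range, nsmul_eq_mul]; ring
      _ ≤ _ := by gcongr
  have hTb2 : T ≤ 4 * K₁ * SB + 2 * N * K₂ * Q := by
    have h1 : K₁ * (2 * ∑ s ∈ Finset.range n, |q s|) ≤ K₁ * (2 * (SB + C₁ * κ * (T + T))) := by
      gcongr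
    have h2 : κ * (8 * K₁ * C₁) * T ≤ 1 * T := by gcongr
    nlinarith
  have hterm : ∀ s, q s - C₁ * κ * (X s ^ 2 + X (s + 1) ^ 2) - κ * |B s| ≤
      Real.sin (α s) * B s := fun s => by
    have h1 := (abs_le.1 (hd s)).1
    have h2 : |(Real.sin (ψ s) - Real.sin (α s)) * B s| ≤ κ * |B s| := by
      rw [abs_mul]; gcongr
      exact (Real.abs_sin_sub_sin_le _ _).trans (hψ s)
    have h3 := (abs_le.1 h2).2
    linarith
  have hfin := Finset.sum_le_sum fun s (_ : s ∈ Finset.range n) => hterm s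
  rw [Finset.sum_sub_distrib, Finset.sum_sub_distrib, ← Finset.mul_sum, ← Finset.mul_sum,
    Finset.sum_add_distrib, hT1] at hfin
  refine le_trans ?_ hfin
  have h1 : C₁ * κ * (T + T) ≤ C₁ * κ * (2 * (4 * K₁ * SB + 2 * N * K₂ * Q)) := by
    rw [← two_mul]; gcongr
  have h2 : κ * (4 * C₁ * N * K₂) * Q ≤ 1 * Q := by gcongr
  nlinarith

/-! ### The elliptic parametrisation for small modulus -/

theorem one_sub_mul_sin_sq_pos {k : ℝ} (hk : k ^ 2 < 1) (θ : ℝ) :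
    0 < 1 - k ^ 2 * Real.sin θ ^ 2 := by
  nlinarith [Real.sin_sq_le_one θ, sq_nonneg (Real.sin θ), sq_nonneg k]

theorem continuous_elliptic_integrand {k : ℝ} (hk : k ^ 2 < 1) :
    Continuous fun θ : ℝ => 1 / Real.sqrt (1 - k ^ 2 * Real.sin θ ^ 2) := by
  refine continuous_const.div (by fun_prop) fun θ => ?_
  exact (Real.sqrt_pos.2 (one_sub_mul_sin_sq_pos hk θ)).ne'

theorem one_le_elliptic_integrand {k : ℝ} (hk : k ^ 2 < 1) (θ : ℝ) :
    1 ≤ 1 / Real.sqrt (1 - k ^ 2 * Real.sin θ ^ 2) := by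
  rw [le_div_iff₀ (Real.sqrt_pos.2 (one_sub_mul_sin_sq_pos hk θ)), one_mul]
  refine Real.sqrt_le_one.2 ?_
  nlinarith [sq_nonneg (k * Real.sin θ)]

theorem elliptic_integrand_le {k : ℝ} (hk : k ^ 2 ≤ 1 / 2) (θ : ℝ) :
    1 / Real.sqrt (1 - k ^ 2 * Real.sin θ ^ 2) ≤ 1 + k ^ 2 := by
  have hpos := one_sub_mul_sin_sq_pos (by linarith : k ^ 2 < 1) θ
  rw [div_le_iff₀ (Real.sqrt_pos.2 hpos)]
  have h0 : 0 ≤ k ^ 2 := sq_nonneg k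
  have h1 : k ^ 2 * Real.sin θ ^ 2 ≤ k ^ 2 :=
    mul_le_of_le_one_right h0 (Real.sin_sq_le_one θ)
  have h2 : (1 : ℝ) ≤ Real.sqrt ((1 + k ^ 2) ^ 2 * (1 - k ^ 2 * Real.sin θ ^ 2)) := by
    rw [Real.one_le_sqrt]
    have : (1 + k ^ 2) ^ 2 * (1 - k ^ 2) ≤ (1 + k ^ 2) ^ 2 * (1 - k ^ 2 * Real.sin θ ^ 2) := by
      gcongr
    refine le_trans ?_ this
    nlinarith [mul_nonneg h0 (by linarith : 0 ≤ 1 / 2 - k ^ 2),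
      mul_nonneg (mul_nonneg h0 h0) (by linarith : 0 ≤ 1 / 2 - k ^ 2)]
  rwa [Real.sqrt_mul (by positivity), Real.sqrt_sq (by positivity)] at h2

theorem le_ellipticU {k φ : ℝ} (hk : k ^ 2 < 1) (hφ : 0 ≤ φ) : φ ≤ ellipticU φ k := by
  have := intervalIntegral.integral_mono_on (μ := MeasureTheory.volume) hφ
    (continuous_const (y := (1 : ℝ)).intervalIntegrable 0 φ)
    ((continuous_elliptic_integrand hk).intervalIntegrable 0 φ)
    (fun θ _ => one_le_elliptic_integrand hk θ)
  simpa [ellipticU] using this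

theorem ellipticU_le {k φ : ℝ} (hk : k ^ 2 ≤ 1 / 2) (hφ : 0 ≤ φ) :
    ellipticU φ k ≤ (1 + k ^ 2) * φ := by
  have := intervalIntegral.integral_mono_on (μ := MeasureTheory.volume) hφ
    ((continuous_elliptic_integrand (by linarith)).intervalIntegrable 0 φ)
    (continuous_const (y := (1 + k ^ 2 : ℝ)).intervalIntegrable 0 φ)
    (fun θ _ => elliptic_integrand_le hk θ)
  rw [intervalIntegral.integral_const, sub_zero, smul_eq_mul, mul_comm] at this
  exact this

theorem continuous_ellipticU {k : ℝ} (hk : k ^ 2 < 1) : Continuous fun φ => ellipticU φ k :=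
  intervalIntegral.continuous_primitive
    (fun a b => (continuous_elliptic_integrand hk).intervalIntegrable a b) 0

theorem abstractAngle_spec {k θ : ℝ} (hk : k ^ 2 < 1) (h0 : 0 ≤ θ) (h1 : θ ≤ Real.pi / 2) :
    abstractAngle k θ ∈ Icc 0 (Real.pi / 2) ∧
      ellipticU (abstractAngle k θ) k = ellipticK k / (Real.pi / 2) * θ := by
  have hpi := Real.pi_pos
  have hK : 0 ≤ ellipticK k := (by positivity : 0 ≤ Real.pi / 2).trans (le_ellipticU hk (by positivity))
  have hex : ∃ φ ∈ Icc 0 (Real.pi / 2), ellipticU φ k = ellipticK k / (Real.pi / 2) * θ := by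
    refine intermediate_value_Icc (by positivity) (continuous_ellipticU hk).continuousOn ⟨?_, ?_⟩
    · simp only [ellipticU, intervalIntegral.integral_same]; positivity
    · change _ ≤ ellipticK k
      rw [div_mul_eq_mul_div, div_le_iff₀ (by positivity)]
      gcongr
  exact ⟨Function.invFunOn_mem hex, Function.invFunOn_eq hex⟩

/-- The integrand of `u` lies between `1` and `1 + k²`, so `u(φ | k)` and `K(k) / (π / 2)` are
linear, resp. `1`, up to a factor in `[1, 1 + k²]`. The 2 bounds `π / 2`. -/
theorem abs_abstractAngle_sub_le {k θ : ℝ} (hk : k ^ 2 ≤ 1 / 2) (h0 : 0 ≤ θ)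
    (h1 : θ ≤ Real.pi / 2) : |abstractAngle k θ - θ| ≤ 2 * k ^ 2 := by
  have hpi := Real.pi_pos
  have hpi4 := Real.pi_lt_four
  have hk1 : k ^ 2 < 1 := by linarith
  have hk0 := sq_nonneg k
  obtain ⟨⟨ha0, ha1⟩, ha⟩ := abstractAngle_spec hk1 h0 h1
  set a := abstractAngle k θ
  have hK1 : Real.pi / 2 ≤ ellipticK k := le_ellipticU hk1 (by positivity)
  have hK2 : ellipticK k ≤ (1 + k ^ 2) * (Real.pi / 2) := ellipticU_le hk (by positivity)
  have l1 : 1 ≤ ellipticK k / (Real.pi / 2) := by rwa [le_div_iff₀ (by positivity), one_mul]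
  have l2 : ellipticK k / (Real.pi / 2) ≤ 1 + k ^ 2 := by rwa [div_le_iff₀ (by positivity)]
  have u1 := le_ellipticU hk1 ha0
  have u2 := ellipticU_le hk ha0
  rw [ha] at u1 u2
  have m1 : ellipticK k / (Real.pi / 2) * θ ≤ (1 + k ^ 2) * θ := by gcongr
  have m2 : 1 * θ ≤ ellipticK k / (Real.pi / 2) * θ := by gcongr
  have n1 : k ^ 2 * θ ≤ k ^ 2 * 2 := by gcongr; linarith
  have n2 : k ^ 2 * a ≤ k ^ 2 * 2 := by gcongr; linarith
  rw [abs_le]; constructor <;> linarith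

theorem one_div_sin_le {t : ℝ} (h0 : 0 < t) (h1 : t ≤ Real.pi / 2) :
    1 / Real.sin t ≤ 1 / t + 1 := by
  have hpi4 := Real.pi_lt_four
  have hs : 0 < Real.sin t := Real.sin_pos_of_pos_of_lt_pi h0 (by linarith)
  have key : t ≤ Real.sin t * (1 + t) := by
    rcases le_total t 1 with h | h
    · have := Real.sin_gt_sub_cube h0
      nlinarith [pow_pos h0 2, pow_pos h0 3, mul_nonneg (pow_pos h0 2).le (by linarith : 0 ≤ 1 - t),
        mul_nonneg (pow_pos h0 3).le (by linarith : 0 ≤ 1 - t)]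
    · have h2 : Real.sin 1 ≤ Real.sin t :=
        Real.sin_le_sin_of_le_of_le_pi_div_two (by linarith) h1 h
      have := Real.sin_gt_sub_cube one_pos
      nlinarith
  rw [div_add' _ _ _ h0.ne', div_le_div_iff₀ hs h0]
  linarith

/-- With `t = π / 2 - θ` the integrand becomes `(sin² t + k² cos² t)^(-1/2)`. It is at most `1 / k`
on `[0, k]`, which contributes at most 1, and at most `1 / sin t ≤ 1 / t + 1` beyond, which
contributes the logarithm. -/
theorem ellipticK_complementary_le {k : ℝ} (h0 : 0 < k) (h1 : k < 1) :
    ellipticK (Real.sqrt (1 - k ^ 2)) ≤ Real.log (1 / k) + 4 := by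
  have hpi4 := Real.pi_lt_four
  have hpi3 := Real.pi_gt_three
  have hk2 : 0 < 1 - k ^ 2 := by nlinarith
  have hsq : Real.sqrt (1 - k ^ 2) ^ 2 = 1 - k ^ 2 := Real.sq_sqrt hk2.le
  have hlt : Real.sqrt (1 - k ^ 2) ^ 2 < 1 := by rw [hsq]; nlinarith
  set f : ℝ → ℝ := fun t => 1 / Real.sqrt (1 - Real.sqrt (1 - k ^ 2) ^ 2 * Real.sin t ^ 2) with hf
  have hfc : Continuous f := continuous_elliptic_integrand hlt
  have hgc : Continuous fun t => f (Real.pi / 2 - t) := by fun_prop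
  have e1 : ellipticK (Real.sqrt (1 - k ^ 2)) = ∫ t in (0 : ℝ)..(Real.pi / 2), f (Real.pi / 2 - t) := by
    rw [intervalIntegral.integral_comp_sub_left f (Real.pi / 2)]
    simp [ellipticK, ellipticU, hf]
  have hval : ∀ t, f (Real.pi / 2 - t) =
      1 / Real.sqrt (Real.sin t ^ 2 + k ^ 2 * Real.cos t ^ 2) := fun t => by
    simp only [hf]
    rw [hsq, Real.sin_pi_div_two_sub]
    congr 2
    linear_combination - Real.sin_sq_add_cos_sq t
  have b1 : ∫ t in (0 : ℝ)..k, f (Real.pi / 2 - t) ≤ ∫ t in (0 : ℝ)..k, 1 / k := by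
    refine intervalIntegral.integral_mono_on h0.le (hgc.intervalIntegrable _ _)
      (continuous_const.intervalIntegrable _ _) fun t _ => ?_
    rw [hval]
    refine one_div_le_one_div_of_le h0 (Real.le_sqrt_of_sq_le ?_)
    nlinarith [Real.sin_sq_add_cos_sq t, sq_nonneg (Real.sin t)]
  have hvint : IntervalIntegrable (fun t : ℝ => 1 / t + 1) MeasureTheory.volume k (Real.pi / 2) := by
    refine ContinuousOn.intervalIntegrable fun t ht => ?_
    rw [uIcc_of_le (by linarith)] at ht
    have : t ≠ 0 := by have := ht.1; linarith
    exact ContinuousAt.continuousWithinAt (by fun_prop (disch := assumption))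
  have b2 : ∫ t in k..(Real.pi / 2), f (Real.pi / 2 - t) ≤ ∫ t in k..(Real.pi / 2), (1 / t + 1) := by
    refine intervalIntegral.integral_mono_on (by linarith) (hgc.intervalIntegrable _ _)
      hvint fun t ht => ?_
    have ht0 : 0 < t := h0.trans_le ht.1
    refine le_trans ?_ (one_div_sin_le ht0 ht.2)
    rw [hval]
    have hs : 0 < Real.sin t := Real.sin_pos_of_pos_of_lt_pi ht0 (by linarith [ht.2])
    refine one_div_le_one_div_of_le hs (Real.le_sqrt_of_sq_le ?_)
    nlinarith [sq_nonneg (k * Real.cos t)]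
  have b3 : ∫ t in k..(Real.pi / 2), (1 / t + 1) =
      Real.log (Real.pi / 2 / k) + (Real.pi / 2 - k) := by
    rw [intervalIntegral.integral_add, integral_one_div_of_pos h0 (by linarith)]
    · simp
    · refine ContinuousOn.intervalIntegrable fun t ht => ?_
      rw [uIcc_of_le (by linarith)] at ht
      have : t ≠ 0 := by have := ht.1; linarith
      exact ContinuousAt.continuousWithinAt (by fun_prop (disch := assumption))
    · exact continuous_const.intervalIntegrable _ _
  have b4 : ∫ t in (0 : ℝ)..k, 1 / k = 1 := by
    rw [intervalIntegral.integral_const]; simp [h0.ne']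
  have b5 : Real.log (Real.pi / 2 / k) ≤ Real.log (1 / k) + 1 := by
    rw [div_eq_mul_one_div (Real.pi / 2) k, Real.log_mul (by positivity) (by positivity)]
    have := Real.log_le_sub_one_of_pos (by positivity : 0 < Real.pi / 2)
    linarith
  rw [e1, ← intervalIntegral.integral_add_adjacent_intervals (hgc.intervalIntegrable 0 k)
    (hgc.intervalIntegrable k _)]
  rw [b4] at b1
  rw [b3] at b2
  linarith

/-- Since `K ≥ π / 2`, the nome is at least `exp (-2 K')`, and the logarithmic bound for `K'` turns
this into a multiple of `k²`. Thus the nome controls the deviation of the virtual angles. -/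
theorem sq_le_nome {k : ℝ} (h0 : 0 ≤ k) (h1 : k < 1) : k ^ 2 ≤ Real.exp 8 * nome k := by
  rcases h0.eq_or_lt with rfl | h0
  · simp [nome]
  have hpi := Real.pi_pos
  have hk1 : k ^ 2 < 1 := by nlinarith
  have hK : Real.pi / 2 ≤ ellipticK k := le_ellipticU hk1 (by positivity)
  have hK' := ellipticK_complementary_le h0 h1
  have hsq : Real.sqrt (1 - k ^ 2) ^ 2 < 1 := by
    rw [Real.sq_sqrt (by linarith)]; nlinarith
  have hK'0 : 0 ≤ ellipticK (Real.sqrt (1 - k ^ 2)) :=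
    (by positivity : 0 ≤ Real.pi / 2).trans (le_ellipticU hsq (by positivity))
  rw [nome, if_neg h0.ne', ← Real.exp_add]
  have e : k ^ 2 = Real.exp (-(2 * Real.log (1 / k))) := by
    rw [one_div, Real.log_inv, mul_neg, neg_neg, mul_comm, Real.exp_mul, Real.exp_log h0]
    norm_cast
  refine e.trans_le ?_
  rw [Real.exp_le_exp]
  have : Real.pi * ellipticK (Real.sqrt (1 - k ^ 2)) / ellipticK k ≤
      2 * ellipticK (Real.sqrt (1 - k ^ 2)) := by
    rw [div_le_iff₀ (by linarith)]
    nlinarith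
  rw [neg_mul, neg_div]
  linarith

namespace IsoradialLattice

variable {δ : ℝ} (L : IsoradialLattice δ)

/-! ### Rhombi in the coordinates of a vertex -/

/-- The first side at the `i`-th vertex of `z`, in counterclockwise order, as a vector. -/
def side₁ (z : L.E) (i : Fin 4) : ℂ := L.vert z (i + 1) - L.vert z i

/-- The second side at the `i`-th vertex of `z`, in counterclockwise order, as a vector. -/
def side₂ (z : L.E) (i : Fin 4) : ℂ := L.vert z (i + 3) - L.vert z i

/-- The oriented area of the parallelogram spanned by two vectors. -/
def cross (a b : ℂ) : ℝ := a.re * b.im - a.im * b.re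

theorem vert_add_two (z : L.E) (i : Fin 4) :
    L.vert z (i + 2) = L.vert z i + L.side₁ z i + L.side₂ z i := by
  have h := L.parallelogram z
  unfold side₁ side₂
  fin_cases i <;> simp <;> first | linear_combination h | linear_combination -h

theorem side₁_succ (z : L.E) (i : Fin 4) : L.side₁ z (i + 1) = L.side₂ z i := by
  have h := L.vert_add_two z i
  unfold side₁ side₂ at *
  rw [add_assoc, show (1 : Fin 4) + 1 = 2 from rfl, h]; ring

theorem side₂_succ (z : L.E) (i : Fin 4) : L.side₂ z (i + 1) = -L.side₁ z i := by
  unfold side₁ side₂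
  rw [add_assoc, show (1 : Fin 4) + 3 = 0 from rfl, add_zero]; ring

theorem fin4_induction {p : Fin 4 → Prop} (h0 : p 0) (h : ∀ i, p i → p (i + 1)) (i : Fin 4) :
    p i := by
  have h1 := h 0 h0
  have h2 := h 1 h1
  have h3 := h 2 h2
  fin_cases i <;> assumption

theorem fin4_cases : ∀ i j : Fin 4, j = i ∨ j = i + 1 ∨ j = i + 2 ∨ j = i + 3 := by decide

theorem cross_sides_pos (z : L.E) (i : Fin 4) : 0 < cross (L.side₁ z i) (L.side₂ z i) := by
  induction i using fin4_induction with
  | h0 =>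
    have h := L.counterclockwise z
    simp only [mul_im, conj_re, conj_im] at h
    simp only [cross, side₁, side₂, zero_add]
    linarith
  | h i ih =>
    rw [side₁_succ, side₂_succ]
    simp only [cross, neg_re, neg_im] at *
    linarith

/-- The coordinate of `x` along the first side at the `i`-th vertex. -/
def cs (z : L.E) (i : Fin 4) (x : ℂ) : ℝ :=
  cross (x - L.vert z i) (L.side₂ z i) / cross (L.side₁ z i) (L.side₂ z i)

/-- The coordinate of `x` along the second side at the `i`-th vertex. -/
def ct (z : L.E) (i : Fin 4) (x : ℂ) : ℝ :=
  cross (L.side₁ z i) (x - L.vert z i) / cross (L.side₁ z i) (L.side₂ z i)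

theorem eq_coord (z : L.E) (i : Fin 4) (x : ℂ) :
    x = L.vert z i + L.cs z i x * L.side₁ z i + L.ct z i x * L.side₂ z i := by
  have h := (L.cross_sides_pos z i).ne'
  unfold cs ct
  generalize L.side₁ z i = a at *
  generalize L.side₂ z i = b at *
  generalize L.vert z i = v
  obtain ⟨K, hK⟩ : ∃ K, K = cross a b := ⟨_, rfl⟩
  rw [← hK] at h ⊢
  unfold cross at *
  apply Complex.ext
  · simp only [add_re, mul_re, ofReal_re, ofReal_im, sub_re, sub_im]
    field_simp; rw [hK]; ring
  · simp only [add_im, mul_im, ofReal_re, ofReal_im, sub_re, sub_im]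
    field_simp; rw [hK]; ring

theorem cs_coord (z : L.E) (i : Fin 4) (s t : ℝ) :
    L.cs z i (L.vert z i + s * L.side₁ z i + t * L.side₂ z i) = s := by
  have h := (L.cross_sides_pos z i).ne'
  unfold cs
  rw [div_eq_iff h]
  simp [cross]; ring

theorem ct_coord (z : L.E) (i : Fin 4) (s t : ℝ) :
    L.ct z i (L.vert z i + s * L.side₁ z i + t * L.side₂ z i) = t := by
  have h := (L.cross_sides_pos z i).ne'
  unfold ct
  rw [div_eq_iff h]
  simp [cross]; ring

/-- This turns statements about the four vertices into a cyclic induction from a single one. -/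
theorem coord_succ (z : L.E) (i : Fin 4) (x : ℂ) :
    L.cs z (i + 1) x = L.ct z i x ∧ L.ct z (i + 1) x = 1 - L.cs z i x := by
  have h := L.eq_coord z i x
  have h' : x = L.vert z (i + 1) + (L.ct z i x : ℝ) * L.side₁ z (i + 1) +
      ((1 - L.cs z i x : ℝ) : ℂ) * L.side₂ z (i + 1) := by
    rw [side₁_succ, side₂_succ]
    have : L.vert z (i + 1) = L.vert z i + L.side₁ z i := by unfold side₁; ring
    rw [this]
    conv_lhs => rw [h]
    push_cast; ring
  constructor
  · conv_lhs => rw [h']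
    exact L.cs_coord z (i + 1) _ _
  · conv_lhs => rw [h']
    exact L.ct_coord z (i + 1) _ _

theorem continuous_cs (z : L.E) (i : Fin 4) : Continuous (L.cs z i) := by
  unfold cs cross; fun_prop

theorem continuous_ct (z : L.E) (i : Fin 4) : Continuous (L.ct z i) := by
  unfold ct cross; fun_prop

theorem coord_vert (z : L.E) (i : Fin 4) : L.cs z i (L.vert z i) = 0 ∧ L.ct z i (L.vert z i) = 0 ∧
    L.cs z i (L.vert z (i + 1)) = 1 ∧ L.ct z i (L.vert z (i + 1)) = 0 ∧
    L.cs z i (L.vert z (i + 2)) = 1 ∧ L.ct z i (L.vert z (i + 2)) = 1 ∧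
    L.cs z i (L.vert z (i + 3)) = 0 ∧ L.ct z i (L.vert z (i + 3)) = 1 := by
  have h0 : L.vert z i = L.vert z i + (0 : ℝ) * L.side₁ z i + (0 : ℝ) * L.side₂ z i := by simp
  have h1 : L.vert z (i + 1) = L.vert z i + (1 : ℝ) * L.side₁ z i + (0 : ℝ) * L.side₂ z i := by
    simp [side₁]
  have h2 : L.vert z (i + 2) = L.vert z i + (1 : ℝ) * L.side₁ z i + (1 : ℝ) * L.side₂ z i := by
    simp [vert_add_two]
  have h3 : L.vert z (i + 3) = L.vert z i + (0 : ℝ) * L.side₁ z i + (1 : ℝ) * L.side₂ z i := by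
    simp [side₂]
  refine ⟨?_, ?_, ?_, ?_, ?_, ?_, ?_, ?_⟩
  · conv_lhs => rw [h0, cs_coord]
  · conv_lhs => rw [h0, ct_coord]
  · conv_lhs => rw [h1, cs_coord]
  · conv_lhs => rw [h1, ct_coord]
  · conv_lhs => rw [h2, cs_coord]
  · conv_lhs => rw [h2, ct_coord]
  · conv_lhs => rw [h3, cs_coord]
  · conv_lhs => rw [h3, ct_coord]

theorem vert_injective (z : L.E) : Function.Injective (L.vert z) := by
  intro i j hij
  obtain ⟨a0, b0, a1, b1, a2, b2, a3, b3⟩ := L.coord_vert z i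
  rcases fin4_cases i j with rfl | rfl | rfl | rfl
  · rfl
  · rw [← hij, a0] at a1; norm_num at a1
  · rw [← hij, a0] at a2; norm_num at a2
  · rw [← hij, b0] at b3; norm_num at b3

/-- The closed rhombus. -/
def hull (z : L.E) : Set ℂ := convexHull ℝ (range (L.vert z))

/-- The open rhombus. -/
def openRhombus (z : L.E) : Set ℂ :=
  {x | 0 < L.cs z 0 x ∧ L.cs z 0 x < 1 ∧ 0 < L.ct z 0 x ∧ L.ct z 0 x < 1}

theorem mem_openRhombus {z : L.E} (i : Fin 4) {x : ℂ} : x ∈ L.openRhombus z ↔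
    0 < L.cs z i x ∧ L.cs z i x < 1 ∧ 0 < L.ct z i x ∧ L.ct z i x < 1 := by
  induction i using fin4_induction with
  | h0 => rfl
  | h i ih =>
    rw [ih, (L.coord_succ z i x).1, (L.coord_succ z i x).2]
    constructor <;> rintro ⟨h1, h2, h3, h4⟩ <;> refine ⟨?_, ?_, ?_, ?_⟩ <;> linarith

theorem cs_affine (z : L.E) (i : Fin 4) (x y : ℂ) (a b : ℝ) (hab : a + b = 1) :
    L.cs z i (a • x + b • y) = a * L.cs z i x + b * L.cs z i y := by
  obtain rfl : b = 1 - a := by linarith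
  unfold cs cross
  field_simp
  simp
  ring

theorem ct_affine (z : L.E) (i : Fin 4) (x y : ℂ) (a b : ℝ) (hab : a + b = 1) :
    L.ct z i (a • x + b • y) = a * L.ct z i x + b * L.ct z i y := by
  obtain rfl : b = 1 - a := by linarith
  unfold ct cross
  field_simp
  simp
  ring

theorem mem_hull {z : L.E} (i : Fin 4) {x : ℂ} : x ∈ L.hull z ↔
    0 ≤ L.cs z i x ∧ L.cs z i x ≤ 1 ∧ 0 ≤ L.ct z i x ∧ L.ct z i x ≤ 1 := by
  constructor
  · have hsub : L.hull z ⊆ {x | 0 ≤ L.cs z i x ∧ L.cs z i x ≤ 1 ∧ 0 ≤ L.ct z i x ∧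
        L.ct z i x ≤ 1} := by
      refine convexHull_min ?_ ?_
      · rintro _ ⟨j, rfl⟩
        obtain ⟨a0, b0, a1, b1, a2, b2, a3, b3⟩ := L.coord_vert z i
        rcases fin4_cases i j with rfl | rfl | rfl | rfl <;> simp [*]
      · intro x hx y hy a b ha hb hab
        simp only [mem_ofPred_eq, L.cs_affine z i x y a b hab, L.ct_affine z i x y a b hab] at *
        obtain ⟨x1, x2, x3, x4⟩ := hx
        obtain ⟨y1, y2, y3, y4⟩ := hy
        refine ⟨by positivity, ?_, by positivity, ?_⟩
        · nlinarith
        · nlinarith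
    exact fun h => hsub h
  · rintro ⟨h1, h2, h3, h4⟩
    have hc : Convex ℝ (L.hull z) := convex_convexHull ℝ _
    have hv : ∀ j, L.vert z j ∈ L.hull z := fun j => subset_convexHull ℝ _ ⟨j, rfl⟩
    have p1 := hc (hv i) (hv (i + 1)) (sub_nonneg.2 h2) h1 (by ring)
    have p2 := hc (hv (i + 3)) (hv (i + 2)) (sub_nonneg.2 h2) h1 (by ring)
    have p3 := hc p1 p2 (sub_nonneg.2 h4) h3 (by ring)
    have e := L.eq_coord z i x
    have e3 : L.vert z (i + 3) = L.vert z i + L.side₂ z i := by unfold side₂; ring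
    have e1 : L.vert z (i + 1) = L.vert z i + L.side₁ z i := by unfold side₁; ring
    rw [e]
    convert p3 using 1
    rw [vert_add_two, e3, e1]
    simp only [real_smul]
    push_cast
    ring

theorem isOpen_openRhombus (z : L.E) : IsOpen (L.openRhombus z) := by
  have h1 := L.continuous_cs z 0
  have h2 := L.continuous_ct z 0
  exact (isOpen_lt continuous_const h1).inter ((isOpen_lt h1 continuous_const).inter
    ((isOpen_lt continuous_const h2).inter (isOpen_lt h2 continuous_const)))

theorem openRhombus_subset_hull (z : L.E) : L.openRhombus z ⊆ L.hull z :=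
  fun _ ⟨h1, h2, h3, h4⟩ => (L.mem_hull 0).2 ⟨h1.le, h2.le, h3.le, h4.le⟩

theorem openRhombus_subset_interior (z : L.E) : L.openRhombus z ⊆ interior (L.hull z) :=
  interior_maximal (L.openRhombus_subset_hull z) (L.isOpen_openRhombus z)

theorem hull_subset_closure (z : L.E) : L.hull z ⊆ closure (L.openRhombus z) := by
  intro x hx
  set c : ℂ := L.vert z 0 + ((1 / 2 : ℝ) : ℂ) * L.side₁ z 0 + ((1 / 2 : ℝ) : ℂ) * L.side₂ z 0
  have hc1 : L.cs z 0 c = 1 / 2 := L.cs_coord z 0 _ _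
  have hc2 : L.ct z 0 c = 1 / 2 := L.ct_coord z 0 _ _
  obtain ⟨h1, h2, h3, h4⟩ := (L.mem_hull 0).1 hx
  have hlim : Filter.Tendsto (fun ε : ℝ => (1 - ε) • x + ε • c) (nhdsWithin 0 (Ioi 0)) (nhds x) := by
    have : Continuous fun ε : ℝ => (1 - ε) • x + ε • c := by fun_prop
    have h := this.tendsto 0
    simp only [sub_zero, one_smul, zero_smul, add_zero] at h
    exact h.mono_left nhdsWithin_le_nhds
  refine mem_closure_of_tendsto hlim ?_
  have : Ioo (0 : ℝ) 1 ∈ nhdsWithin (0 : ℝ) (Ioi 0) := Ioo_mem_nhdsGT one_pos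
  filter_upwards [this] with ε hε
  simp only [openRhombus, mem_ofPred_eq, L.cs_affine z 0 x c (1 - ε) ε (by ring),
    L.ct_affine z 0 x c (1 - ε) ε (by ring), hc1, hc2]
  obtain ⟨e1, e2⟩ := hε
  refine ⟨?_, ?_, ?_, ?_⟩ <;> nlinarith

theorem disjoint_openRhombus {z z' : L.E} (h : z ≠ z') :
    Disjoint (L.openRhombus z) (L.openRhombus z') :=
  (L.disjoint_interior z z' h).mono (L.openRhombus_subset_interior z)
    (L.openRhombus_subset_interior z')

theorem disjoint_hull_openRhombus {z z' : L.E} (h : z ≠ z') :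
    Disjoint (L.hull z) (L.openRhombus z') :=
  ((L.disjoint_openRhombus h).closure_left (L.isOpen_openRhombus z')).mono_left
    (L.hull_subset_closure z)

end IsoradialLattice

namespace IsoradialLattice

variable {δ : ℝ} (L : IsoradialLattice δ)

/-! ### Angles -/

/-- Half the angle of the rhombus `z` at its `i`-th vertex. -/
def cornerAngle (z : L.E) (i : Fin 4) : ℝ :=
  if (i : ℕ) % 2 = 0 then L.halfAngle z else Real.pi / 2 - L.halfAngle z

theorem cornerAngle_succ (z : L.E) (i : Fin 4) :
    L.cornerAngle z (i + 1) = Real.pi / 2 - L.cornerAngle z i := by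
  unfold cornerAngle
  fin_cases i <;> simp

/-- The direction from the `i`-th vertex of `z` to the opposite vertex. -/
def diagDir (z : L.E) (i : Fin 4) : ℂ :=
  if i = 0 then (L.vert z 2 - L.vert z 0) / (‖L.vert z 2 - L.vert z 0‖ : ℝ)
  else if i = 1 then I * ((L.vert z 2 - L.vert z 0) / (‖L.vert z 2 - L.vert z 0‖ : ℝ))
  else if i = 2 then -((L.vert z 2 - L.vert z 0) / (‖L.vert z 2 - L.vert z 0‖ : ℝ))
  else -(I * ((L.vert z 2 - L.vert z 0) / (‖L.vert z 2 - L.vert z 0‖ : ℝ)))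

theorem diagDir_succ (z : L.E) (i : Fin 4) : L.diagDir z (i + 1) = I * L.diagDir z i := by
  have : I * I = -1 := I_mul_I
  unfold diagDir
  fin_cases i <;> simp [← mul_assoc]

theorem norm_side₁ (z : L.E) (i : Fin 4) : ‖L.side₁ z i‖ = δ := L.side_length z i

theorem norm_side₂ (z : L.E) (i : Fin 4) : ‖L.side₂ z i‖ = δ := by
  rw [← side₁_succ]; exact L.side_length z (i + 1)

theorem exp_I_mul_pi_div_two_sub (θ : ℝ) :
    exp (I * ((Real.pi / 2 - θ : ℝ) : ℂ)) = I * exp (-(I * θ)) := by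
  push_cast
  rw [mul_sub, sub_eq_add_neg, exp_add, show I * ((Real.pi : ℂ) / 2) = Real.pi / 2 * I by ring,
    exp_pi_div_two_mul_I]

/-- When the diagonal is rotated onto the positive real axis, the two sides have equal length and
real sum, hence are complex conjugate. The orientation decides which has negative imaginary part. -/
theorem side_eq_zero_aux (z : L.E) : ‖L.diagDir z 0‖ = 1 ∧
    L.side₁ z 0 = δ * L.diagDir z 0 * exp (-(I * (L.cornerAngle z 0 : ℂ))) ∧
    L.side₂ z 0 = δ * L.diagDir z 0 * exp (I * (L.cornerAngle z 0 : ℂ)) := by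
  have hD : L.vert z 2 - L.vert z 0 = L.side₁ z 0 + L.side₂ z 0 := by
    have := L.vert_add_two z 0
    rw [zero_add] at this
    rw [this]; ring
  have h1 := L.norm_side₁ z 0
  have h2 := L.norm_side₂ z 0
  have hc := L.cross_sides_pos z 0
  have hang : L.cornerAngle z 0 =
      InnerProductGeometry.angle (L.side₁ z 0 + L.side₂ z 0) (L.side₁ z 0) := by
    simp only [cornerAngle, halfAngle, hD]
    simp [side₁]
  have hdir : L.diagDir z 0 =
      (L.side₁ z 0 + L.side₂ z 0) / (‖L.side₁ z 0 + L.side₂ z 0‖ : ℝ) := by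
    simp only [diagDir, hD, if_true]
  rw [hang, hdir]
  generalize L.side₁ z 0 = a at *
  generalize L.side₂ z 0 = b at *
  have hab : a + b ≠ 0 := by
    intro h
    obtain rfl : b = -a := by linear_combination h
    simp [cross, mul_comm] at hc
  set N : ℝ := ‖a + b‖ with hN
  have hNpos : 0 < N := norm_pos_iff.2 hab
  have hNC : (N : ℂ) ≠ 0 := by exact_mod_cast hNpos.ne'
  set d : ℂ := (a + b) / (N : ℝ) with hd
  have hdn : ‖d‖ = 1 := by
    rw [hd, norm_div, norm_real, Real.norm_eq_abs, abs_of_pos hNpos, ← hN, div_self hNpos.ne']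
  have hdd : d * (starRingEnd ℂ) d = 1 := by
    rw [mul_conj, normSq_eq_norm_sq, hdn]; simp
  set ζ := (starRingEnd ℂ) d * a with hζ
  set ξ := (starRingEnd ℂ) d * b with hξ
  have ha : a = d * ζ := by rw [hζ, ← mul_assoc, hdd, one_mul]
  have hb : b = d * ξ := by rw [hξ, ← mul_assoc, hdd, one_mul]
  have hsum : ζ + ξ = (N : ℂ) := by
    have : a + b = N * d := by rw [hd]; field_simp
    rw [hζ, hξ, ← mul_add, this]
    linear_combination (N : ℂ) * hdd
  have hre : ζ.re + ξ.re = N := by simpa using congrArg re hsum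
  have him : ζ.im + ξ.im = 0 := by simpa using congrArg im hsum
  have nζ : ζ.re ^ 2 + ζ.im ^ 2 = δ ^ 2 := by
    have : ‖ζ‖ = δ := by rw [hζ, norm_mul, norm_conj, hdn, one_mul, h1]
    rw [← this, ← normSq_eq_norm_sq, normSq_apply]; ring
  have nξ : ξ.re ^ 2 + ξ.im ^ 2 = δ ^ 2 := by
    have : ‖ξ‖ = δ := by rw [hξ, norm_mul, norm_conj, hdn, one_mul, h2]
    rw [← this, ← normSq_eq_norm_sq, normSq_apply]; ring
  have himξ : ξ.im = -ζ.im := by linarith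
  have hreξ : ξ.re = ζ.re := by
    rw [himξ] at nξ
    have : (ξ.re - ζ.re) * N = 0 := by rw [← hre]; linarith
    rcases mul_eq_zero.1 this with h | h
    · linarith
    · exact absurd h hNpos.ne'
  have hre0 : 0 < ζ.re := by linarith
  have hcr : cross a b = ζ.re * ξ.im - ζ.im * ξ.re := by
    have dd : d.re ^ 2 + d.im ^ 2 = 1 := by
      have : ‖d‖ ^ 2 = 1 := by rw [hdn]; norm_num
      rw [← normSq_eq_norm_sq, normSq_apply] at this
      linarith
    rw [ha, hb]
    simp only [cross, mul_re, mul_im]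
    linear_combination (ζ.re * ξ.im - ζ.im * ξ.re) * dd
  have him0 : ζ.im < 0 := by
    rw [hcr, himξ, hreξ] at hc
    nlinarith
  have hδ : 0 < δ := by
    have : 0 ≤ δ := by rw [← h1]; exact norm_nonneg _
    rcases this.eq_or_lt with h | h
    · rw [← h] at nζ; nlinarith [sq_nonneg ζ.im]
    · exact h
  set θ := InnerProductGeometry.angle (a + b) a with hθ
  have hcos : Real.cos θ = ζ.re / δ := by
    rw [hθ, InnerProductGeometry.cos_angle, h1, Complex.inner]
    have : (starRingEnd ℂ) (a + b) * a = N * ζ := by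
      have : a + b = N * d := by rw [hd]; field_simp
      rw [this, map_mul, conj_ofReal, hζ]; ring
    rw [mul_comm a, this, re_ofReal_mul, ← hN]
    field_simp
  have hsin : Real.sin θ = -ζ.im / δ := by
    have h0 : 0 ≤ Real.sin θ := Real.sin_nonneg_of_nonneg_of_le_pi
      (InnerProductGeometry.angle_nonneg _ _) (InnerProductGeometry.angle_le_pi _ _)
    have h3 : 0 < -ζ.im / δ := div_pos (by linarith) hδ
    have h4 : Real.sin θ ^ 2 = (-ζ.im / δ) ^ 2 := by
      have := Real.sin_sq_add_cos_sq θ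
      rw [hcos] at this
      have e : (-ζ.im / δ) ^ 2 + (ζ.re / δ) ^ 2 = 1 := by
        rw [div_pow, div_pow, ← add_div, div_eq_one_iff_eq (by positivity)]
        linarith
      linarith
    exact (pow_left_inj₀ h0 h3.le two_ne_zero).1 h4
  have e1 : exp (I * (θ : ℂ)) = (Real.cos θ : ℂ) + Real.sin θ * I := by
    rw [mul_comm, exp_mul_I, ofReal_cos, ofReal_sin]
  have e2 : exp (-(I * (θ : ℂ))) = (Real.cos θ : ℂ) - Real.sin θ * I := by
    rw [show -(I * (θ : ℂ)) = (-θ : ℂ) * I by ring, exp_mul_I, Complex.cos_neg, Complex.sin_neg,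
      ofReal_cos, ofReal_sin]; ring
  have hδC : (δ : ℂ) ≠ 0 := by exact_mod_cast hδ.ne'
  refine ⟨hdn, ?_, ?_⟩
  · rw [e2, hcos, hsin, ha]
    have : ζ = ζ.re + ζ.im * I := (re_add_im ζ).symm
    rw [this]
    push_cast
    simp only [add_re, ofReal_re, mul_re, I_re, mul_zero, ofReal_im, I_im, mul_one, sub_self,
      add_zero, add_im, mul_im, zero_add]
    field_simp
    ring
  · rw [e1, hcos, hsin, hb]
    have : ξ = ζ.re + (-ζ.im) * I := by
      rw [← re_add_im ξ, himξ, hreξ]; push_cast; ring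
    rw [this]
    push_cast
    field_simp

/-- The two sides at a vertex are obtained from the diagonal by rotations by the half-angle. -/
theorem side_eq (z : L.E) (i : Fin 4) : ‖L.diagDir z i‖ = 1 ∧
    L.side₁ z i = δ * L.diagDir z i * exp (-(I * (L.cornerAngle z i : ℂ))) ∧
    L.side₂ z i = δ * L.diagDir z i * exp (I * (L.cornerAngle z i : ℂ)) := by
  induction i using fin4_induction with
  | h0 => exact L.side_eq_zero_aux z
  | h i ih =>
    obtain ⟨h1, h2, h3⟩ := ih
    have hI : I * I = -1 := I_mul_I
    have e1 : exp (-(I * ((Real.pi / 2 - L.cornerAngle z i : ℝ) : ℂ))) =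
        -I * exp (I * L.cornerAngle z i) := by
      rw [exp_neg, exp_I_mul_pi_div_two_sub, mul_inv, inv_I, exp_neg, inv_inv]
    refine ⟨by rw [diagDir_succ, norm_mul, norm_I, one_mul, h1], ?_, ?_⟩
    · rw [side₁_succ, h3, diagDir_succ, cornerAngle_succ, e1]
      linear_combination (δ * L.diagDir z i * exp (I * L.cornerAngle z i)) * hI
    · rw [side₂_succ, h2, diagDir_succ, cornerAngle_succ, exp_I_mul_pi_div_two_sub]
      linear_combination -(δ * L.diagDir z i * exp (-(I * L.cornerAngle z i))) * hI

theorem vert_opp_sub (z : L.E) (i : Fin 4) : L.vert z (i + 2) - L.vert z i =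
    ((2 * δ * Real.cos (L.cornerAngle z i) : ℝ) : ℂ) * L.diagDir z i := by
  obtain ⟨-, h2, h3⟩ := L.side_eq z i
  rw [vert_add_two, h2, h3]
  push_cast
  rw [Complex.cos, show -(I * (L.cornerAngle z i : ℂ)) = -(L.cornerAngle z i : ℂ) * I by ring,
    show I * (L.cornerAngle z i : ℂ) = (L.cornerAngle z i : ℂ) * I by ring]
  ring

variable {L}

theorem AngleBound.cornerAngle {η : ℝ} (h : L.AngleBound η) (z : L.E) (i : Fin 4) :
    L.cornerAngle z i ∈ Icc η (Real.pi / 2 - η) := by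
  obtain ⟨h1, h2⟩ := h z
  unfold IsoradialLattice.cornerAngle
  split_ifs
  · exact ⟨h1, h2⟩
  · constructor <;> linarith

variable (L)

theorem cross_sides (z : L.E) (i : Fin 4) :
    cross (L.side₁ z i) (L.side₂ z i) = δ ^ 2 * Real.sin (2 * L.cornerAngle z i) := by
  obtain ⟨h1, h2, h3⟩ := L.side_eq z i
  rw [h2, h3]
  have dd : (L.diagDir z i).re ^ 2 + (L.diagDir z i).im ^ 2 = 1 := by
    have : ‖L.diagDir z i‖ ^ 2 = 1 := by rw [h1]; norm_num
    rw [← normSq_eq_norm_sq, normSq_apply] at this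
    linarith
  generalize L.diagDir z i = d at *
  generalize L.cornerAngle z i = θ
  have e1 : exp (I * (θ : ℂ)) = (Real.cos θ : ℂ) + Real.sin θ * I := by
    rw [mul_comm, exp_mul_I, ofReal_cos, ofReal_sin]
  have e2 : exp (-(I * (θ : ℂ))) = (Real.cos θ : ℂ) - Real.sin θ * I := by
    rw [show -(I * (θ : ℂ)) = (-θ : ℂ) * I by ring, exp_mul_I, Complex.cos_neg, Complex.sin_neg,
      ofReal_cos, ofReal_sin]; ring
  rw [e1, e2, Real.sin_two_mul]
  simp only [cross, mul_re, mul_im, ofReal_re, ofReal_im, add_re, add_im, sub_re, sub_im, I_re, I_im]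
  linear_combination (δ ^ 2 * (2 * Real.sin θ * Real.cos θ)) * dd

end IsoradialLattice

namespace IsoradialLattice

variable {δ : ℝ} (L : IsoradialLattice δ)

/-! ### Local structure of the tiling -/

theorem parity_eq {z z' : L.E} {i i' : Fin 4} (h : L.vert z' i' = L.vert z i) :
    (i' : ℕ) % 2 = (i : ℕ) % 2 := by
  obtain ⟨j, hj, hp⟩ := L.proper z z' i' (by rw [h]; exact subset_convexHull ℝ _ ⟨i, rfl⟩)
  rw [h] at hj
  rw [hp, ← L.vert_injective z hj]

theorem cs_add (z : L.E) (i : Fin 4) (x h : ℂ) : L.cs z i (x + h) =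
    L.cs z i x + cross h (L.side₂ z i) / cross (L.side₁ z i) (L.side₂ z i) := by
  unfold cs
  rw [← add_div]
  congr 1
  simp [cross]; ring

theorem ct_add (z : L.E) (i : Fin 4) (x h : ℂ) : L.ct z i (x + h) =
    L.ct z i x + cross (L.side₁ z i) h / cross (L.side₁ z i) (L.side₂ z i) := by
  unfold ct
  rw [← add_div]
  congr 1
  simp [cross]; ring

theorem abs_cross_le (a b : ℂ) : |cross a b| ≤ ‖a‖ * ‖b‖ := by
  refine abs_le_of_sq_le_sq ?_ (by positivity)
  rw [mul_pow, ← normSq_eq_norm_sq, ← normSq_eq_norm_sq, normSq_apply, normSq_apply]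
  unfold cross
  nlinarith [sq_nonneg (a.re * b.re + a.im * b.im)]

theorem cross_smul_left (r : ℝ) (a b : ℂ) : cross (r * a) b = r * cross a b := by
  simp [cross]; ring

variable {L}

theorem AngleBound.sin_two_mul {η : ℝ} (h : L.AngleBound η) (hη : 0 < η) (z : L.E) (i : Fin 4) :
    0 < Real.sin (2 * η) ∧ Real.sin (2 * η) ≤ Real.sin (2 * L.cornerAngle z i) := by
  obtain ⟨h1, h2⟩ := h.cornerAngle z i
  refine ⟨Real.sin_pos_of_pos_of_lt_pi (by linarith) (by linarith [Real.pi_pos]), ?_⟩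
  rcases le_total (2 * L.cornerAngle z i) (Real.pi / 2) with h | h
  · exact Real.sin_le_sin_of_le_of_le_pi_div_two (by linarith) h (by linarith)
  · rw [← Real.sin_pi_sub (2 * L.cornerAngle z i)]
    exact Real.sin_le_sin_of_le_of_le_pi_div_two (by linarith) (by linarith) (by linarith)

theorem AngleBound.abs_cross_div_le {η : ℝ} (hL : L.AngleBound η) (hη : 0 < η) (hδ : 0 < δ)
    (z : L.E) (i : Fin 4) (h : ℂ) :
    |cross h (L.side₂ z i) / cross (L.side₁ z i) (L.side₂ z i)| ≤ ‖h‖ / (δ * Real.sin (2 * η)) ∧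
    |cross (L.side₁ z i) h / cross (L.side₁ z i) (L.side₂ z i)| ≤ ‖h‖ / (δ * Real.sin (2 * η)) := by
  obtain ⟨s1, s2⟩ := hL.sin_two_mul hη z i
  have key : ∀ c : ℝ, |c| ≤ ‖h‖ * δ → |c / cross (L.side₁ z i) (L.side₂ z i)| ≤
      ‖h‖ / (δ * Real.sin (2 * η)) := by
    intro c hc
    rw [abs_div, abs_of_pos (L.cross_sides_pos z i), cross_sides]
    calc |c| / (δ ^ 2 * Real.sin (2 * L.cornerAngle z i)) ≤
        (‖h‖ * δ) / (δ ^ 2 * Real.sin (2 * η)) := by gcongr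
      _ = _ := by field_simp
  constructor
  · refine key _ ?_
    have := abs_cross_le h (L.side₂ z i)
    rwa [L.norm_side₂] at this
  · refine key _ ?_
    have := abs_cross_le (L.side₁ z i) h
    rwa [L.norm_side₁, mul_comm] at this

variable (L)

/-- The centre of a rhombus. -/
def center (z : L.E) : ℂ :=
  L.vert z 0 + ((1 / 2 : ℝ) : ℂ) * L.side₁ z 0 + ((1 / 2 : ℝ) : ℂ) * L.side₂ z 0

variable {L}

theorem AngleBound.ball_center_subset {η : ℝ} (hL : L.AngleBound η) (hη : 0 < η) (hδ : 0 < δ)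
    (z : L.E) : Metric.ball (L.center z) (δ * Real.sin (2 * η) / 2) ⊆ L.openRhombus z := by
  intro x hx
  obtain ⟨s1, -⟩ := hL.sin_two_mul hη z 0
  rw [Metric.mem_ball, dist_eq_norm] at hx
  obtain ⟨b1, b2⟩ := hL.abs_cross_div_le hη hδ z 0 (x - L.center z)
  have hlt : ‖x - L.center z‖ / (δ * Real.sin (2 * η)) < 1 / 2 := by
    rw [div_lt_iff₀ (by positivity)]; linarith
  have e1 := L.cs_add z 0 (L.center z) (x - L.center z)
  have e2 := L.ct_add z 0 (L.center z) (x - L.center z)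
  rw [add_sub_cancel] at e1 e2
  have c1 : L.cs z 0 (L.center z) = 1 / 2 := L.cs_coord z 0 _ _
  have c2 : L.ct z 0 (L.center z) = 1 / 2 := L.ct_coord z 0 _ _
  have := abs_lt.1 (b1.trans_lt hlt)
  have := abs_lt.1 (b2.trans_lt hlt)
  refine ⟨?_, ?_, ?_, ?_⟩ <;> linarith

theorem dist_center_le (hδ : 0 < δ) {z : L.E} {x : ℂ} (hx : x ∈ L.hull z) :
    dist x (L.center z) ≤ δ := by
  have h := (L.mem_hull 0).1 hx
  have e := L.eq_coord z 0 x
  rw [dist_eq_norm]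
  have : x - L.center z = ((L.cs z 0 x - 1 / 2 : ℝ) : ℂ) * L.side₁ z 0 +
      ((L.ct z 0 x - 1 / 2 : ℝ) : ℂ) * L.side₂ z 0 := by
    unfold center
    conv_lhs => rw [e]
    push_cast; ring
  rw [this]
  refine (norm_add_le _ _).trans ?_
  rw [norm_mul, norm_mul, L.norm_side₁, L.norm_side₂, norm_real, norm_real, Real.norm_eq_abs,
    Real.norm_eq_abs]
  have a1 : |L.cs z 0 x - 1 / 2| ≤ 1 / 2 := by rw [abs_le]; constructor <;> linarith
  have a2 : |L.ct z 0 x - 1 / 2| ≤ 1 / 2 := by rw [abs_le]; constructor <;> linarith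
  nlinarith

/-- The open rhombi contain disjoint discs of a common radius about their centres, so each point of
a finite net with mesh half that radius is near at most one centre. -/
theorem AngleBound.locallyFinite {η : ℝ} (hL : L.AngleBound η) (hη : 0 < η) (hδ : 0 < δ) :
    LocallyFinite fun z => L.hull z := by
  intro x
  refine ⟨Metric.ball x δ, Metric.ball_mem_nhds x hδ, ?_⟩
  by_cases hE : Nonempty L.E
  swap
  · exact Set.Finite.subset (Set.finite_empty) fun z _ => (hE ⟨z⟩).elim
  obtain ⟨z₀⟩ := hE
  obtain ⟨s1, -⟩ := hL.sin_two_mul hη z₀ 0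
  set ε := δ * Real.sin (2 * η) / 4 with hε
  have hεpos : 0 < ε := by positivity
  have htb : TotallyBounded (Metric.closedBall x (2 * δ)) :=
    (isCompact_closedBall x (2 * δ)).totallyBounded
  obtain ⟨t, htf, ht⟩ := Metric.totallyBounded_iff.1 htb ε hεpos
  have hmem : ∀ z ∈ {z | (L.hull z ∩ Metric.ball x δ).Nonempty}, ∃ y ∈ t,
      L.center z ∈ Metric.ball y ε := by
    rintro z ⟨y, hy1, hy2⟩
    have h1 := dist_center_le hδ hy1
    have h2 : L.center z ∈ Metric.closedBall x (2 * δ) := by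
      rw [Metric.mem_closedBall]
      have := dist_triangle (L.center z) y x
      rw [dist_comm] at h1
      rw [Metric.mem_ball] at hy2
      linarith
    simpa using ht h2
  choose! f hf1 hf2 using hmem
  refine Set.Finite.of_finite_image (f := f) (htf.subset ?_) ?_
  · rintro _ ⟨z, hz, rfl⟩; exact hf1 z hz
  · intro z hz z' hz' hzz
    by_contra hne
    have d1 := hf2 z hz
    have d2 := hf2 z' hz'
    rw [hzz, Metric.mem_ball] at d1
    rw [Metric.mem_ball] at d2
    have hd : L.center z' ∈ Metric.ball (L.center z) (δ * Real.sin (2 * η) / 2) := by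
      rw [Metric.mem_ball]
      have := dist_triangle_right (L.center z') (L.center z) (f z')
      linarith
    have hd' : L.center z' ∈ Metric.ball (L.center z') (δ * Real.sin (2 * η) / 2) :=
      Metric.mem_ball_self (by positivity)
    exact Set.disjoint_left.1 (L.disjoint_openRhombus hne) (hL.ball_center_subset hη hδ z hd)
      (hL.ball_center_subset hη hδ z' hd')

theorem isClosed_hull (z : L.E) : IsClosed (L.hull z) := by
  have h1 := L.continuous_cs z 0
  have h2 := L.continuous_ct z 0
  have : L.hull z = {x | 0 ≤ L.cs z 0 x ∧ L.cs z 0 x ≤ 1 ∧ 0 ≤ L.ct z 0 x ∧ L.ct z 0 x ≤ 1} :=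
    Set.ext fun x => L.mem_hull 0
  rw [this]
  exact (isClosed_le continuous_const h1).inter ((isClosed_le h1 continuous_const).inter
    ((isClosed_le continuous_const h2).inter (isClosed_le h2 continuous_const)))

/-- Every side of a rhombus is a side of another rhombus, with the opposite orientation. -/
theorem AngleBound.exists_next {η : ℝ} (hL : L.AngleBound η) (hη : 0 < η) (hδ : 0 < δ)
    (z : L.E) (i : Fin 4) :
    ∃ z' j, L.vert z' j = L.vert z i ∧ L.vert z' (j + 1) = L.vert z (i + 3) := by
  -- The midpoint of the side. Another closed rhombus contains it: the others form a closed set by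
  -- local finiteness, and missing `m` they would leave points just outside `z` uncovered.
  obtain ⟨m, hm⟩ : ∃ m : ℂ, m = L.vert z i + ((0 : ℝ) : ℂ) * L.side₁ z i +
    ((1 / 2 : ℝ) : ℂ) * L.side₂ z i := ⟨_, rfl⟩
  have m1 : L.cs z i m = 0 := by rw [hm]; exact L.cs_coord z i _ _
  have m2 : L.ct z i m = 1 / 2 := by rw [hm]; exact L.ct_coord z i _ _
  have hmz : m ∈ L.hull z := (L.mem_hull i).2 (by rw [m1, m2]; norm_num)
  obtain ⟨z', hne, hmz'⟩ : ∃ z', z' ≠ z ∧ m ∈ L.hull z' := by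
    by_contra hcon
    push Not at hcon
    have hcl : IsClosed (⋃ z' : {z' // z' ≠ z}, L.hull z'.1) :=
      ((hL.locallyFinite hη hδ).comp_injective Subtype.val_injective).isClosed_iUnion
        fun z' => isClosed_hull z'.1
    have hmem : (⋃ z' : {z' // z' ≠ z}, L.hull z'.1)ᶜ ∈ nhds m := by
      refine hcl.isOpen_compl.mem_nhds ?_
      simp only [mem_compl_iff, mem_iUnion, not_exists]
      exact fun z' => hcon z'.1 z'.2
    have hlim : Filter.Tendsto (fun ε : ℝ => m + ((-ε : ℝ) : ℂ) * L.side₁ z i)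
        (nhdsWithin 0 (Ioi 0)) (nhds m) := by
      have : Continuous fun ε : ℝ => m + ((-ε : ℝ) : ℂ) * L.side₁ z i := by fun_prop
      have h := this.tendsto 0
      simp only [neg_zero, ofReal_zero, zero_mul, add_zero] at h
      exact h.mono_left nhdsWithin_le_nhds
    obtain ⟨ε, hε1, hε2⟩ := ((hlim.eventually hmem).and self_mem_nhdsWithin).exists
    replace hε2 : 0 < ε := hε2
    set y := m + ((-ε : ℝ) : ℂ) * L.side₁ z i with hy
    have hyz : y ∉ L.hull z := by
      rw [L.mem_hull i, hy, cs_add, m1, cross_smul_left, mul_div_assoc,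
        div_self (L.cross_sides_pos z i).ne']
      rintro ⟨h, -⟩
      linarith
    have : y ∈ ⋃ z, L.hull z := by
      have := L.cover
      unfold hull
      rw [this]; trivial
    obtain ⟨w, hw⟩ := mem_iUnion.1 this
    have hwz : w ≠ z := by rintro rfl; exact hyz hw
    exact hε1 (mem_iUnion.2 ⟨⟨w, hwz⟩, hw⟩)
  have hmo : m ∉ L.openRhombus z' := Set.disjoint_left.1 (L.disjoint_hull_openRhombus hne.symm) hmz
  have hnv : ∀ j, m ≠ L.vert z' j := by
    intro j hj
    obtain ⟨l, hl, -⟩ := L.proper z z' j (by rw [← hj]; exact hmz)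
    rw [← hj] at hl
    obtain ⟨a0, b0, a1, b1, a2, b2, a3, b3⟩ := L.coord_vert z i
    rcases fin4_cases i l with rfl | rfl | rfl | rfl <;> rw [hl] at m2 <;> linarith
  obtain ⟨j, hj⟩ : ∃ j, L.cs z' j m = 0 := by
    by_contra hcon
    push Not at hcon
    have h := (L.mem_hull 0).1 hmz'
    have h0 := hcon 0
    have h1 := hcon 1
    have h2 := hcon 2
    have h3 := hcon 3
    have c0 := L.coord_succ z' 0 m
    have c1 := L.coord_succ z' 1 m
    have c2 := L.coord_succ z' 2 m
    simp only [zero_add, Fin.reduceAdd] at c0 c1 c2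
    rw [c0.1] at h1
    rw [c1.1, c0.2] at h2
    rw [c2.1, c1.2, c0.1] at h3
    refine hmo ⟨lt_of_le_of_ne h.1 h0.symm, lt_of_le_of_ne h.2.1 ?_, lt_of_le_of_ne h.2.2.1 h1.symm,
      lt_of_le_of_ne h.2.2.2 ?_⟩
    · intro h; apply h2; linarith
    · intro h; apply h3; linarith
  have hmz'j := (L.mem_hull j).1 hmz'
  have ej := L.eq_coord z' j m
  have v3 : L.vert z' (j + 3) = L.vert z' j + L.side₂ z' j := by unfold side₂; ring
  have t0 : 0 < L.ct z' j m := by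
    refine lt_of_le_of_ne hmz'j.2.2.1 fun h => hnv j ?_
    rw [ej, hj, ← h]; simp
  have t1 : L.ct z' j m < 1 := by
    refine lt_of_le_of_ne hmz'j.2.2.2 fun h => hnv (j + 3) ?_
    rw [v3, ej, hj, h]; simp
  -- Let `g` be the sum of the two side vectors, which have equal length. If `g ≠ 0`, each has inner
  -- product `|g|² / 2` with `g`, so the direction `-I * g` points from `m` strictly into both open
  -- rhombi, which are disjoint.
  have hop : L.side₂ z' j = -L.side₂ z i := by
    by_contra hne2
    set g := L.side₂ z i + L.side₂ z' j with hg
    have hg0 : g ≠ 0 := fun h => hne2 (by rw [hg] at h; linear_combination h)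
    have n1 := L.norm_side₂ z i
    have n2 := L.norm_side₂ z' j
    have hgn : 0 < g.re ^ 2 + g.im ^ 2 := by
      have : 0 < ‖g‖ ^ 2 := by positivity
      rw [← normSq_eq_norm_sq, normSq_apply] at this
      linarith
    have q1 : (L.side₂ z i).re ^ 2 + (L.side₂ z i).im ^ 2 = δ ^ 2 := by
      have e := normSq_eq_norm_sq (L.side₂ z i)
      rw [n1, normSq_apply] at e; linarith
    have q2 : (L.side₂ z' j).re ^ 2 + (L.side₂ z' j).im ^ 2 = δ ^ 2 := by
      have e := normSq_eq_norm_sq (L.side₂ z' j)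
      rw [n2, normSq_apply] at e; linarith
    have p1 : 0 < cross (-I * g) (L.side₂ z i) := by
      simp [cross, hg] at hgn ⊢
      nlinarith
    have p2 : 0 < cross (-I * g) (L.side₂ z' j) := by
      simp [cross, hg] at hgn ⊢
      nlinarith
    have hlim : Filter.Tendsto (fun ε : ℝ => m + (ε : ℂ) * (-I * g))
        (nhdsWithin 0 (Ioi 0)) (nhds m) := by
      have : Continuous fun ε : ℝ => m + (ε : ℂ) * (-I * g) := by fun_prop
      have h := this.tendsto 0
      simp only [ofReal_zero, zero_mul, add_zero] at h
      exact h.mono_left nhdsWithin_le_nhds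
    have key : ∀ (w : L.E) (l : Fin 4), L.cs w l m = 0 → 0 < L.ct w l m → L.ct w l m < 1 →
        0 < cross (-I * g) (L.side₂ w l) →
        ∀ᶠ ε : ℝ in nhdsWithin (0 : ℝ) (Ioi 0), m + (ε : ℂ) * (-I * g) ∈ L.openRhombus w := by
      intro w l a1 a2 a3 a4
      have b1 := ((L.continuous_cs w l).tendsto m |>.comp hlim).eventually_lt_const
        (by rw [a1]; norm_num : L.cs w l m < 1)
      have b2 := ((L.continuous_ct w l).tendsto m |>.comp hlim).eventually_lt_const a3
      have b3 := ((L.continuous_ct w l).tendsto m |>.comp hlim).eventually_const_lt a2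
      filter_upwards [b1, b2, b3, self_mem_nhdsWithin] with ε c1 c2 c3 c4
      refine (L.mem_openRhombus l).2 ⟨?_, c1, c3, c2⟩
      replace c4 : 0 < ε := c4
      rw [cs_add, a1, cross_smul_left, zero_add]
      have := L.cross_sides_pos w l
      positivity
    have k1 := key z i m1 (by rw [m2]; norm_num) (by rw [m2]; norm_num) p1
    have k2 := key z' j hj t0 t1 p2
    obtain ⟨ε, hε1, hε2⟩ := (k1.and k2).exists
    exact Set.disjoint_left.1 (L.disjoint_openRhombus hne.symm) hε1 hε2
  have hv' : L.vert z' j = L.vert z i + ((0 : ℝ) : ℂ) * L.side₁ z i +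
      ((1 / 2 + L.ct z' j m : ℝ) : ℂ) * L.side₂ z i := by
    rw [hj, hop] at ej
    push_cast at ej hm ⊢
    linear_combination -ej + hm
  have hv3 : L.vert z' (j + 3) = L.vert z i + ((0 : ℝ) : ℂ) * L.side₁ z i +
      ((L.ct z' j m - 1 / 2 : ℝ) : ℂ) * L.side₂ z i := by
    rw [v3, hv', hop]; push_cast; ring
  have hside : ∀ (l : Fin 4) (t : ℝ), L.vert z' l = L.vert z i + ((0 : ℝ) : ℂ) * L.side₁ z i +
      (t : ℂ) * L.side₂ z i → 0 < t → t < 1 → False := by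
    intro l t hl ht0 ht1
    have c1 : L.cs z i (L.vert z' l) = 0 := by rw [hl]; exact L.cs_coord z i _ _
    have c2 : L.ct z i (L.vert z' l) = t := by rw [hl]; exact L.ct_coord z i _ _
    obtain ⟨l', hl', -⟩ := L.proper z z' l ((L.mem_hull i).2 (by
      rw [c1, c2]; exact ⟨le_rfl, zero_le_one, ht0.le, ht1.le⟩))
    obtain ⟨a0, b0, a1, b1, a2, b2, a3, b3⟩ := L.coord_vert z i
    rcases fin4_cases i l' with rfl | rfl | rfl | rfl <;> rw [hl'] at c1 c2 <;> linarith
  -- If `m` were not the midpoint of the second side too, an end of that side would lie strictly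
  -- inside the first, against the edge-to-edge property.
  have ht : L.ct z' j m = 1 / 2 := by
    rcases lt_trichotomy (L.ct z' j m) (1 / 2) with h | h | h
    · exact (hside j _ hv' (by linarith) (by linarith)).elim
    · exact h
    · exact (hside (j + 3) _ hv3 (by linarith) (by linarith)).elim
  refine ⟨z', j + 3, ?_, ?_⟩
  · rw [hv3, ht]; simp
  · rw [add_assoc, show (3 : Fin 4) + 1 = 0 from rfl, add_zero, hv', ht]
    push_cast
    unfold side₂
    ring

end IsoradialLattice

namespace IsoradialLattice

variable {δ : ℝ} (L : IsoradialLattice δ)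

/-! ### The fan of rhombi at a vertex -/

theorem side₂_eq_rotate (z : L.E) (i : Fin 4) :
    L.side₂ z i = L.side₁ z i * exp (I * ((2 * L.cornerAngle z i : ℝ) : ℂ)) := by
  obtain ⟨-, h2, h3⟩ := L.side_eq z i
  rw [h2, h3, mul_assoc _ (exp _) (exp _), ← exp_add]
  congr 2
  push_cast; ring

theorem polar_eq {z : L.E} {i : Fin 4} (hs : Real.sin (2 * L.cornerAngle z i) ≠ 0) (r γ : ℝ) :
    (r : ℂ) * (L.side₁ z i * exp (I * (γ : ℂ))) =
      ((r * Real.sin (2 * L.cornerAngle z i - γ) / Real.sin (2 * L.cornerAngle z i) : ℝ) : ℂ) *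
        L.side₁ z i +
      ((r * Real.sin γ / Real.sin (2 * L.cornerAngle z i) : ℝ) : ℂ) * L.side₂ z i := by
  rw [side₂_eq_rotate]
  generalize 2 * L.cornerAngle z i = θ at *
  have hsC : (Real.sin θ : ℂ) ≠ 0 := by exact_mod_cast hs
  have e : ∀ x : ℝ, exp (I * (x : ℂ)) = (Real.cos x : ℂ) + Real.sin x * I := fun x => by
    rw [mul_comm, exp_mul_I, ofReal_cos, ofReal_sin]
  rw [e, e, Real.sin_sub]
  push_cast at hsC ⊢
  field_simp
  ring

variable {L}

theorem coord_polar {z : L.E} {i : Fin 4} (hs : Real.sin (2 * L.cornerAngle z i) ≠ 0) (r γ : ℝ) :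
    L.cs z i (L.vert z i + r * (L.side₁ z i * exp (I * (γ : ℂ)))) =
      r * Real.sin (2 * L.cornerAngle z i - γ) / Real.sin (2 * L.cornerAngle z i) ∧
    L.ct z i (L.vert z i + r * (L.side₁ z i * exp (I * (γ : ℂ)))) =
      r * Real.sin γ / Real.sin (2 * L.cornerAngle z i) := by
  rw [L.polar_eq hs, ← add_assoc]
  exact ⟨L.cs_coord z i _ _, L.ct_coord z i _ _⟩

/-- Rhombi at the same vertex with overlapping sectors are equal. -/
theorem AngleBound.eq_of_sector {η : ℝ} (hL : L.AngleBound η) (hη : 0 < η)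
    {z z' : L.E} {i i' : Fin 4} (hv : L.vert z' i' = L.vert z i) {γ γ' : ℝ}
    (h : L.side₁ z i * exp (I * (γ : ℂ)) = L.side₁ z' i' * exp (I * (γ' : ℂ)))
    (h0 : 0 < γ) (h1 : γ < 2 * L.cornerAngle z i) (h0' : 0 < γ')
    (h1' : γ' < 2 * L.cornerAngle z' i') : z' = z ∧ i' = i := by
  have key : ∀ (w : L.E) (l : Fin 4) (β : ℝ), 0 < β → β < 2 * L.cornerAngle w l →
      ∀ᶠ r : ℝ in nhdsWithin (0 : ℝ) (Ioi 0),
        L.vert w l + r * (L.side₁ w l * exp (I * (β : ℂ))) ∈ L.openRhombus w := by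
    intro w l β hβ0 hβ1
    have hb := (hL.cornerAngle w l).2
    have hsp : 0 < Real.sin (2 * L.cornerAngle w l) :=
      (hL.sin_two_mul hη w l).1.trans_le (hL.sin_two_mul hη w l).2
    have hlim : Filter.Tendsto (fun r : ℝ => L.vert w l + r * (L.side₁ w l * exp (I * (β : ℂ))))
        (nhdsWithin 0 (Ioi 0)) (nhds (L.vert w l)) := by
      have : Continuous fun r : ℝ => L.vert w l + r * (L.side₁ w l * exp (I * (β : ℂ))) := by
        fun_prop
      have h := this.tendsto 0
      simp only [ofReal_zero, zero_mul, add_zero] at h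
      exact h.mono_left nhdsWithin_le_nhds
    have b1 := ((L.continuous_cs w l).tendsto _ |>.comp hlim).eventually_lt_const
      (by rw [(L.coord_vert w l).1]; norm_num : L.cs w l (L.vert w l) < 1)
    have b2 := ((L.continuous_ct w l).tendsto _ |>.comp hlim).eventually_lt_const
      (by rw [(L.coord_vert w l).2.1]; norm_num : L.ct w l (L.vert w l) < 1)
    filter_upwards [b1, b2, self_mem_nhdsWithin] with r c1 c2 c3
    replace c3 : 0 < r := c3
    obtain ⟨e1, e2⟩ := coord_polar hsp.ne' r β
    have s1 : 0 < Real.sin (2 * L.cornerAngle w l - β) :=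
      Real.sin_pos_of_pos_of_lt_pi (by linarith) (by linarith)
    have s2 : 0 < Real.sin β := Real.sin_pos_of_pos_of_lt_pi hβ0 (by linarith)
    refine (L.mem_openRhombus l).2 ⟨?_, c1, ?_, c2⟩
    · rw [e1]; positivity
    · rw [e2]; positivity
  have hz : z' = z := by
    by_contra hne
    obtain ⟨r, r1, r2⟩ := ((key z i γ h0 h1).and (key z' i' γ' h0' h1')).exists
    rw [h, ← hv] at r1
    exact Set.disjoint_left.1 (L.disjoint_openRhombus hne) r2 r1
  subst hz
  exact ⟨rfl, L.vert_injective _ hv⟩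

/-- `x 0, …, x (n - 1)` are the rhombi at the vertex `v` in counterclockwise order (with the index of
`v` in each), continued periodically. -/
structure IsFan (L : IsoradialLattice δ) (v : ℂ) (x : ℕ → L.E × Fin 4) (n : ℕ) : Prop where
  vert_eq : ∀ s, L.vert (x s).1 (x s).2 = v
  succ : ∀ s, L.vert (x (s + 1)).1 ((x (s + 1)).2 + 1) = L.vert (x s).1 ((x s).2 + 3)
  periodic : ∀ s, x (s + n) = x s
  sum_angle : ∑ s ∈ Finset.range n, L.cornerAngle (x s).1 (x s).2 = Real.pi
  exists_eq : ∀ z i, L.vert z i = v → ∃ s, x s = (z, i)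
  exists_sector : ∀ h : ℂ, ∃ s, 0 ≤ L.cs (x s).1 (x s).2 (v + h) ∧ 0 ≤ L.ct (x s).1 (x s).2 (v + h)

/-- Crossing second sides repeatedly turns the first side by the accumulated angle `T s`. The sector
that contains the direction `2 π` overlaps the first one, hence equals it. An overshoot is
impossible: `T k` would be a multiple of `2 π` strictly between `0` and `2 π`. So the fan closes
after exactly one turn. -/
theorem AngleBound.exists_fan {η : ℝ} (hL : L.AngleBound η) (hη : 0 < η) (hδ : 0 < δ)
    (z₀ : L.E) (i₀ : Fin 4) :
    ∃ (x : ℕ → L.E × Fin 4) (n : ℕ), x 0 = (z₀, i₀) ∧ L.IsFan (L.vert z₀ i₀) x n := by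
  have hpi := Real.pi_pos
  choose nz nj hn1 hn2 using fun p : L.E × Fin 4 => hL.exists_next hη hδ p.1 p.2
  obtain ⟨x, hx0, hxs⟩ : ∃ x : ℕ → L.E × Fin 4, x 0 = (z₀, i₀) ∧
      ∀ s, x (s + 1) = (nz (x s), nj (x s)) :=
    ⟨fun s => Nat.rec (z₀, i₀) (fun _ p => (nz p, nj p)) s, rfl, fun _ => rfl⟩
  set v := L.vert z₀ i₀ with hv
  have hvert : ∀ s, L.vert (x s).1 (x s).2 = v := by
    intro s
    induction s with
    | zero => rw [hx0]
    | succ s ih => rw [hxs]; exact (hn1 (x s)).trans ih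
  have hsucc : ∀ s, L.vert (x (s + 1)).1 ((x (s + 1)).2 + 1) = L.vert (x s).1 ((x s).2 + 3) := by
    intro s; rw [hxs]; exact hn2 (x s)
  set A : ℕ → ℝ := fun s => 2 * L.cornerAngle (x s).1 (x s).2 with hA
  have hA1 : ∀ s, 2 * η ≤ A s := fun s => by
    have := (hL.cornerAngle (x s).1 (x s).2).1; simp only [hA]; linarith
  have hA2 : ∀ s, A s < Real.pi := fun s => by
    have := (hL.cornerAngle (x s).1 (x s).2).2; simp only [hA]; linarith
  set T : ℕ → ℝ := fun s => ∑ j ∈ Finset.range s, A j with hT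
  have hTs : ∀ s, T (s + 1) = T s + A s := fun s => Finset.sum_range_succ _ _
  have hside : ∀ s, L.side₁ (x s).1 (x s).2 = L.side₁ z₀ i₀ * exp (I * (T s : ℂ)) := by
    intro s
    induction s with
    | zero => simp [hT, hx0]
    | succ s ih =>
      have : L.side₁ (x (s + 1)).1 (x (s + 1)).2 = L.side₂ (x s).1 (x s).2 := by
        unfold side₁ side₂; rw [hsucc, hvert, hvert]
      rw [this, side₂_eq_rotate, ih, mul_assoc, ← exp_add, ← mul_add, ← ofReal_add, hTs]
  have hTmono : StrictMono T := strictMono_nat_of_lt_succ fun s => by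
    rw [hTs]; linarith [hA1 s]
  have hTlin : ∀ s : ℕ, s * (2 * η) ≤ T s := fun s => by
    have := Finset.card_nsmul_le_sum (Finset.range s) A (2 * η) (fun s _ => hA1 s)
    simpa using this
  have hex : ∃ s, 2 * Real.pi ≤ T s := by
    obtain ⟨s, hs⟩ := exists_nat_ge (2 * Real.pi / (2 * η))
    refine ⟨s, le_trans ?_ (hTlin s)⟩
    rwa [div_le_iff₀ (by positivity)] at hs
  classical
  have hexp : exp (I * ((2 * Real.pi : ℝ) : ℂ)) = 1 := by
    rw [mul_comm]; push_cast; exact exp_two_pi_mul_I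
  have T0 : T 0 = 0 := by simp [hT]
  have hback : ∀ s, T s ≤ 2 * Real.pi → 2 * Real.pi < T (s + 1) → x s = x 0 := by
    intro s h1 h2
    rw [hTs] at h2
    set ε := min (T s + A s - 2 * Real.pi) (A 0) / 2 with hε
    have hA0 := hA1 0
    have e0 : 0 < ε := by
      have : 0 < min (T s + A s - 2 * Real.pi) (A 0) := lt_min (by linarith) (by linarith)
      positivity
    have e1 : 2 * ε ≤ T s + A s - 2 * Real.pi := by
      have := min_le_left (T s + A s - 2 * Real.pi) (A 0); linarith
    have e2 : 2 * ε ≤ A 0 := by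
      have := min_le_right (T s + A s - 2 * Real.pi) (A 0); linarith
    have := hL.eq_of_sector hη (z := (x 0).1) (i := (x 0).2) (z' := (x s).1) (i' := (x s).2)
      ((hvert s).trans (hvert 0).symm) (γ := ε) (γ' := 2 * Real.pi - T s + ε) (by
        rw [hside s, hside 0, T0, mul_assoc, mul_assoc, ← exp_add, ← exp_add, ← mul_add, ← mul_add,
          ← ofReal_add, ← ofReal_add, show T s + (2 * Real.pi - T s + ε) = 2 * Real.pi + (0 + ε) by ring,
          ofReal_add (2 * Real.pi), mul_add I, exp_add, hexp, one_mul]) e0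
      (by change ε < A 0; linarith) (by linarith) (by change _ < A s; linarith)
    exact Prod.ext this.1 this.2
  set n := Nat.find hex with hn
  have hn1' : 2 * Real.pi ≤ T n := Nat.find_spec hex
  have hn0 : n ≠ 0 := fun h => by rw [h, T0] at hn1'; linarith
  obtain ⟨k, hk⟩ := Nat.exists_eq_succ_of_ne_zero hn0
  rw [Nat.succ_eq_add_one] at hk
  have hTk : T k < 2 * Real.pi := not_le.1 (Nat.find_min hex (by omega))
  have hTn : T n = 2 * Real.pi := by
    rcases hn1'.eq_or_lt with h | h
    · exact h.symm
    · exfalso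
      have hxk := hback k hTk.le (by rw [← hk]; exact h)
      have hk0 : k ≠ 0 := by
        rintro rfl
        rw [hk, hTs, T0] at h
        linarith [hA2 0]
      have h1 := hside k
      rw [hxk, hside 0, T0] at h1
      have hne : L.side₁ z₀ i₀ ≠ 0 := by
        rw [← norm_pos_iff, L.norm_side₁]; exact hδ
      have h2 := mul_left_cancel₀ hne h1
      have hTk0 : 0 < T k := by rw [← T0]; exact hTmono (Nat.pos_of_ne_zero hk0)
      simp only [ofReal_zero, mul_zero, Complex.exp_zero] at h2
      obtain ⟨l, hl⟩ := Complex.exp_eq_one_iff.1 h2.symm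
      have hl' : T k = l * (2 * Real.pi) := by
        have : (T k : ℂ) = ((l * (2 * Real.pi) : ℝ) : ℂ) := by
          push_cast
          exact mul_left_cancel₀ I_ne_zero (by rw [hl]; ring)
        exact_mod_cast this
      rw [hl'] at hTk0 hTk
      have l1 : 0 < (l : ℝ) := by
        by_contra hc
        push Not at hc
        nlinarith
      have l2 : (l : ℝ) < 1 := by nlinarith
      have : 0 < l := by exact_mod_cast l1
      have : l < 1 := by exact_mod_cast l2
      omega
  have hxn : x n = x 0 := hback n hTn.le (by rw [hTs, hTn]; linarith [hA1 n])
  have hper : ∀ s, x (s + n) = x s := by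
    intro s
    induction s with
    | zero => rw [zero_add]; exact hxn
    | succ s ih => rw [show s + 1 + n = (s + n) + 1 by ring, hxs, ih, hxs]
  have hdir : ∀ h : ℂ, h ≠ 0 → ∃ s, ∃ γ r : ℝ, 0 ≤ γ ∧ γ < A s ∧ 0 < r ∧
      h = r * (L.side₁ (x s).1 (x s).2 * exp (I * (γ : ℂ))) := by
    intro h hh
    have hne : L.side₁ z₀ i₀ ≠ 0 := by
      rw [← norm_pos_iff, L.norm_side₁]; exact hδ
    obtain ⟨t, r, ht0, ht1, hr, he⟩ : ∃ t r : ℝ, 0 ≤ t ∧ t < 2 * Real.pi ∧ 0 < r ∧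
        h = r * (L.side₁ z₀ i₀ * exp (I * (t : ℂ))) := by
      set w := h / L.side₁ z₀ i₀ with hw
      have hw0 : w ≠ 0 := div_ne_zero hh hne
      have hpol : (‖w‖ : ℂ) * exp (w.arg * I) = w := norm_mul_exp_arg_mul_I w
      have hhw : h = w * L.side₁ z₀ i₀ := by rw [hw]; field_simp
      rcases le_or_gt 0 w.arg with ha | ha
      · refine ⟨w.arg, ‖w‖, ha, by linarith [arg_le_pi w], norm_pos_iff.2 hw0, ?_⟩
        rw [mul_comm I, mul_left_comm, hpol, hhw]; ring
      · refine ⟨w.arg + 2 * Real.pi, ‖w‖, by linarith [neg_pi_lt_arg w], by linarith,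
          norm_pos_iff.2 hw0, ?_⟩
        rw [ofReal_add, mul_add, exp_add, hexp, mul_one, mul_comm I, mul_left_comm, hpol, hhw]; ring
    have hex2 : ∃ s, t < T s := ⟨n, by rw [hTn]; exact ht1⟩
    have hm := Nat.find_spec hex2
    have hm0 : Nat.find hex2 ≠ 0 := fun h => by rw [h, T0] at hm; linarith
    obtain ⟨s, hs⟩ := Nat.exists_eq_succ_of_ne_zero hm0
    rw [Nat.succ_eq_add_one] at hs
    have hle : T s ≤ t := not_lt.1 (Nat.find_min hex2 (by omega))
    rw [hs, hTs] at hm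
    refine ⟨s, t - T s, r, by linarith, by linarith, hr, ?_⟩
    rw [hside s, mul_assoc, ← exp_add, ← mul_add, ← ofReal_add, add_sub_cancel]
    exact he
  refine ⟨x, n, hx0, hvert, hsucc, hper, ?_, ?_, ?_⟩
  · have : T n = 2 * ∑ s ∈ Finset.range n, L.cornerAngle (x s).1 (x s).2 := by
      rw [Finset.mul_sum]
    linarith
  · intro z i hzi
    have hne : L.side₁ z i ≠ 0 := by
      rw [← norm_pos_iff, L.norm_side₁]; exact hδ
    obtain ⟨s, γ, r, hγ0, hγ1, hr, he⟩ := hdir _ hne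
    have hr1 : r = 1 := by
      have h1 := congrArg norm he
      rw [norm_mul, norm_mul, L.norm_side₁, L.norm_side₁, norm_real, Real.norm_eq_abs,
        abs_of_pos hr, mul_comm I, norm_exp_ofReal_mul_I, mul_one] at h1
      have : (r - 1) * δ = 0 := by linarith
      rcases mul_eq_zero.1 this with h | h
      · linarith
      · exact absurd h hδ.ne'
    rw [hr1, ofReal_one, one_mul] at he
    have hzA := (hL.cornerAngle z i).1
    set ε := min (A s - γ) (2 * L.cornerAngle z i) / 2 with hε
    have e0 : 0 < ε := by
      have : 0 < min (A s - γ) (2 * L.cornerAngle z i) := lt_min (by linarith) (by linarith)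
      positivity
    have e1 : 2 * ε ≤ A s - γ := by
      have := min_le_left (A s - γ) (2 * L.cornerAngle z i); linarith
    have e2 : 2 * ε ≤ 2 * L.cornerAngle z i := by
      have := min_le_right (A s - γ) (2 * L.cornerAngle z i); linarith
    have := hL.eq_of_sector hη (z := z) (i := i) (z' := (x s).1) (i' := (x s).2)
      ((hvert s).trans hzi.symm) (γ := ε) (γ' := γ + ε) (by
        rw [he, mul_assoc, ← exp_add, ← mul_add, ← ofReal_add]) e0
      (by linarith) (by linarith) (by change _ < A s; linarith)
    exact ⟨s, Prod.ext this.1 this.2⟩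
  · intro h
    by_cases hh : h = 0
    · refine ⟨0, ?_⟩
      rw [hh, add_zero, ← hvert 0, (L.coord_vert _ _).1, (L.coord_vert _ _).2.1]
      exact ⟨le_rfl, le_rfl⟩
    · obtain ⟨s, γ, r, hγ0, hγ1, hr, he⟩ := hdir h hh
      refine ⟨s, ?_⟩
      have hsp : 0 < Real.sin (2 * L.cornerAngle (x s).1 (x s).2) :=
        (hL.sin_two_mul hη (x s).1 (x s).2).1.trans_le (hL.sin_two_mul hη _ _).2
      obtain ⟨c1, c2⟩ := coord_polar hsp.ne' r γ
      rw [← hvert s, he, c1, c2]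
      have := hA2 s
      have s1 : 0 ≤ Real.sin (2 * L.cornerAngle (x s).1 (x s).2 - γ) :=
        Real.sin_nonneg_of_nonneg_of_le_pi (by change 0 ≤ A s - γ; linarith)
          (by change A s - γ ≤ _; linarith)
      have s2 : 0 ≤ Real.sin γ := Real.sin_nonneg_of_nonneg_of_le_pi hγ0 (by linarith)
      constructor <;> positivity

end IsoradialLattice

namespace IsoradialLattice

variable {δ : ℝ} {L : IsoradialLattice δ}

/-! ### Discrete domains as planar regions -/

theorem AngleBound.eq_of_first_side {η : ℝ} (hL : L.AngleBound η) (hη : 0 < η)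
    {z z' : L.E} {i i' : Fin 4} (hv : L.vert z' i' = L.vert z i)
    (h : L.vert z' (i' + 1) = L.vert z (i + 1)) : z' = z ∧ i' = i := by
  have h1 := (hL.cornerAngle z i).1
  have h2 := (hL.cornerAngle z' i').1
  refine hL.eq_of_sector hη hv (γ := η) (γ' := η) ?_ hη (by linarith) hη (by linarith)
  unfold side₁
  rw [hv, h]

/-- The open triangle cut from the rhombus `z` at its `l`-th vertex by the other diagonal. -/
def openTriangle (L : IsoradialLattice δ) (z : L.E) (l : Fin 4) : Set ℂ :=
  {x | 0 < L.cs z l x ∧ 0 < L.ct z l x ∧ L.cs z l x + L.ct z l x < 1}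

theorem isOpen_openTriangle (z : L.E) (l : Fin 4) : IsOpen (L.openTriangle z l) := by
  have h1 := L.continuous_cs z l
  have h2 := L.continuous_ct z l
  exact (isOpen_lt continuous_const h1).inter ((isOpen_lt continuous_const h2).inter
    (isOpen_lt (h1.add h2) continuous_const))

theorem Piece.shape_subset_hull (P : L.Piece) : P.shape ⊆ L.hull P.1 :=
  convexHull_mono (image_subset_range _ _)

theorem Piece.mem_shape {P : L.Piece} {l : Fin 4} (hP : P.2 = none ∨ P.2 = some l) {x : ℂ}
    (h1 : 0 ≤ L.cs P.1 l x) (h2 : 0 ≤ L.ct P.1 l x) (h3 : L.cs P.1 l x + L.ct P.1 l x ≤ 1) :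
    x ∈ P.shape := by
  have hc : Convex ℝ P.shape := convex_convexHull ℝ _
  have hv : ∀ j, P.2 ≠ some (j + 2) → L.vert P.1 j ∈ P.shape := fun j hj =>
    subset_convexHull ℝ _ ⟨j, hj, rfl⟩
  have hne : ∀ j : Fin 4, l ≠ j → P.2 ≠ some j := by
    rintro j hj
    rcases hP with h | h <;> rw [h] <;> simp [hj]
  have v0 := hv l (hne _ (by clear * -; revert l; decide))
  have v1 := hv (l + 1) (hne _ (by clear * -; revert l; decide))
  have v3 := hv (l + 3) (hne _ (by clear * -; revert l; decide))
  have e := L.eq_coord P.1 l x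
  have e3 : L.vert P.1 (l + 3) = L.vert P.1 l + L.side₂ P.1 l := by unfold side₂; ring
  have e1 : L.vert P.1 (l + 1) = L.vert P.1 l + L.side₁ P.1 l := by unfold side₁; ring
  have := hc.sum_mem (t := Finset.univ) (w := ![1 - L.cs P.1 l x - L.ct P.1 l x, L.cs P.1 l x,
    L.ct P.1 l x]) (z := ![L.vert P.1 l, L.vert P.1 (l + 1), L.vert P.1 (l + 3)])
    (by intro i _; fin_cases i <;> simp <;> linarith)
    (by simp [Fin.sum_univ_three]; ring) (by intro i _; fin_cases i <;> simpa)
  convert this using 1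
  simp only [Fin.sum_univ_three, Matrix.cons_val_zero, Matrix.cons_val_one, Matrix.cons_val,
    real_smul, e1, e3]
  conv_lhs => rw [e]
  push_cast
  ring

theorem Piece.openTriangle_subset {P : L.Piece} {l : Fin 4} (hP : P.2 = none ∨ P.2 = some l) :
    L.openTriangle P.1 l ⊆ interior P.shape :=
  interior_maximal (fun _ ⟨h1, h2, h3⟩ => P.mem_shape hP h1.le h2.le h3.le)
    (isOpen_openTriangle _ _)

theorem Piece.shape_subset_half {P : L.Piece} {j : Fin 4} (hP : P.2 = some j) {x : ℂ}
    (hx : x ∈ P.shape) : L.cs P.1 j x + L.ct P.1 j x ≤ 1 := by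
  have : P.shape ⊆ {x | L.cs P.1 j x + L.ct P.1 j x ≤ 1} := by
    refine convexHull_min ?_ ?_
    · rintro _ ⟨i, hi, rfl⟩
      have hi : P.2 ≠ some (i + 2) := hi
      rw [hP] at hi
      obtain ⟨a0, b0, a1, b1, a2, b2, a3, b3⟩ := L.coord_vert P.1 j
      rcases fin4_cases j i with rfl | rfl | rfl | rfl
      · simp [a0, b0]
      · simp [a1, b1]
      · exact absurd (by clear * -; revert j; decide) hi
      · simp [a3, b3]
    · intro x hx y hy a b ha hb hab
      simp only [mem_ofPred_eq, L.cs_affine P.1 j x y a b hab, L.ct_affine P.1 j x y a b hab] at *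
      nlinarith
  exact this hx

theorem Piece.mem_cut {P : L.Piece} {x : ℂ} (hx : x ∈ P.cut) : ∃ j, P.2 = some j ∧
    0 ≤ L.cs P.1 j x ∧ 0 ≤ L.ct P.1 j x ∧ L.cs P.1 j x + L.ct P.1 j x = 1 := by
  obtain ⟨j, hj, a, b, ha, hb, hab, rfl⟩ := hx
  refine ⟨j, hj, ?_⟩
  have e : j - 1 = j + 3 := by clear hj; revert j; decide
  obtain ⟨a0, b0, a1, b1, a2, b2, a3, b3⟩ := L.coord_vert P.1 j
  rw [L.cs_affine P.1 j _ _ a b hab, L.ct_affine P.1 j _ _ a b hab, e, a3, b3, a1, b1]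
  refine ⟨by linarith, by linarith, by linarith⟩

theorem Piece.cut_subset_hull (P : L.Piece) : P.cut ⊆ L.hull P.1 := by
  intro x hx
  obtain ⟨j, -, h1, h2, h3⟩ := Piece.mem_cut hx
  exact (L.mem_hull j).2 ⟨h1, by linarith, h2, by linarith⟩

variable {Ω : L.DiscreteDomain}

theorem DiscreteDomain.eq_of_openTriangle {P P' : L.Piece} (hP : P ∈ Ω.pieces)
    (hP' : P' ∈ Ω.pieces) (hz : P'.1 = P.1) {l l' : Fin 4} (h : P.2 = none ∨ P.2 = some l)
    (h' : P'.2 = none ∨ P'.2 = some l') {x : ℂ} (hx : x ∈ L.openTriangle P.1 l)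
    (hx' : x ∈ L.openTriangle P.1 l') : P' = P := by
  by_contra hne
  refine Set.disjoint_left.1 (Ω.disjoint_interior P hP P' hP' (Ne.symm hne))
    (Piece.openTriangle_subset h hx) (Piece.openTriangle_subset h' ?_)
  rwa [hz]

/-- A piece that is all of the rhombus near its `l`-th vertex is the only piece of this rhombus that
touches the vertex. -/
theorem DiscreteDomain.piece_unique {P P' : L.Piece} (hP : P ∈ Ω.pieces)
    (hP' : P' ∈ Ω.pieces) (hz : P'.1 = P.1) {l : Fin 4} (h : P.2 = none ∨ P.2 = some l)
    (h' : P'.2 ≠ some (l + 2)) : P' = P := by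
  have key : ∀ s t : ℝ, ∀ l' : Fin 4, (P'.2 = none ∨ P'.2 = some l') →
      (L.vert P.1 l + s * L.side₁ P.1 l + t * L.side₂ P.1 l) ∈ L.openTriangle P.1 l →
      (L.vert P.1 l + s * L.side₁ P.1 l + t * L.side₂ P.1 l) ∈ L.openTriangle P.1 l' → P' = P :=
    fun s t l' h1 h2 h3 => DiscreteDomain.eq_of_openTriangle hP hP' hz h h1 h2 h3
  have hmem : ∀ s t : ℝ, 0 < s → 0 < t → s + t < 1 →
      (L.vert P.1 l + s * L.side₁ P.1 l + t * L.side₂ P.1 l) ∈ L.openTriangle P.1 l := by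
    intro s t hs ht hst
    refine ⟨?_, ?_, ?_⟩ <;> simpa only [cs_coord, ct_coord]
  have hmem1 : ∀ s t : ℝ, 0 < t → t < s → s < 1 →
      (L.vert P.1 l + s * L.side₁ P.1 l + t * L.side₂ P.1 l) ∈ L.openTriangle P.1 (l + 1) := by
    intro s t hs ht hst
    refine ⟨?_, ?_, ?_⟩ <;> simp only [L.coord_succ P.1 l, cs_coord, ct_coord] <;> linarith
  have hmem3 : ∀ s t : ℝ, 0 < s → s < t → t < 1 →
      (L.vert P.1 l + s * L.side₁ P.1 l + t * L.side₂ P.1 l) ∈ L.openTriangle P.1 (l + 3) := by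
    intro s t hs ht hst
    have e : l = l + 3 + 1 := by clear h h' key hmem hmem1; revert l; decide
    obtain ⟨c1, c2⟩ := L.coord_succ P.1 (l + 3)
      (L.vert P.1 l + s * L.side₁ P.1 l + t * L.side₂ P.1 l)
    rw [← e, cs_coord] at c1
    rw [← e, ct_coord] at c2
    refine ⟨?_, ?_, ?_⟩ <;> linarith
  rcases hP2 : P'.2 with _ | l'
  · exact key (1 / 4) (1 / 4) l (Or.inl hP2) (hmem _ _ (by norm_num) (by norm_num) (by norm_num))
      (hmem _ _ (by norm_num) (by norm_num) (by norm_num))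
  · rcases fin4_cases l l' with rfl | rfl | rfl | rfl
    · exact key (1 / 4) (1 / 4) l' (Or.inr hP2)
        (hmem _ _ (by norm_num) (by norm_num) (by norm_num))
        (hmem _ _ (by norm_num) (by norm_num) (by norm_num))
    · exact key (1 / 2) (1 / 4) _ (Or.inr hP2)
        (hmem _ _ (by norm_num) (by norm_num) (by norm_num))
        (hmem1 _ _ (by norm_num) (by norm_num) (by norm_num))
    · exact absurd hP2 h'
    · exact key (1 / 4) (1 / 2) _ (Or.inr hP2)
        (hmem _ _ (by norm_num) (by norm_num) (by norm_num))
        (hmem3 _ _ (by norm_num) (by norm_num) (by norm_num))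

/-- The planar region of a discrete domain. -/
def DiscreteDomain.region (Ω : L.DiscreteDomain) : Set ℂ :=
  interior (⋃ P ∈ Ω.pieces, P.shape) \ ⋃ P ∈ Ω.pieces, P.cut

theorem DiscreteDomain.openRhombus_subset_region {P : L.Piece} (hP : P ∈ Ω.pieces)
    (hP2 : P.2 = none) : L.openRhombus P.1 ⊆ Ω.region := by
  intro x hx
  refine ⟨interior_mono (subset_biUnion_of_mem (u := fun P : L.Piece => P.shape) hP) ?_, ?_⟩
  · have : P.shape = L.hull P.1 := by
      have hv : P.verts = univ := by
        ext i; simp [Piece.verts, hP2]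
      rw [Piece.shape, hv, image_univ]; rfl
    rw [this]
    exact L.openRhombus_subset_interior _ hx
  · intro hcut
    obtain ⟨P', hP', hx'⟩ := mem_iUnion₂.1 hcut
    by_cases hz : P'.1 = P.1
    · obtain ⟨j, hj, -⟩ := Piece.mem_cut hx'
      have := DiscreteDomain.piece_unique hP hP' hz (l := j) (Or.inl hP2) (by
        rw [hj]; intro h; rw [Option.some_inj] at h; clear hj; revert j; decide)
      rw [this, hP2] at hj
      simp at hj
    · exact Set.disjoint_left.1 (L.disjoint_hull_openRhombus hz) (Piece.cut_subset_hull _ hx') hx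

/-- The elements of the boundary are disjoint from the region. -/
theorem DiscreteDomain.seg_disjoint_region {η : ℝ} (hL : L.AngleBound η) (hη : 0 < η) (hδ : 0 < δ)
    {b : L.BoundaryElement} (hb : b ∈ Ω.boundary) {x : ℂ} (hx : x ∈ b.seg) : x ∉ Ω.region := by
  rcases b with P | ⟨P, i⟩
  · intro h
    exact h.2 (mem_iUnion₂.2 ⟨P, hb.1, hx⟩)
  · obtain ⟨hP, hi, hno⟩ := hb
    -- Side `i` is the second side at vertex `i + 1`, and `z'` is the rhombus across it. If a point
    -- of the side were in the region, points of `z'` close to it would be covered by a piece of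
    -- `z'`. As this piece does not have the side, it is a half-rhombus on the far side of a
    -- diagonal, away from these points.
    obtain ⟨z', j, e1, e2⟩ := hL.exists_next hη hδ P.1 (i + 1)
    have e3 : i + 1 + 3 = i := by clear hx hi hno e1 e2; revert i; decide
    rw [e3] at e2
    intro hreg
    obtain ⟨a, t, ha, ht, hat, rfl⟩ := hx
    set x := a • L.vert P.1 i + t • L.vert P.1 (i + 1) with hxdef
    obtain ⟨a0, b0, a1, b1, -⟩ := L.coord_vert z' j
    have cx : L.cs z' j x = a := by
      rw [hxdef, L.cs_affine _ _ _ _ _ _ hat, ← e1, ← e2, a0, a1]; ring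
    have tx : L.ct z' j x = 0 := by
      rw [hxdef, L.ct_affine _ _ _ _ _ _ hat, ← e1, ← e2, b0, b1]; ring
    set y : ℂ := L.vert z' j + ((1 / 2 : ℝ) : ℂ) * L.side₁ z' j + ((1 / 4 : ℝ) : ℂ) * L.side₂ z' j
    have cy : L.cs z' j y = 1 / 2 := L.cs_coord z' j _ _
    have ty : L.ct z' j y = 1 / 4 := L.ct_coord z' j _ _
    have hlim : Filter.Tendsto (fun ε : ℝ => (1 - ε) • x + ε • y) (nhdsWithin 0 (Ioi 0)) (nhds x) := by
      have : Continuous fun ε : ℝ => (1 - ε) • x + ε • y := by fun_prop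
      have h := this.tendsto 0
      simp only [sub_zero, one_smul, zero_smul, add_zero] at h
      exact h.mono_left nhdsWithin_le_nhds
    have hev := hlim.eventually (isOpen_interior.mem_nhds hreg.1)
    have : Ioo (0 : ℝ) 1 ∈ nhdsWithin (0 : ℝ) (Ioi 0) := Ioo_mem_nhdsGT one_pos
    obtain ⟨ε, hε, hε0, hε1⟩ := (hev.and this).exists
    set w := (1 - ε) • x + ε • y with hw
    have cw : L.cs z' j w = (1 - ε) * a + ε * (1 / 2) := by
      rw [hw, L.cs_affine z' j x y (1 - ε) ε (by ring), cx, cy]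
    have tw : L.ct z' j w = ε * (1 / 4) := by
      rw [hw, L.ct_affine z' j x y (1 - ε) ε (by ring), tx, ty]; ring
    have m1 : 0 ≤ (1 - ε) * a := mul_nonneg (by linarith) ha
    have m2 : 0 ≤ (1 - ε) * t := mul_nonneg (by linarith) ht
    have m3 : (1 - ε) * a + (1 - ε) * t = 1 - ε := by rw [← mul_add, hat, mul_one]
    have hwo : w ∈ L.openRhombus z' := by
      refine (L.mem_openRhombus j).2 ⟨?_, ?_, ?_, ?_⟩ <;> first | rw [cw] | rw [tw]
      all_goals linarith
    obtain ⟨P', hP', hwP⟩ := mem_iUnion₂.1 (interior_subset hε)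
    have hz : P'.1 = z' := by
      by_contra hne
      exact Set.disjoint_left.1 (L.disjoint_hull_openRhombus hne)
        (Piece.shape_subset_hull _ hwP) hwo
    have hns : ¬ P'.HasSide j := fun hs => hno P' hP' j hs ⟨by rw [hz, e2], by rw [hz, e1]⟩
    have hcase : P'.2 = some (j + 2) ∨ P'.2 = some (j + 1 + 2) := by
      by_contra hcon
      push Not at hcon
      exact hns ⟨hcon.1, hcon.2⟩
    have c1 := L.coord_succ z' j w
    have c2 := L.coord_succ z' (j + 1) w
    have c3 := L.coord_succ z' (j + 1 + 1) w
    rcases hcase with h | h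
    · have := Piece.shape_subset_half h hwP
      rw [hz, show j + 2 = j + 1 + 1 by clear * -; revert j; decide, c2.1, c2.2, c1.1, c1.2] at this
      linarith
    · have := Piece.shape_subset_half h hwP
      rw [hz, show j + 1 + 2 = j + 1 + 1 + 1 by clear * -; revert j; decide, c3.1, c3.2, c2.1, c2.2, c1.1, c1.2] at this
      linarith

/-- A vertex of the lattice all of whose rhombi belong to the domain, at least near the vertex. -/
structure DiscreteDomain.IsInterior (Ω : L.DiscreteDomain) (v : ℂ) : Prop where
  exists_vert : ∃ z i, L.vert z i = v
  piece : ∀ z i, L.vert z i = v → ∃ Q ∈ Ω.pieces, Q.1 = z ∧ (Q.2 = none ∨ Q.2 = some i)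

theorem DiscreteDomain.IsInterior.not_mem_cut {v : ℂ} (hv : Ω.IsInterior v) {P : L.Piece}
    (hP : P ∈ Ω.pieces) {j l : Fin 4} (hj : P.2 = some j) (hl : l = j + 1 ∨ l = j + 3)
    (h : L.vert P.1 l = v) : False := by
  obtain ⟨Q, hQ, hQz, hQ2⟩ := hv.piece P.1 l h
  have := DiscreteDomain.piece_unique hQ hP hQz.symm hQ2 (by
    rw [hj]; intro h; rw [Option.some_inj] at h; clear * - h hl; revert j l; decide)
  rw [← this, hj] at hQ2
  rcases hQ2 with h' | h'
  · simp at h'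
  · rw [Option.some_inj] at h'; clear * - h' hl; revert j l; decide

/-- In its sector at `v`, each point of the ball has both coordinates below `1 / 2`, and so lies in
the triangle at `v` that belongs to the domain. A boundary edge of the same rhombus cannot meet this
part of the triangle; one of another rhombus can do so only with an end at `v`, where half a rhombus
would be missing. -/
theorem DiscreteDomain.IsInterior.ball_subset_region {η : ℝ} (hL : L.AngleBound η) (hη : 0 < η)
    (hδ : 0 < δ) {v : ℂ} (hv : Ω.IsInterior v) :
    Metric.ball v (δ * Real.sin (2 * η) / 2) ⊆ Ω.region := by
  obtain ⟨z₀, i₀, h₀⟩ := hv.exists_vert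
  obtain ⟨x, n, -, hfan⟩ := hL.exists_fan hη hδ z₀ i₀
  rw [h₀] at hfan
  obtain ⟨s1, -⟩ := hL.sin_two_mul hη z₀ i₀
  have key : ∀ y ∈ Metric.ball v (δ * Real.sin (2 * η) / 2), ∃ z l, L.vert z l = v ∧
      0 ≤ L.cs z l y ∧ 0 ≤ L.ct z l y ∧ L.cs z l y + L.ct z l y < 1 := by
    intro y hy
    obtain ⟨s, c1, c2⟩ := hfan.exists_sector (y - v)
    rw [add_sub_cancel] at c1 c2
    have hvs := hfan.vert_eq s
    refine ⟨_, _, hvs, c1, c2, ?_⟩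
    obtain ⟨b1, b2⟩ := hL.abs_cross_div_le hη hδ (x s).1 (x s).2 (y - v)
    have e1 := L.cs_add (x s).1 (x s).2 v (y - v)
    have e2 := L.ct_add (x s).1 (x s).2 v (y - v)
    rw [add_sub_cancel] at e1 e2
    obtain ⟨a0, b0, -⟩ := L.coord_vert (x s).1 (x s).2
    rw [hvs] at a0 b0
    rw [a0, zero_add] at e1
    rw [b0, zero_add] at e2
    rw [← e1] at b1
    rw [← e2] at b2
    have hlt : ‖y - v‖ / (δ * Real.sin (2 * η)) < 1 / 2 := by
      rw [Metric.mem_ball, dist_eq_norm] at hy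
      rw [div_lt_iff₀ (by positivity)]; linarith
    have := le_abs_self (L.cs (x s).1 (x s).2 y)
    have := le_abs_self (L.ct (x s).1 (x s).2 y)
    linarith
  intro y hy
  refine ⟨interior_maximal ?_ Metric.isOpen_ball hy, ?_⟩
  · intro y hy
    obtain ⟨z, l, hzl, c1, c2, c3⟩ := key y hy
    obtain ⟨Q, hQ, rfl, hQ2⟩ := hv.piece z l hzl
    exact mem_iUnion₂.2 ⟨Q, hQ, Piece.mem_shape hQ2 c1 c2 c3.le⟩
  · intro hcut
    obtain ⟨z, l, hzl, c1, c2, c3⟩ := key y hy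
    obtain ⟨P, hP, hyP⟩ := mem_iUnion₂.1 hcut
    obtain ⟨Q, hQ, hQz, hQ2⟩ := hv.piece z l hzl
    obtain ⟨j, hj, d1, d2, d3⟩ := Piece.mem_cut hyP
    by_cases hz : P.1 = z
    · by_cases hj2 : j = l + 2
      · have k1 := L.coord_succ z l y
        have k2 := L.coord_succ z (l + 1) y
        rw [hz, hj2, show l + 2 = l + 1 + 1 by clear * -; revert l; decide, k2.1, k2.2, k1.1, k1.2] at d3
        linarith
      · have := DiscreteDomain.piece_unique hQ hP (hz.trans hQz.symm) hQ2 (by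
          rw [hj]; simpa using hj2)
        rw [← this, hj] at hQ2
        rcases hQ2 with h | h
        · simp at h
        · rw [Option.some_inj] at h
          rw [hz, h] at d3
          linarith
    · have hyz : y ∈ L.hull z := (L.mem_hull l).2 ⟨c1, by linarith, c2, by linarith⟩
      have hno : y ∉ L.openRhombus P.1 :=
        Set.disjoint_left.1 (L.disjoint_hull_openRhombus (Ne.symm hz)) hyz
      have ey := L.eq_coord P.1 j y
      obtain ⟨l', hl', hyv⟩ : ∃ l', (l' = j + 1 ∨ l' = j + 3) ∧ y = L.vert P.1 l' := by
        rcases d1.eq_or_lt with h | h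
        · refine ⟨j + 3, Or.inr rfl, ?_⟩
          have : L.ct P.1 j y = 1 := by linarith
          rw [ey, ← h, this]; simp [side₂]
        · rcases d2.eq_or_lt with h' | h'
          · refine ⟨j + 1, Or.inl rfl, ?_⟩
            have : L.cs P.1 j y = 1 := by linarith
            rw [ey, ← h', this]; simp [side₁]
          · exact absurd ((L.mem_openRhombus j).2 ⟨h, by linarith, h', by linarith⟩) hno
      obtain ⟨m, hm, -⟩ := L.proper z P.1 l' (by rw [← hyv]; exact hyz)
      rw [← hyv] at hm
      obtain ⟨a0, b0, a1, b1, a2, b2, a3, b3⟩ := L.coord_vert z l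
      rcases fin4_cases l m with rfl | rfl | rfl | rfl
      · exact hv.not_mem_cut hP hj hl' (by rw [← hyv, hm, hzl])
      · rw [hm, a1, b1] at c3; linarith
      · rw [hm, a2, b2] at c3; linarith
      · rw [hm, a3, b3] at c3; linarith

end IsoradialLattice

namespace IsoradialLattice

variable {δ : ℝ} {L : IsoradialLattice δ}

/-! ### Massive s-holomorphicity at a vertex of a piece -/

/-- `1` for primal and `-1` for dual vertices. -/
def colour (l : Fin 4) : ℝ := if (l : ℕ) % 2 = 0 then 1 else -1

/-- Half the angle of the virtual rhombus at its `l`-th vertex. -/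
def virtualAngle (L : IsoradialLattice δ) (k : ℝ) (z : L.E) (l : Fin 4) : ℝ :=
  if (l : ℕ) % 2 = 0 then L.hatAngle k z else Real.pi / 2 - L.hatAngle k z

theorem abs_virtualAngle_sub (k : ℝ) (z : L.E) (l : Fin 4) :
    |L.virtualAngle k z l - L.cornerAngle z l| = |L.hatAngle k z - L.halfAngle z| := by
  unfold virtualAngle cornerAngle
  split_ifs
  · rfl
  · rw [← abs_neg]; congr 1; ring

/-- The value at the corner that joins `v` to its neighbour `w`, where `v` is primal or dual
according to the parity of `l`. -/
def LatticeFunction.atCorner (F : L.LatticeFunction) (l : Fin 4) (v w : ℂ) : ℂ :=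
  if (l : ℕ) % 2 = 0 then F.corner v w else F.corner w v

theorem atSide_first (F : L.LatticeFunction) (P : L.Piece) (l : Fin 4) :
    F.atSide P l = F.atCorner l (L.vert P.1 l) (L.vert P.1 (l + 1)) := by
  unfold LatticeFunction.atSide LatticeFunction.atCorner primalEnd dualEnd
  split_ifs <;> rfl

theorem atSide_second (F : L.LatticeFunction) (P : L.Piece) (l : Fin 4) :
    F.atSide P (l + 3) = F.atCorner l (L.vert P.1 l) (L.vert P.1 (l + 3)) := by
  unfold LatticeFunction.atSide LatticeFunction.atCorner primalEnd dualEnd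
  fin_cases l <;> simp

theorem virtualDir_first (hδ : 0 < δ) (k : ℝ) (z : L.E) (l : Fin 4) :
    L.virtualDir k z l =
      colour l * L.diagDir z l * exp (-(I * (L.virtualAngle k z l : ℂ))) := by
  obtain ⟨-, h2, -⟩ := L.side_eq z l
  have hδC : (δ : ℂ) ≠ 0 := by exact_mod_cast hδ.ne'
  unfold virtualDir cornerDir
  have hd : (L.vert z (dualEnd l) - L.vert z (primalEnd l)) = colour l * L.side₁ z l := by
    unfold dualEnd primalEnd colour side₁
    split_ifs
    · simp
    · simp
  have hn : ‖L.vert z (dualEnd l) - L.vert z (primalEnd l)‖ = δ := by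
    rw [hd, norm_mul, L.norm_side₁]
    unfold colour; split_ifs <;> simp
  rw [hn, hd, h2]
  have e : exp (I * ((turnSign l * (L.hatAngle k z - L.halfAngle z) : ℝ) : ℂ)) *
      exp (-(I * (L.cornerAngle z l : ℂ))) = exp (-(I * (L.virtualAngle k z l : ℂ))) := by
    rw [← exp_add]
    congr 1
    unfold turnSign cornerAngle virtualAngle
    split_ifs <;> push_cast <;> ring
  rw [← e]
  field_simp

theorem virtualDir_second (hδ : 0 < δ) (k : ℝ) (z : L.E) (l : Fin 4) :
    L.virtualDir k z (l + 3) =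
      colour l * L.diagDir z l * exp (I * (L.virtualAngle k z l : ℂ)) := by
  obtain ⟨-, -, h3⟩ := L.side_eq z l
  have hδC : (δ : ℂ) ≠ 0 := by exact_mod_cast hδ.ne'
  unfold virtualDir cornerDir
  have hd : (L.vert z (dualEnd (l + 3)) - L.vert z (primalEnd (l + 3))) =
      colour l * L.side₂ z l := by
    unfold dualEnd primalEnd colour side₂
    fin_cases l <;> simp
  have hn : ‖L.vert z (dualEnd (l + 3)) - L.vert z (primalEnd (l + 3))‖ = δ := by
    rw [hd, norm_mul, L.norm_side₂]
    unfold colour; split_ifs <;> simp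
  rw [hn, hd, h3]
  have e : exp (I * ((turnSign (l + 3) * (L.hatAngle k z - L.halfAngle z) : ℝ) : ℂ)) *
      exp (I * (L.cornerAngle z l : ℂ)) = exp (I * (L.virtualAngle k z l : ℂ)) := by
    rw [← exp_add]
    congr 1
    unfold turnSign cornerAngle virtualAngle
    fin_cases l <;> simp <;> ring
  rw [← e]
  field_simp

theorem turn_first (k : ℝ) (z : L.E) (l : Fin 4) :
    (turnSign l * (L.hatAngle k z - L.halfAngle z) / 2 : ℝ) =
      -(L.virtualAngle k z l - L.cornerAngle z l) / 2 := by
  unfold turnSign cornerAngle virtualAngle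
  split_ifs <;> ring

theorem turn_second (k : ℝ) (z : L.E) (l : Fin 4) :
    (turnSign (l + 3) * (L.hatAngle k z - L.halfAngle z) / 2 : ℝ) =
      (L.virtualAngle k z l - L.cornerAngle z l) / 2 := by
  unfold turnSign cornerAngle virtualAngle
  fin_cases l <;> simp

/-- A square root of `I * ν` is a phase that turns the projection line into the real axis. -/
theorem mul_projLine {u ν : ℂ} (hu : ‖u‖ = 1) (h : u ^ 2 = I * ν) (F : ℂ) :
    u * projLine ν F = ((u * F).re : ℂ) := by
  have huu : u * (starRingEnd ℂ) u = 1 := by rw [mul_conj, normSq_eq_norm_sq, hu]; simp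
  have hu0 : u ≠ 0 := by rw [← norm_pos_iff, hu]; exact one_pos
  have hinv : u⁻¹ = (starRingEnd ℂ) u := by
    field_simp; rw [huu]
  rw [projLine, ← h, re_eq_add_conj, map_mul, ← hinv]
  field_simp

theorem norm_projLine_sq {ν : ℂ} (hν : ‖ν‖ = 1) (F : ℂ) :
    ‖projLine ν F‖ ^ 2 = (‖F‖ ^ 2 - (ν * F ^ 2).im) / 2 := by
  obtain ⟨u, hu⟩ := IsAlgClosed.exists_pow_nat_eq (I * ν) (n := 2) (by norm_num)
  have hun : ‖u‖ = 1 := by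
    have : ‖u‖ ^ 2 = 1 := by rw [← norm_pow, hu, norm_mul, norm_I, hν, one_mul]
    nlinarith [norm_nonneg u]
  have h1 := mul_projLine hun hu F
  have h2 : ‖projLine ν F‖ = |(u * F).re| := by
    rw [← Real.norm_eq_abs, ← norm_real, ← h1, norm_mul, hun, one_mul]
  have h3 : ((u * F) ^ 2).re = -(ν * F ^ 2).im := by
    rw [mul_pow, hu, mul_assoc]
    simp
  have h4 : (u * F).re ^ 2 + (u * F).im ^ 2 = ‖F‖ ^ 2 := by
    have : ‖F‖ = ‖u * F‖ := by rw [norm_mul, hun, one_mul]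
    rw [this, ← normSq_eq_norm_sq, normSq_apply]; ring
  rw [h2, sq_abs]
  have h5 : ((u * F) ^ 2).re = (u * F).re ^ 2 - (u * F).im ^ 2 := by
    rw [sq, mul_re]; ring
  linarith

theorem hasSide_first {P : L.Piece} {l : Fin 4} (hP : P.2 = none ∨ P.2 = some l) :
    P.HasSide l ∧ P.HasSide (l + 3) := by
  have hne : ∀ j : Fin 4, l ≠ j → P.2 ≠ some j := by
    rintro j hj
    rcases hP with h | h <;> rw [h] <;> simp [hj]
  refine ⟨⟨hne _ ?_, hne _ ?_⟩, ⟨hne _ ?_, hne _ ?_⟩⟩ <;> (clear * -; revert l; decide)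

/-- The corner values at the two sides of a vertex, in terms of the value at the rhombus. -/
theorem SHolAt.corner_values (hδ : 0 < δ) {k : ℝ} {F : L.LatticeFunction} {P : L.Piece}
    (hF : SHolAt k F P) {l : Fin 4} (hP : P.2 = none ∨ P.2 = some l) {ω h : ℂ}
    (hω : ω ^ 2 = colour l * I) (hωn : ‖ω‖ = 1) (hh : h ^ 2 = L.diagDir P.1 l) (hhn : ‖h‖ = 1) :
    ω * (h * exp (-(I * (L.cornerAngle P.1 l : ℂ) / 2))) *
        F.atCorner l (L.vert P.1 l) (L.vert P.1 (l + 1)) =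
      (((ω * h * F.edge P) * exp (-(I * (L.virtualAngle k P.1 l : ℂ) / 2))).re : ℂ) ∧
    ω * (h * exp (I * (L.cornerAngle P.1 l : ℂ) / 2)) *
        F.atCorner l (L.vert P.1 l) (L.vert P.1 (l + 3)) =
      (((ω * h * F.edge P) * exp (I * (L.virtualAngle k P.1 l : ℂ) / 2)).re : ℂ) := by
  obtain ⟨s1, s2⟩ := hasSide_first hP
  have f1 := hF l s1
  have f2 := hF (l + 3) s2
  have hne : ∀ x : ℝ, ‖exp (I * (x : ℂ))‖ = 1 := fun x => by
    rw [mul_comm, norm_exp_ofReal_mul_I]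
  constructor
  -- A square root of `I ν(ξ̂)`. The correction factor in the s-holomorphicity relation replaces its
  -- virtual half-angle by the true one at the corner value. This is why corner values fit together
  -- around a vertex with true angles, while virtual angles remain at the value on the rhombus.
  · set u := ω * h * exp (-(I * (L.virtualAngle k P.1 l : ℂ) / 2)) with hu
    have hun : ‖u‖ = 1 := by
      have := hne (-(L.virtualAngle k P.1 l / 2))
      rw [show I * ((-(L.virtualAngle k P.1 l / 2) : ℝ) : ℂ) =
        -(I * (L.virtualAngle k P.1 l : ℂ) / 2) by push_cast; ring] at this
      rw [hu, norm_mul, norm_mul, hωn, hhn, this]; norm_num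
    have hu2 : u ^ 2 = I * L.virtualDir k P.1 l := by
      rw [hu, virtualDir_first hδ, mul_pow, mul_pow, hω, hh, ← exp_nat_mul]
      rw [show ((2 : ℕ) : ℂ) * -(I * (L.virtualAngle k P.1 l : ℂ) / 2) =
        -(I * (L.virtualAngle k P.1 l : ℂ)) by push_cast; ring]
      ring
    have := mul_projLine hun hu2 (F.edge P)
    rw [f1, atSide_first, turn_first] at this
    rw [show (ω * h * F.edge P) * exp (-(I * (L.virtualAngle k P.1 l : ℂ) / 2)) = u * F.edge P by
      rw [hu]; ring, ← this, hu, ← mul_assoc, ← mul_assoc, mul_assoc (ω * h) (exp _) (exp _),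
      ← exp_add]
    congr 3
    push_cast; ring
  · set u := ω * h * exp (I * (L.virtualAngle k P.1 l : ℂ) / 2) with hu
    have hun : ‖u‖ = 1 := by
      have := hne (L.virtualAngle k P.1 l / 2)
      rw [show I * ((L.virtualAngle k P.1 l / 2 : ℝ) : ℂ) =
        I * (L.virtualAngle k P.1 l : ℂ) / 2 by push_cast; ring] at this
      rw [hu, norm_mul, norm_mul, hωn, hhn, this]; norm_num
    have hu2 : u ^ 2 = I * L.virtualDir k P.1 (l + 3) := by
      rw [hu, virtualDir_second hδ, mul_pow, mul_pow, hω, hh, ← exp_nat_mul]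
      rw [show ((2 : ℕ) : ℂ) * (I * (L.virtualAngle k P.1 l : ℂ) / 2) =
        I * (L.virtualAngle k P.1 l : ℂ) by push_cast; ring]
      ring
    have := mul_projLine hun hu2 (F.edge P)
    rw [f2, atSide_second, turn_second] at this
    rw [show (ω * h * F.edge P) * exp (I * (L.virtualAngle k P.1 l : ℂ) / 2) = u * F.edge P by
      rw [hu]; ring, ← this, hu, ← mul_assoc, ← mul_assoc, mul_assoc (ω * h) (exp _) (exp _),
      ← exp_add]
    congr 3
    push_cast; ring

/-- The normal component of the square of the value at a rhombus as a form of its corner values. -/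
theorem sin_mul_eq_cornerForm {ψ : ℝ} (hψ : Real.sin ψ ≠ 0) (G : ℂ) :
    Real.sin ψ * -(G ^ 2).re =
      cornerForm ψ (G * exp (-(I * (ψ : ℂ) / 2))).re (G * exp (I * (ψ : ℂ) / 2)).re := by
  have e1 : exp (I * (ψ : ℂ) / 2) = (Real.cos (ψ / 2) : ℂ) + Real.sin (ψ / 2) * I := by
    rw [show I * (ψ : ℂ) / 2 = ((ψ / 2 : ℝ) : ℂ) * I by push_cast; ring, exp_mul_I, ofReal_cos,
      ofReal_sin]
  have e2 : exp (-(I * (ψ : ℂ) / 2)) = (Real.cos (ψ / 2) : ℂ) - Real.sin (ψ / 2) * I := by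
    rw [show -(I * (ψ : ℂ) / 2) = -((ψ / 2 : ℝ) : ℂ) * I by push_cast; ring, exp_mul_I,
      Complex.cos_neg, Complex.sin_neg, ofReal_cos, ofReal_sin]; ring
  rw [e1, e2]
  have hs : Real.sin ψ = 2 * Real.sin (ψ / 2) * Real.cos (ψ / 2) := by
    rw [← Real.sin_two_mul]; congr 1; ring
  have hc : Real.cos ψ = Real.cos (ψ / 2) ^ 2 - Real.sin (ψ / 2) ^ 2 := by
    rw [← Real.cos_two_mul']; congr 1; ring
  have h1 := Real.sin_sq_add_cos_sq (ψ / 2)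
  have hs0 : Real.sin (ψ / 2) ≠ 0 := fun h => hψ (by rw [hs, h]; ring)
  have hc0 : Real.cos (ψ / 2) ≠ 0 := fun h => hψ (by rw [hs, h]; ring)
  unfold cornerForm
  rw [hs, hc]
  simp only [sq G, mul_re, sub_re, add_re, sub_im, add_im, ofReal_re, ofReal_im, I_re, I_im, mul_im]
  generalize Real.sin (ψ / 2) = s at *
  generalize Real.cos (ψ / 2) = c at *
  field_simp
  simp only [zero_mul, sub_zero, add_zero, zero_add, zero_sub]
  linear_combination (2 * s ^ 2 * G.im ^ 2 - 2 * c ^ 2 * G.re ^ 2) * h1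

/-- On the way from `l` to `l + 2` through `l + 1`, the terms `|F|²` of the two squared projections
cancel. What remains is a difference of two virtual side directions, a multiple of the diagonal by
twice the cosine of the virtual angle. -/
theorem mul_increment (hδ : 0 < δ) {k : ℝ} {Ω : L.DiscreteDomain} {F : L.LatticeFunction}
    {H : L.Piece → Fin 4 → ℝ} (hH : IsSquareIntegral Ω F H) {P : L.Piece} (hP : P ∈ Ω.pieces)
    (hP2 : P.2 = none) (hF : SHolAt k F P) (l : Fin 4) :
    colour l * (H P (l + 2) - H P l) = 2 * δ * Real.cos (L.virtualAngle k P.1 l) *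
      (colour l * (L.diagDir P.1 l * F.edge P ^ 2).im) := by
  have hs : ∀ i, P.HasSide i := fun i => by
    constructor <;> (change P.2 ≠ _; rw [hP2]; simp)
  have hn : ∀ i, ‖F.atSide P i‖ ^ 2 = (‖F.edge P‖ ^ 2 - (L.virtualDir k P.1 i * F.edge P ^ 2).im) / 2 := by
    intro i
    have h1 := hF i (hs i)
    have hv : ‖L.virtualDir k P.1 i‖ = 1 := by
      rw [virtualDir_first hδ, norm_mul, norm_mul, (L.side_eq P.1 i).1, norm_real]
      rw [show -(I * (L.virtualAngle k P.1 i : ℂ)) = ((-L.virtualAngle k P.1 i : ℝ) : ℂ) * I by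
        push_cast; ring, norm_exp_ofReal_mul_I]
      unfold colour; split_ifs <;> simp
    rw [← norm_projLine_sq hv, h1, norm_mul, show ∀ x : ℝ, -I * (x : ℂ) = ((-x : ℝ) : ℂ) * I by
      intro x; push_cast; ring, norm_exp_ofReal_mul_I, one_mul]
  have e1 : colour l * (H P l - H P (l + 1)) = 2 * δ * ‖F.atSide P l‖ ^ 2 := by
    rw [← hH.increment P hP l (hs l)]
    unfold colour primalEnd dualEnd
    split_ifs <;> ring
  have e2 : colour l * (H P (l + 2) - H P (l + 1)) = 2 * δ * ‖F.atSide P (l + 1)‖ ^ 2 := by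
    rw [← hH.increment P hP (l + 1) (hs _)]
    clear * -
    unfold colour primalEnd dualEnd
    fin_cases l <;> simp
  have hd : L.diagDir P.1 (l + 2) = -L.diagDir P.1 l := by
    rw [show l + 2 = l + 1 + 1 by clear * -; revert l; decide, L.diagDir_succ, L.diagDir_succ,
      ← mul_assoc, I_mul_I, neg_one_mul]
  have v2 : L.virtualDir k P.1 (l + 1) =
      -(colour l * L.diagDir P.1 l * exp (I * (L.virtualAngle k P.1 l : ℂ))) := by
    have := virtualDir_second (L := L) hδ k P.1 (l + 2)
    rw [show l + 2 + 3 = l + 1 by clear * -; revert l; decide, hd] at this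
    rw [this, show colour (l + 2) = colour l by unfold colour; clear * -; fin_cases l <;> simp,
      show L.virtualAngle k P.1 (l + 2) = L.virtualAngle k P.1 l by
        unfold virtualAngle; clear * -; fin_cases l <;> simp]
    ring
  have hk : (L.virtualDir k P.1 l * F.edge P ^ 2).im - (L.virtualDir k P.1 (l + 1) * F.edge P ^ 2).im
      = 2 * Real.cos (L.virtualAngle k P.1 l) *
        (colour l * (L.diagDir P.1 l * F.edge P ^ 2).im) := by
    rw [← sub_im, v2, virtualDir_first hδ, ← im_ofReal_mul, ← im_ofReal_mul]
    congr 1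
    push_cast
    rw [Complex.cos]
    rw [show -(I * (L.virtualAngle k P.1 l : ℂ)) = -(L.virtualAngle k P.1 l : ℂ) * I by ring,
      show (I * (L.virtualAngle k P.1 l : ℂ)) = (L.virtualAngle k P.1 l : ℂ) * I by ring]
    ring
  rw [hn] at e1 e2
  linear_combination e2 - e1 + δ * hk

/-- The boundary coefficient has the same shape as the interior one, with `cos ψ` replaced by `(1 +
cos ψ) / 2` for the virtual angle `ψ` seen from `z_int`, on wired and free edges alike. -/
theorem mul_increment_boundary {η : ℝ} (hL : L.AngleBound η) (hη : 0 < η) {k c : ℝ}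
    {F : L.LatticeFunction} {H : L.Piece → Fin 4 → ℝ} {P : L.Piece} {l : Fin 4} (hP2 : P.2 = some l)
    (hS : HasBoundaryValue k F H c (.edge P)) :
    colour l * (H P (l + 2) - H P l) = δ * (1 + Real.cos (L.virtualAngle k P.1 l)) *
      (colour l * (L.diagDir P.1 l * F.edge P ^ 2).im) := by
  obtain ⟨-, -, -, -, h⟩ := hS l hP2
  have hα := hL.cornerAngle P.1 l
  have hc0 : 0 < Real.cos (L.cornerAngle P.1 l) :=
    Real.cos_pos_of_mem_Ioo ⟨by linarith [hα.1, Real.pi_pos], by linarith [hα.2]⟩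
  have hb : boundaryCoeff L k P.1 l =
      ((Real.cos (L.virtualAngle k P.1 l) + 1) / 2) / Real.cos (L.cornerAngle P.1 l) := by
    unfold boundaryCoeff virtualAngle cornerAngle
    by_cases hl : (l : ℕ) % 2 = 0
    · rw [if_pos hl, if_pos hl, if_neg (by omega)]
    · rw [if_neg hl, if_neg hl, if_pos (by omega), Real.cos_pi_div_two_sub, Real.cos_pi_div_two_sub]
  rw [h, hb, L.vert_opp_sub, mul_assoc (ofReal _), im_ofReal_mul]
  field_simp
  ring

end IsoradialLattice

namespace IsoradialLattice

variable {δ : ℝ} {L : IsoradialLattice δ}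

/-! ### The sub-mean-value inequality at an interior vertex -/

theorem colour_congr {l l' : Fin 4} (h : (l : ℕ) % 2 = (l' : ℕ) % 2) : colour l = colour l' := by
  unfold colour; rw [h]

theorem atCorner_congr (F : L.LatticeFunction) {l l' : Fin 4} (h : (l : ℕ) % 2 = (l' : ℕ) % 2) :
    F.atCorner l = F.atCorner l' := by
  funext v w; unfold LatticeFunction.atCorner; rw [h]

theorem exists_unit_sq {a : ℂ} (ha : ‖a‖ = 1) : ∃ u : ℂ, u ^ 2 = a ∧ ‖u‖ = 1 := by
  obtain ⟨u, hu⟩ := IsAlgClosed.exists_pow_nat_eq a (n := 2) (by norm_num)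
  refine ⟨u, hu, ?_⟩
  have : ‖u‖ ^ 2 = 1 := by rw [← norm_pow, hu, ha]
  nlinarith [norm_nonneg u]

theorem norm_exp_I_mul (x : ℝ) : ‖exp (I * (x : ℂ))‖ = 1 := by
  rw [mul_comm, norm_exp_ofReal_mul_I]

namespace IsFan

variable {v : ℂ} {x : ℕ → L.E × Fin 4} {n : ℕ}

theorem side₁_succ (hx : L.IsFan v x n) (s : ℕ) :
    L.side₁ (x (s + 1)).1 (x (s + 1)).2 = L.side₂ (x s).1 (x s).2 := by
  unfold side₁ side₂
  rw [hx.succ, hx.vert_eq, hx.vert_eq]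

theorem side₁_eq (hx : L.IsFan v x n) (s : ℕ) :
    L.side₁ (x s).1 (x s).2 = L.side₁ (x 0).1 (x 0).2 *
      exp (I * ((2 * ∑ j ∈ Finset.range s, L.cornerAngle (x j).1 (x j).2 : ℝ) : ℂ)) := by
  induction s with
  | zero => simp
  | succ s ih =>
    rw [hx.side₁_succ, side₂_eq_rotate, ih, mul_assoc, ← exp_add, Finset.sum_range_succ]
    congr 2
    push_cast; ring

theorem diagDir_eq (hx : L.IsFan v x n) (hδ : 0 < δ) (s : ℕ) :
    L.diagDir (x s).1 (x s).2 = L.diagDir (x 0).1 (x 0).2 *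
      exp (-(I * (L.cornerAngle (x 0).1 (x 0).2 : ℂ))) *
      exp (I * ((2 * ∑ j ∈ Finset.range s, L.cornerAngle (x j).1 (x j).2 : ℝ) : ℂ)) *
      exp (I * (L.cornerAngle (x s).1 (x s).2 : ℂ)) := by
  have h := hx.side₁_eq s
  have hδC : (δ : ℂ) ≠ 0 := by exact_mod_cast hδ.ne'
  rw [(L.side_eq _ _).2.1, (L.side_eq (x 0).1 (x 0).2).2.1] at h
  have e : exp (-(I * (L.cornerAngle (x s).1 (x s).2 : ℂ))) *
      exp (I * (L.cornerAngle (x s).1 (x s).2 : ℂ)) = 1 := by rw [← exp_add]; simp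
  have h' := congrArg (· * exp (I * (L.cornerAngle (x s).1 (x s).2 : ℂ))) h
  rw [mul_assoc _ (exp (-(I * (L.cornerAngle (x s).1 (x s).2 : ℂ)))), e, mul_one] at h'
  refine mul_left_cancel₀ hδC (h'.trans ?_)
  ring

/-- The linear and quadratic functions of the plane are discrete harmonic. -/
theorem sum_tan_mul (hx : L.IsFan v x n) {η : ℝ} (hL : L.AngleBound η) (hη : 0 < η) :
    ∑ s ∈ Finset.range n, (Real.tan (L.cornerAngle (x s).1 (x s).2) : ℂ) *
        (L.vert (x s).1 ((x s).2 + 2) - v) = 0 ∧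
    ∑ s ∈ Finset.range n, (Real.tan (L.cornerAngle (x s).1 (x s).2) : ℂ) *
        (L.vert (x s).1 ((x s).2 + 2) - v) ^ 2 = 0 := by
  set f : ℕ → ℂ := fun s => L.side₁ (x s).1 (x s).2 with hf
  -- The tangent times the diagonal is a quarter turn of the difference of the two sides, and the
  -- diagonal is their sum. So the weighted diagonals telescope around the fan, and so do the
  -- weighted squares.
  have key : ∀ s, (Real.tan (L.cornerAngle (x s).1 (x s).2) : ℂ) *
        (L.vert (x s).1 ((x s).2 + 2) - v) = -I * (f (s + 1) - f s) ∧
      L.vert (x s).1 ((x s).2 + 2) - v = f (s + 1) + f s := by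
    intro s
    have hα := hL.cornerAngle (x s).1 (x s).2
    have hc : Real.cos (L.cornerAngle (x s).1 (x s).2) ≠ 0 :=
      (Real.cos_pos_of_mem_Ioo ⟨by linarith [hα.1, Real.pi_pos], by linarith [hα.2]⟩).ne'
    have hv := hx.vert_eq s
    obtain ⟨-, h1, h2⟩ := L.side_eq (x s).1 (x s).2
    have hd := L.vert_opp_sub (x s).1 (x s).2
    rw [hv] at hd
    simp only [hf]
    rw [hx.side₁_succ, h1, h2, hd]
    have ec : exp (I * (L.cornerAngle (x s).1 (x s).2 : ℂ)) =
        (Real.cos (L.cornerAngle (x s).1 (x s).2) : ℂ) +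
          Real.sin (L.cornerAngle (x s).1 (x s).2) * I := by
      rw [mul_comm, exp_mul_I, ofReal_cos, ofReal_sin]
    have ec' : exp (-(I * (L.cornerAngle (x s).1 (x s).2 : ℂ))) =
        (Real.cos (L.cornerAngle (x s).1 (x s).2) : ℂ) -
          Real.sin (L.cornerAngle (x s).1 (x s).2) * I := by
      rw [show -(I * (L.cornerAngle (x s).1 (x s).2 : ℂ)) =
        (-(L.cornerAngle (x s).1 (x s).2 : ℂ)) * I by ring, exp_mul_I, Complex.cos_neg,
        Complex.sin_neg, ofReal_cos, ofReal_sin]; ring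
    rw [ec, ec']
    have hcC : (Real.cos (L.cornerAngle (x s).1 (x s).2) : ℂ) ≠ 0 := by exact_mod_cast hc
    rw [Real.tan_eq_sin_div_cos, ofReal_div]
    generalize (Real.cos (L.cornerAngle (x s).1 (x s).2)) = cc at *
    generalize (Real.sin (L.cornerAngle (x s).1 (x s).2)) = ss at *
    constructor
    · push_cast
      field_simp
      linear_combination (2 * (ss : ℂ) * δ * L.diagDir (x s).1 (x s).2) * I_sq
    · push_cast; ring
  have hper : f n = f 0 := by
    have := hx.periodic 0
    rw [zero_add] at this
    simp only [hf, this]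
  constructor
  · rw [Finset.sum_congr rfl fun s _ => (key s).1, ← Finset.mul_sum, Finset.sum_range_sub, hper]
    simp
  · have : ∀ s, (Real.tan (L.cornerAngle (x s).1 (x s).2) : ℂ) *
        (L.vert (x s).1 ((x s).2 + 2) - v) ^ 2 = -I * (f (s + 1) ^ 2 - f s ^ 2) := by
      intro s
      rw [sq (L.vert (x s).1 ((x s).2 + 2) - v), ← mul_assoc, (key s).1, (key s).2]; ring
    rw [Finset.sum_congr rfl fun s _ => this s, ← Finset.mul_sum,
      Finset.sum_range_sub (fun s => f s ^ 2), hper]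
    simp

end IsFan

/-- The weight of the edge of a piece at a vertex with half-angle `α`. -/
def edgeWeight (Q : L.Piece) (α : ℝ) : ℝ :=
  if Q.2 = none then Real.tan α else 2 * Real.sin α / (1 + Real.cos α)

/-- The normal component of the square of `F` at a piece, seen from its `l`-th vertex. -/
def normalComponent (F : L.LatticeFunction) (Q : L.Piece) (l : Fin 4) : ℝ :=
  colour l * (L.diagDir Q.1 l * F.edge Q ^ 2).im

/-- The phase at the `s`-th corner is a square root of the direction, continued by the true
half-angles. These add up to `π` over one turn, which reverses the sign of the phase. The corner
values thereby become the real antiperiodic sequence `X` of `sum_sin_mul_ge`. -/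
theorem IsFan.sum_sin_mul_normalComponent {η : ℝ} (hη : 0 < η) : ∃ C κ₀ : ℝ, 0 < C ∧ 0 < κ₀ ∧
    κ₀ ≤ η / 2 ∧ ∀ {δ : ℝ} {L : IsoradialLattice δ} (_ : L.AngleBound η) (_ : 0 < δ) {v : ℂ}
      {x : ℕ → L.E × Fin 4} {n : ℕ} (_ : L.IsFan v x n) (k κ : ℝ) (_ : κ ≤ κ₀)
      (_ : ∀ z, |L.hatAngle k z - L.halfAngle z| ≤ κ) (F : L.LatticeFunction)
      (Q : L.E → Fin 4 → L.Piece) (_ : ∀ s, (Q (x s).1 (x s).2).1 = (x s).1)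
      (_ : ∀ s, (Q (x s).1 (x s).2).2 = none ∨ (Q (x s).1 (x s).2).2 = some (x s).2)
      (_ : ∀ s, SHolAt k F (Q (x s).1 (x s).2)),
      -(C * κ * ∑ s ∈ Finset.range n, |normalComponent F (Q (x s).1 (x s).2) (x s).2|) ≤
        ∑ s ∈ Finset.range n, Real.sin (L.cornerAngle (x s).1 (x s).2) *
          normalComponent F (Q (x s).1 (x s).2) (x s).2 := by
  obtain ⟨C, κ₀, hC, hκ₀, hκη, key⟩ := sum_sin_mul_ge hη
  refine ⟨C, κ₀, hC, hκ₀, hκη, ?_⟩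
  intro δ L hL hδ v x n hx k κ hκ hhat F Q hQ1 hQ2 hF
  set α : ℕ → ℝ := fun s => L.cornerAngle (x s).1 (x s).2 with hα
  set ψ : ℕ → ℝ := fun s => L.virtualAngle k (x s).1 (x s).2 with hψ
  set T : ℕ → ℝ := fun s => ∑ j ∈ Finset.range s, α j with hT
  set l := (x 0).2 with hl
  have hpar : ∀ s, ((x s).2 : ℕ) % 2 = (l : ℕ) % 2 := fun s =>
    L.parity_eq ((hx.vert_eq s).trans (hx.vert_eq 0).symm)
  obtain ⟨ω, hω, hωn⟩ := exists_unit_sq (a := colour l * I) (by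
    unfold colour; split_ifs <;> simp)
  obtain ⟨g, hg, hgn⟩ := exists_unit_sq (a := L.diagDir (x 0).1 (x 0).2 *
      exp (-(I * (L.cornerAngle (x 0).1 (x 0).2 : ℂ)))) (by
    rw [norm_mul, (L.side_eq _ _).1, ← mul_neg, ← ofReal_neg, norm_exp_I_mul, one_mul])
  set X : ℕ → ℝ := fun s => (ω * (g * exp (I * (T s : ℂ))) *
    F.atCorner l v (L.vert (x s).1 ((x s).2 + 1))).re with hX
  have hαb : ∀ s, α s ∈ Icc η (Real.pi / 2 - η) := fun s => hL.cornerAngle _ _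
  have hαp : ∀ s, α (s + n) = α s := fun s => by simp only [hα, hx.periodic]
  have hψα : ∀ s, |ψ s - α s| ≤ κ := fun s => by
    simp only [hψ, hα, abs_virtualAngle_sub]; exact hhat _
  have main : ∀ s, X s = (ω * (g * exp (I * (T s : ℂ)) * exp (I * (α s : ℂ) / 2)) *
        F.edge (Q (x s).1 (x s).2) * exp (-(I * (ψ s : ℂ) / 2))).re ∧
      X (s + 1) = (ω * (g * exp (I * (T s : ℂ)) * exp (I * (α s : ℂ) / 2)) *
        F.edge (Q (x s).1 (x s).2) * exp (I * (ψ s : ℂ) / 2)).re ∧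
      (g * exp (I * (T s : ℂ)) * exp (I * (α s : ℂ) / 2)) ^ 2 = L.diagDir (x s).1 (x s).2 := by
    intro s
    set h := g * exp (I * (T s : ℂ)) * exp (I * (α s : ℂ) / 2) with hh
    have e2 : h ^ 2 = L.diagDir (x s).1 (x s).2 := by
      rw [hx.diagDir_eq hδ s, hh, mul_pow, mul_pow, hg, ← exp_nat_mul, ← exp_nat_mul]
      rw [show ((2 : ℕ) : ℂ) * (I * (T s : ℂ)) = I * ((2 * T s : ℝ) : ℂ) by push_cast; ring,
        show ((2 : ℕ) : ℂ) * (I * (α s : ℂ) / 2) = I * (α s : ℂ) by push_cast; ring]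
    have hn : ‖h‖ = 1 := by
      rw [hh, norm_mul, norm_mul, hgn, norm_exp_I_mul, mul_div_assoc,
        show ((α s : ℂ) / 2) = ((α s / 2 : ℝ) : ℂ) by push_cast; rfl, norm_exp_I_mul]; norm_num
    have c := SHolAt.corner_values hδ (hF s) (hQ2 s) (ω := ω) (h := h)
      (by rw [hω, colour_congr (hpar s)]) hωn (by rw [e2, hQ1]) hn
    rw [hQ1, hx.vert_eq, atCorner_congr F (hpar s)] at c
    obtain ⟨c1, c2⟩ := c
    have g1 : h * exp (-(I * (L.cornerAngle (x s).1 (x s).2 : ℂ) / 2)) = g * exp (I * (T s : ℂ)) := by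
      rw [hh, mul_assoc _ (exp _) (exp _), ← exp_add]; simp [hα]
    have g2 : h * exp (I * (L.cornerAngle (x s).1 (x s).2 : ℂ) / 2) =
        g * exp (I * (T (s + 1) : ℂ)) := by
      rw [hh, mul_assoc _ (exp _) (exp _), ← exp_add, mul_assoc, ← exp_add]
      congr 2
      simp only [hT, hα, Finset.sum_range_succ]; push_cast; ring
    rw [g1] at c1
    rw [g2, ← hx.succ] at c2
    refine ⟨?_, ?_, e2⟩
    · simp only [hX]; rw [c1, ofReal_re]
    · simp only [hX]; rw [c2, ofReal_re]
  refine key n α ψ (fun s => normalComponent F (Q (x s).1 (x s).2) (x s).2) X κ hκ hαb hαp ?_ ?_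
    hx.sum_angle hψα ?_
  · intro s; simp only [hx.periodic]
  · intro s
    have hTn : T (s + n) = T s + Real.pi := by
      have h1 := sum_range_add_of_periodic hαp s
      have h2 : T (s + n) = T s + ∑ j ∈ Finset.range n, α (s + j) := by
        simp only [hT]; rw [Finset.sum_range_add]
      have h3 : ∑ j ∈ Finset.range n, α (s + j) = Real.pi := by
        rw [← hx.sum_angle, ← h1]
        exact Finset.sum_congr rfl fun j _ => by rw [add_comm]
      rw [h2, h3]
    simp only [hX, hx.periodic, hTn]
    rw [ofReal_add, mul_add, exp_add, show exp (I * (Real.pi : ℂ)) = -1 by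
      rw [mul_comm, exp_pi_mul_I], ← neg_re]
    congr 1; ring
  · intro s
    obtain ⟨m1, m2, m3⟩ := main s
    have hb := abs_le.1 (hψα s)
    have hs : Real.sin (ψ s) ≠ 0 := by
      refine (Real.sin_pos_of_pos_of_lt_pi ?_ ?_).ne' <;> linarith [(hαb s).1, (hαb s).2, Real.pi_pos]
    rw [m1, m2, ← sin_mul_eq_cornerForm hs]
    congr 1
    unfold normalComponent
    rw [mul_pow, mul_pow, hω, m3, hQ1, colour_congr (hpar s)]
    rw [show (colour l : ℂ) * I * L.diagDir (x s).1 (x s).2 * F.edge (Q (x s).1 (x s).2) ^ 2 =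
      (colour l : ℂ) * (I * (L.diagDir (x s).1 (x s).2 * F.edge (Q (x s).1 (x s).2) ^ 2)) by ring,
      re_ofReal_mul, I_mul_re]
    ring

theorem edgeWeight_bounds {η α : ℝ} (hη : 0 < η) (hα : α ∈ Icc η (Real.pi / 2 - η)) (Q : L.Piece) :
    Real.sin η ≤ edgeWeight Q α ∧ Real.sin α ≤ edgeWeight Q α ∧
      Real.sin η ≤ Real.sin α ∧ Real.sin η ≤ Real.cos α ∧ Real.tan α ≤ 1 / Real.sin η ∧
      0 < Real.sin η := by
  have hpi := Real.pi_pos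
  obtain ⟨h1, h2⟩ := hα
  have s0 : 0 < Real.sin η := Real.sin_pos_of_pos_of_lt_pi hη (by linarith)
  have s1 : Real.sin η ≤ Real.sin α :=
    Real.sin_le_sin_of_le_of_le_pi_div_two (by linarith) (by linarith) h1
  have s2 : Real.sin η ≤ Real.cos α := by
    rw [← Real.sin_pi_div_two_sub]
    exact Real.sin_le_sin_of_le_of_le_pi_div_two (by linarith) (by linarith) (by linarith)
  have c0 : 0 < Real.cos α := s0.trans_le s2
  have c1 := Real.cos_le_one α
  have sα := Real.sin_le_one α
  have h3 : Real.sin α ≤ edgeWeight Q α := by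
    unfold edgeWeight
    split_ifs
    · rw [Real.tan_eq_sin_div_cos, le_div_iff₀ c0]; nlinarith
    · rw [le_div_iff₀ (by linarith)]; nlinarith
  refine ⟨s1.trans h3, h3, s1, s2, ?_, s0⟩
  rw [Real.tan_eq_sin_div_cos]
  exact div_le_div₀ zero_le_one sα s0 s2

-- For both kinds of pieces the weight times the increment would be `2 δ sin α` times the normal
-- component if the virtual angle were the true one. Replacing the cosine of the one angle by that
-- of the other costs `O(τ)`, and the normal components are in turn bounded by the increments.
set_option maxHeartbeats 1000000 in
theorem IsFan.weighted_increments_ge {η : ℝ} (hη : 0 < η) : ∃ C τ₀ : ℝ, 0 < C ∧ 0 < τ₀ ∧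
    ∀ {δ : ℝ} {L : IsoradialLattice δ} (_ : L.AngleBound η) (_ : 0 < δ) {k τ : ℝ} (_ : 0 ≤ k)
      (_ : k < 1) (_ : nome k ≤ τ) (_ : τ ≤ τ₀) {Ω : L.DiscreteDomain} {F : L.LatticeFunction}
      {H : L.Piece → Fin 4 → ℝ} (_ : IsMassiveSHol k Ω F) (_ : IsSquareIntegral Ω F H) {c : ℝ}
      {v : ℂ} {x : ℕ → L.E × Fin 4} {n : ℕ} (_ : L.IsFan v x n)
      (Q : L.E → Fin 4 → L.Piece) (_ : ∀ s, Q (x s).1 (x s).2 ∈ Ω.pieces)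
      (_ : ∀ s, (Q (x s).1 (x s).2).1 = (x s).1)
      (_ : ∀ s, (Q (x s).1 (x s).2).2 = none ∨ ((Q (x s).1 (x s).2).2 = some (x s).2 ∧
        HasBoundaryValue k F H c (.edge (Q (x s).1 (x s).2)))),
      -(C * τ * ∑ s ∈ Finset.range n, |H (Q (x s).1 (x s).2) ((x s).2 + 2) -
          H (Q (x s).1 (x s).2) (x s).2|) ≤
        ∑ s ∈ Finset.range n, edgeWeight (Q (x s).1 (x s).2) (L.cornerAngle (x s).1 (x s).2) *
          (colour (x s).2 * (H (Q (x s).1 (x s).2) ((x s).2 + 2) -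
            H (Q (x s).1 (x s).2) (x s).2)) := by
  obtain ⟨C, κ₀, hC, hκ₀, hκη, key⟩ := IsFan.sum_sin_mul_normalComponent hη
  have he := Real.exp_pos 8
  by_cases hηpi : Real.pi / 2 < η
  · refine ⟨1, 1, one_pos, one_pos, ?_⟩
    intro δ L hL hδ k τ _ _ _ _ Ω F H _ _ c v x n hx
    have := hL.cornerAngle (x 0).1 (x 0).2
    linarith [this.1, this.2]
  push Not at hηpi
  have hpi := Real.pi_pos
  have sη : 0 < Real.sin η := Real.sin_pos_of_pos_of_lt_pi hη (by linarith)
  have sη2 : 0 < Real.sin (η / 2) := Real.sin_pos_of_pos_of_lt_pi (by linarith) (by linarith)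
  -- By `k² ≤ exp 8 * nome k`, the angles deviate by at most `κ = 2 exp 8 * τ`. The second bound on
  -- `τ` ensures `k² ≤ 1 / 2`, which the estimate of the abstract angle needs.
  refine ⟨(C + 1 / Real.sin η) * (2 * Real.exp 8) / Real.sin (η / 2),
    min (κ₀ / (2 * Real.exp 8)) (1 / (2 * Real.exp 8)), by positivity, by positivity, ?_⟩
  intro δ L hL hδ k τ hk0 hk1 hkτ hτ Ω F H hF hH c v x n hx Q hQ hQ1 hQ2
  have hk2 : k ^ 2 ≤ Real.exp 8 * τ := (sq_le_nome hk0 hk1).trans (by gcongr)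
  have hτ1 : 2 * Real.exp 8 * τ ≤ κ₀ := by
    have := hτ.trans (min_le_left _ _)
    rwa [le_div_iff₀ (by positivity), mul_comm] at this
  have hτ2 : 2 * Real.exp 8 * τ ≤ 1 := by
    have := hτ.trans (min_le_right _ _)
    rwa [le_div_iff₀ (by positivity), mul_comm] at this
  set κ := 2 * Real.exp 8 * τ with hκ
  have hκ0 : 0 ≤ κ := by nlinarith [sq_nonneg k]
  have hhat : ∀ z, |L.hatAngle k z - L.halfAngle z| ≤ κ := fun z => by
    have hz := hL z
    refine (abs_abstractAngle_sub_le (by linarith) (by linarith [hz.1]) (by linarith [hz.2])).trans ?_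
    linarith
  have hS : ∀ s, SHolAt k F (Q (x s).1 (x s).2) := fun s => by
    rcases hQ2 s with h | ⟨h, hb⟩
    · exact hF _ (hQ s) h
    · exact (hb _ h).1
  set α : ℕ → ℝ := fun s => L.cornerAngle (x s).1 (x s).2 with hα
  set B : ℕ → ℝ := fun s => normalComponent F (Q (x s).1 (x s).2) (x s).2 with hB
  set D : ℕ → ℝ := fun s => H (Q (x s).1 (x s).2) ((x s).2 + 2) - H (Q (x s).1 (x s).2) (x s).2 with hD
  have main := key hL hδ hx k κ hτ1 hhat F Q hQ1 (fun s => (hQ2 s).imp id And.left) hS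
  have term : ∀ s, 2 * δ * (Real.sin (α s) * B s) - 2 * δ * (1 / Real.sin η * κ * |B s|) ≤
      edgeWeight (Q (x s).1 (x s).2) (α s) * (colour (x s).2 * D s) ∧
      2 * δ * |B s| ≤ |D s| / Real.sin (η / 2) := by
    intro s
    have hαs := hL.cornerAngle (x s).1 (x s).2
    obtain ⟨w1, w2, w3, w4, w5, -⟩ := edgeWeight_bounds hη hαs (Q (x s).1 (x s).2)
    set ψ := L.virtualAngle k (x s).1 (x s).2 with hψ
    have hψα : |ψ - α s| ≤ κ := by
      rw [hψ, hα]; simp only [abs_virtualAngle_sub]; exact hhat _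
    have hcos : |Real.cos ψ - Real.cos (α s)| ≤ κ := (Real.abs_cos_sub_cos_le _ _).trans hψα
    have hψ1 : Real.sin (η / 2) ≤ Real.cos ψ := by
      rw [← Real.sin_pi_div_two_sub]
      have := abs_le.1 hψα
      refine Real.sin_le_sin_of_le_of_le_pi_div_two ?_ ?_ ?_ <;> simp only [hα] at this <;>
        linarith [hαs.1, hαs.2]
    have hψp := sη2.trans_le hψ1
    have hδ2 : 0 < 2 * δ := by positivity
    have hσ : |colour (x s).2 * D s| = |D s| := by
      rw [abs_mul]; unfold colour; split_ifs <;> simp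
    have hcα : 0 < Real.cos (α s) := sη.trans_le w4
    have hsα : 0 < Real.sin (α s) := sη.trans_le w3
    have hs1 := Real.sin_le_one (α s)
    have bound : ∀ t : ℝ, |t| ≤ 1 / Real.sin η →
        -(1 / Real.sin η * κ * |B s|) ≤ t * (Real.cos ψ - Real.cos (α s)) * B s := by
      intro t ht
      refine (abs_le.1 ?_).1
      rw [abs_mul, abs_mul]
      gcongr
    rcases hQ2 s with h | ⟨h, hb⟩
    · have hd : colour (x s).2 * D s = 2 * δ * Real.cos ψ * B s := by
        have := mul_increment hδ hH (hQ s) h (hS s) (x s).2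
        rw [hQ1] at this
        simp only [hD, hB, normalComponent, hQ1]
        exact this
      constructor
      · rw [hd, edgeWeight, if_pos h]
        have ht : |Real.tan (α s)| ≤ 1 / Real.sin η := by
          rw [abs_of_pos (by rw [Real.tan_eq_sin_div_cos]; positivity)]; exact w5
        have := bound _ ht
        have e : Real.sin (α s) = Real.tan (α s) * Real.cos (α s) := by
          rw [Real.tan_mul_cos hcα.ne']
        rw [e]
        have := mul_le_mul_of_nonneg_left this hδ2.le
        linarith
      · rw [le_div_iff₀ sη2, ← hσ, hd, abs_mul, abs_of_pos (by positivity : 0 < 2 * δ * Real.cos ψ)]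
        have := mul_le_mul_of_nonneg_left hψ1 (by positivity : 0 ≤ 2 * δ * |B s|)
        linarith
    · have hd : colour (x s).2 * D s = δ * (1 + Real.cos ψ) * B s := by
        have := mul_increment_boundary hL hη h hb
        rw [hQ1] at this
        simp only [hD, hB, normalComponent, hQ1]
        exact this
      constructor
      · rw [hd, edgeWeight, if_neg (by rw [h]; simp)]
        set t := Real.sin (α s) / (1 + Real.cos (α s)) with ht'
        have hcp : 0 < 1 + Real.cos (α s) := by linarith
        have ht : |t| ≤ 1 / Real.sin η := by
          rw [abs_of_pos (by positivity), ht']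
          refine (div_le_div₀ zero_le_one hs1 sη (by linarith))
        have := bound _ ht
        have e : Real.sin (α s) = t * (1 + Real.cos (α s)) := by
          rw [ht', div_mul_cancel₀ _ hcp.ne']
        have e2 : 2 * Real.sin (α s) / (1 + Real.cos (α s)) = 2 * t := by
          rw [mul_div_assoc]
        rw [e2]
        have := mul_le_mul_of_nonneg_left this hδ2.le
        have e3 : 2 * δ * (Real.sin (α s) * B s) = 2 * δ * (t * (1 + Real.cos (α s)) * B s) := by
          rw [← e]
        linarith
      · rw [le_div_iff₀ sη2, ← hσ, hd, abs_mul, abs_of_pos (by positivity : 0 < δ * (1 + Real.cos ψ))]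
        have h2 : 2 * Real.sin (η / 2) ≤ 1 + Real.cos ψ := by linarith [Real.cos_le_one ψ]
        have := mul_le_mul_of_nonneg_left h2 (by positivity : 0 ≤ δ * |B s|)
        linarith
  have hsum1 := Finset.sum_le_sum fun s (_ : s ∈ Finset.range n) => (term s).1
  have hsum2 := Finset.sum_le_sum fun s (_ : s ∈ Finset.range n) => (term s).2
  rw [Finset.sum_sub_distrib, ← Finset.mul_sum, ← Finset.mul_sum, ← Finset.mul_sum] at hsum1
  rw [← Finset.mul_sum, ← Finset.sum_div] at hsum2
  refine le_trans ?_ hsum1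
  set A := ∑ s ∈ Finset.range n, |B s| with hA
  set A' := ∑ s ∈ Finset.range n, |D s| with hA'
  have m2 := mul_le_mul_of_nonneg_left main (by positivity : 0 ≤ 2 * δ)
  have m3 : (C + 1 / Real.sin η) * κ * (2 * δ * A) ≤ (C + 1 / Real.sin η) * κ * (A' / Real.sin (η / 2)) := by
    gcongr
  have e : (C + 1 / Real.sin η) * (2 * Real.exp 8) / Real.sin (η / 2) * τ * A' =
      (C + 1 / Real.sin η) * κ * (A' / Real.sin (η / 2)) := by rw [hκ]; ring
  change -((C + 1 / Real.sin η) * (2 * Real.exp 8) / Real.sin (η / 2) * τ * A') ≤ _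
  rw [e]
  linarith

end IsoradialLattice

namespace IsoradialLattice

variable {δ : ℝ} {L : IsoradialLattice δ} {Ω : L.DiscreteDomain} {F : L.LatticeFunction}
  {H : L.Piece → Fin 4 → ℝ}

/-! ### Boundary and interior vertices -/

/-- A vertex of the domain, with a way of access, is an end of a boundary element on this way, or it
is an interior vertex. -/
theorem IsSquareIntegral.vertex_cases {η : ℝ} (hL : L.AngleBound η) (hη : 0 < η) (hδ : 0 < δ)
    (hH : IsSquareIntegral Ω F H) {P : L.Piece} (hP : P ∈ Ω.pieces) {i : Fin 4}
    (hi : i ∈ P.verts) :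
    (∃ b ∈ Ω.boundary, L.vert P.1 i ∈ b.seg ∧
      ∀ k F c, HasBoundaryValue k F H c b → H P i = c) ∨
    ∀ z' i', L.vert z' i' = L.vert P.1 i →
      ∃ Q ∈ Ω.pieces, Q.1 = z' ∧ (Q.2 = none ∨ Q.2 = some i') ∧ H Q i' = H P i := by
  by_contra hcon
  push Not at hcon
  obtain ⟨hno, z', i', hzi, hcon⟩ := hcon
  obtain ⟨x, n, hx0, hx⟩ := hL.exists_fan hη hδ P.1 i
  -- A half-rhombus that reaches the vertex elsewhere than at `z_int` has it as an end of its
  -- boundary edge, which is excluded.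
  have full : ∀ Q ∈ Ω.pieces, ∀ l, l ∈ Q.verts → L.vert Q.1 l = L.vert P.1 i → H Q l = H P i →
      Q.2 = none ∨ Q.2 = some l := by
    intro Q hQ l hl hv hHl
    rcases hQ2 : Q.2 with _ | j
    · exact Or.inl rfl
    right
    have hl : Q.2 ≠ some (l + 2) := hl
    rw [hQ2] at hl
    have hjl : l = j ∨ l = j - 1 ∨ l = j + 1 := by
      have hl : j ≠ l + 2 := fun h => hl (by rw [h])
      clear * - hl; revert l j; decide
    rcases hjl with rfl | hjl
    · rfl
    · exfalso
      have hseg : L.vert Q.1 l ∈ segment ℝ (L.vert Q.1 (j - 1)) (L.vert Q.1 (j + 1)) := by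
        rcases hjl with rfl | rfl
        · exact left_mem_segment _ _ _
        · exact right_mem_segment _ _ _
      obtain ⟨k, F', c, hb, hc⟩ := hno (.edge Q) ⟨hQ, by rw [hQ2]; simp⟩
        ⟨j, hQ2, by rw [← hv]; exact hseg⟩
      obtain ⟨-, h1, h2, -⟩ := hb j hQ2
      rw [← hHl] at hc
      rcases hjl with rfl | rfl
      · exact hc h1
      · exact hc h2
  -- Induction around the fan: the second side of the current piece is not a boundary corner, so it
  -- is pasted to a piece of the next rhombus, and `H` keeps its value across it.
  have all : ∀ s, ∃ Q ∈ Ω.pieces, Q.1 = (x s).1 ∧ (Q.2 = none ∨ Q.2 = some (x s).2) ∧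
      H Q (x s).2 = H P i := by
    intro s
    induction s with
    | zero =>
      rw [hx0]
      exact ⟨P, hP, rfl, full P hP i hi rfl rfl, rfl⟩
    | succ s ih =>
      obtain ⟨Q, hQ, hQ1, hQ2, hQH⟩ := ih
      set l := (x s).2 with hl
      have hv : L.vert Q.1 l = L.vert P.1 i := by rw [hQ1]; exact hx.vert_eq s
      have e4 : l + 3 + 1 = l := (by decide : ∀ l : Fin 4, l + 3 + 1 = l) l
      have hside := (hasSide_first hQ2).2
      by_cases hb : (.corner Q (l + 3) : L.BoundaryElement) ∈ Ω.boundary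
      · obtain ⟨k, F', c, hb, hc⟩ := hno _ hb (by
          change _ ∈ segment ℝ _ _
          rw [e4, hv]; exact right_mem_segment _ _ _)
        have := hb.2
        rw [e4, hQH] at this
        exact absurd this hc
      · have hb' : ¬ (Q ∈ Ω.pieces ∧ Q.HasSide (l + 3) ∧
          ∀ P' ∈ Ω.pieces, ∀ i', P'.HasSide i' → ¬ Q.Opposite (l + 3) P' i') := hb
        push Not at hb'
        obtain ⟨P', hP', i', hs', hopp⟩ := hb' hQ hside
        obtain ⟨g1, g2⟩ := hH.glue Q hQ P' hP' (l + 3) i' hside hs' hopp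
        obtain ⟨o1, o2⟩ := hopp
        rw [e4] at o2 g2
        obtain ⟨r1, r2⟩ := hL.eq_of_first_side hη (z := (x (s + 1)).1) (i := (x (s + 1)).2)
          (z' := P'.1) (i' := i') (by rw [hx.vert_eq, ← o2, hv]) (by
            rw [hx.succ, ← o1, hQ1])
        have hH' : H P' (x (s + 1)).2 = H P i := by rw [← r2, ← g2, hQH]
        refine ⟨P', hP', r1, ?_, hH'⟩
        rw [← r2]
        exact full P' hP' i' hs'.1 (by rw [← o2, hv]) (by rw [← g2, hQH])
  obtain ⟨s, hs⟩ := hx.exists_eq z' i' hzi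
  obtain ⟨Q, hQ, h1, h2, h3⟩ := all s
  rw [hs] at h1 h2 h3
  exact hcon Q hQ h1 h2 h3

theorem DiscreteDomain.IsInterior.mem_region {η : ℝ} (hL : L.AngleBound η) (hη : 0 < η)
    (hδ : 0 < δ) {v : ℂ} (hv : Ω.IsInterior v) : v ∈ Ω.region := by
  obtain ⟨z₀, i₀, -⟩ := hv.exists_vert
  have := (hL.sin_two_mul hη z₀ i₀).1
  exact hv.ball_subset_region hL hη hδ (Metric.mem_ball_self (by positivity))

theorem carrier_disjoint_region {η : ℝ} (hL : L.AngleBound η) (hη : 0 < η) (hδ : 0 < δ)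
    {S : Set L.BoundaryElement} (hS : S ⊆ Ω.boundary) : Disjoint (carrier S) Ω.region := by
  rw [Set.disjoint_left]
  intro x hx
  obtain ⟨b, hb, hx⟩ := mem_iUnion₂.1 hx
  exact DiscreteDomain.seg_disjoint_region hL hη hδ (hS hb) hx

/-- A vertex off the boundary part without prescribed value is interior, or has the boundary value. -/
theorem IsSquareIntegral.interior_or_eq {η : ℝ} (hL : L.AngleBound η) (hη : 0 < η) (hδ : 0 < δ)
    (hH : IsSquareIntegral Ω F H) {k c : ℝ} {S : Set L.BoundaryElement}
    (hS : ∀ s ∈ S, HasBoundaryValue k F H c s) {P : L.Piece}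
    (hP : P ∈ Ω.pieces) {i : Fin 4} (hi : i ∈ P.verts)
    (hv : L.vert P.1 i ∉ carrier (Ω.boundary \ S)) :
    H P i = c ∨ Ω.IsInterior (L.vert P.1 i) := by
  rcases hH.vertex_cases hL hη hδ hP hi with ⟨b, hb, hbs, hval⟩ | hvint
  · left
    by_cases hbS : b ∈ S
    · exact hval _ _ _ (hS b hbS)
    · exact absurd (mem_iUnion₂.2 ⟨b, ⟨hb, hbS⟩, hbs⟩) hv
  · right
    refine ⟨⟨_, _, rfl⟩, fun z' i' h => ?_⟩
    obtain ⟨Q, hQ, h1, h2, -⟩ := hvint z' i' h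
    exact ⟨Q, hQ, h1, h2⟩

/-- At an interior vertex, `H` does not depend on the way of access. -/
theorem IsSquareIntegral.eq_of_isInterior {η : ℝ} (hL : L.AngleBound η) (hη : 0 < η) (hδ : 0 < δ)
    (hH : IsSquareIntegral Ω F H) {P P' : L.Piece} (hP : P ∈ Ω.pieces) (hP' : P' ∈ Ω.pieces)
    {i i' : Fin 4} (hi : i ∈ P.verts) (hi' : i' ∈ P'.verts)
    (hv : L.vert P'.1 i' = L.vert P.1 i) (hvint : Ω.IsInterior (L.vert P.1 i)) :
    H P' i' = H P i := by
  rcases hH.vertex_cases hL hη hδ hP hi with ⟨b, hb, hbs, -⟩ | hall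
  · exact absurd (hvint.mem_region hL hη hδ) (DiscreteDomain.seg_disjoint_region hL hη hδ hb hbs)
  · obtain ⟨Q, hQ, h1, h2, h3⟩ := hall P'.1 i' hv
    have := DiscreteDomain.piece_unique hQ hP' h1.symm h2 hi'
    rw [this, h3]

end IsoradialLattice

namespace IsoradialLattice

variable {δ : ℝ} {L : IsoradialLattice δ}

/-! ### The comparison principle -/

/-- The hypotheses on a square integral `H` with boundary value `c` on a part `S` of the boundary,
with nome at most `τ`. -/
structure BoundaryProblem (L : IsoradialLattice δ) (η τ k c : ℝ) (Ω : L.DiscreteDomain)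
    (F : L.LatticeFunction) (H : L.Piece → Fin 4 → ℝ) (S : Set L.BoundaryElement) : Prop where
  angleBound : L.AngleBound η
  eta_pos : 0 < η
  mesh_pos : 0 < δ
  modulus_nonneg : 0 ≤ k
  modulus_lt_one : k < 1
  nome_le : nome k ≤ τ
  sHol : IsMassiveSHol k Ω F
  squareIntegral : IsSquareIntegral Ω F H
  subset_boundary : S ⊆ Ω.boundary
  boundaryValue : ∀ s ∈ S, HasBoundaryValue k F H c s

theorem norm_opp_sub_le (hδ : 0 < δ) (z : L.E) (i : Fin 4) :
    ‖L.vert z (i + 2) - L.vert z i‖ ≤ 2 * δ := by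
  rw [L.vert_opp_sub, norm_mul, (L.side_eq z i).1, mul_one, norm_real, Real.norm_eq_abs, abs_mul,
    abs_of_pos (by positivity : 0 < 2 * δ)]
  have := Real.abs_cos_le_one (L.cornerAngle z i)
  nlinarith

theorem norm_side_sub (z : L.E) (i : Fin 4) : ‖L.vert z (i + 1) - L.vert z i‖ = δ ∧
    ‖L.vert z (i + 3) - L.vert z i‖ = δ :=
  ⟨L.norm_side₁ z i, L.norm_side₂ z i⟩

namespace BoundaryProblem

theorem edge_mem {η τ k c : ℝ} {Ω : L.DiscreteDomain} {F : L.LatticeFunction}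
    {H : L.Piece → Fin 4 → ℝ} {S : Set L.BoundaryElement} (h : L.BoundaryProblem η τ k c Ω F H S)
    {Q : L.Piece} (hQ : Q ∈ Ω.pieces) {j : Fin 4} (hj : Q.2 = some j)
    (hfar : ∀ y ∈ carrier (Ω.boundary \ S), 2 * δ < dist y (L.vert Q.1 j)) :
    HasBoundaryValue k F H c (.edge Q) := by
  have hb : (.edge Q : L.BoundaryElement) ∈ Ω.boundary := ⟨hQ, by rw [hj]; simp⟩
  by_contra hcon
  have hn : (.edge Q : L.BoundaryElement) ∉ S := fun hs => hcon (h.boundaryValue _ hs)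
  have := hfar (L.vert Q.1 (j + 1)) (mem_iUnion₂.2 ⟨_, ⟨hb, hn⟩, ⟨j, hj, right_mem_segment _ _ _⟩⟩)
  rw [dist_eq_norm, (norm_side_sub Q.1 j).1] at this
  linarith [h.mesh_pos]

/-- At an interior vertex, `M - (H - c)` (for the appropriate sign of `H - c`) minus a strictly
subharmonic function has no local minimum. -/
theorem no_local_min {η : ℝ} (hη : 0 < η) : ∃ C τ₀ ℓ₀ : ℝ, 0 < C ∧ 0 < τ₀ ∧ 0 < ℓ₀ ∧
    ∀ {δ : ℝ} {L : IsoradialLattice δ} {τ k c : ℝ} {Ω : L.DiscreteDomain} {F : L.LatticeFunction}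
      {H : L.Piece → Fin 4 → ℝ} {S : Set L.BoundaryElement}
      (_ : L.BoundaryProblem η τ k c Ω F H S) (_ : τ ≤ τ₀) {P : L.Piece} (_ : P ∈ Ω.pieces)
      {i : Fin 4} (_ : i ∈ P.verts) (_ : Ω.IsInterior (L.vert P.1 i))
      (_ : ∀ y ∈ carrier (Ω.boundary \ S), 2 * δ < dist y (L.vert P.1 i))
      {M t ℓ : ℝ} {a b : ℂ} {ψ : ℂ → ℝ} (_ : M / 2 ≤ colour i * (H P i - c))
      (_ : ∀ h : ℂ, ‖h‖ ≤ 2 * δ → (a * h).re + (b * h ^ 2).re + t * ‖h‖ ^ 2 ≤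
        ψ (L.vert P.1 i + h) - ψ (L.vert P.1 i))
      (_ : ∀ h : ℂ, ‖h‖ ≤ 2 * δ → |ψ (L.vert P.1 i + h) - ψ (L.vert P.1 i)| ≤ ℓ * ‖h‖)
      (_ : ∀ Q ∈ Ω.pieces, ∀ j, Q.2 = none → L.vert Q.1 j = L.vert P.1 i →
        ψ (L.vert Q.1 (j + 2)) - ψ (L.vert P.1 i) ≤ colour i * (H P i - H Q (j + 2)))
      (_ : 0 ≤ M) (_ : 0 ≤ ℓ) (_ : ℓ * δ ≤ ℓ₀ * M)
      (_ : C * τ * ℓ < t * δ), False := by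
  by_cases hηpi : Real.pi / 2 < η
  · refine ⟨1, 1, 1, one_pos, one_pos, one_pos, ?_⟩
    intro δ L τ k c Ω F H S h _ P _ i
    have := h.angleBound P.1
    linarith [this.1, this.2]
  push Not at hηpi
  have sη : 0 < Real.sin η := Real.sin_pos_of_pos_of_lt_pi hη (by linarith [Real.pi_pos])
  obtain ⟨C, τ₀, hC, hτ₀, key⟩ := IsFan.weighted_increments_ge hη
  refine ⟨C / (2 * Real.sin η), min τ₀ (Real.sin η / (2 * C)), Real.sin η ^ 2 / 16, by positivity,
    by positivity, by positivity, ?_⟩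
  intro δ L τ k c Ω F H S h hτ P hP i hi hvint hfar M t ℓ a b ψ hM hψ hψ' hmin hM0 hℓ0 hℓ hlt
  have hδ := h.mesh_pos
  have hL := h.angleBound
  set v := L.vert P.1 i with hv
  obtain ⟨x, n, hx0, hx⟩ := hL.exists_fan hη hδ P.1 i
  rw [← hv] at hx
  choose! Q hQ using hvint.piece
  have hQs := fun s => hQ _ _ (hx.vert_eq s)
  have hpar : ∀ s, colour (x s).2 = colour i := fun s =>
    colour_congr (L.parity_eq ((hx.vert_eq s).trans hv))
  have hverts : ∀ s, (x s).2 ∈ (Q (x s).1 (x s).2).verts := fun s => by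
    have := (hasSide_first (hQs s).2.2).1.1
    exact this
  have hval : ∀ s, H (Q (x s).1 (x s).2) (x s).2 = H P i := fun s =>
    h.squareIntegral.eq_of_isInterior hL hη hδ hP (hQs s).1 hi (hverts s)
      (by rw [(hQs s).2.1, hx.vert_eq, hv]) hvint
  have hQ2 : ∀ s, (Q (x s).1 (x s).2).2 = none ∨ ((Q (x s).1 (x s).2).2 = some (x s).2 ∧
        HasBoundaryValue k F H c (.edge (Q (x s).1 (x s).2))) := fun s => by
    rcases (hQs s).2.2 with h' | h'
    · exact Or.inl h'
    · refine Or.inr ⟨h', h.edge_mem (hQs s).1 h' ?_⟩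
      rw [(hQs s).2.1, hx.vert_eq]; exact hfar
  have hτ1 := hτ.trans (min_le_left _ _)
  have hτ2 : C * τ ≤ Real.sin η / 2 := by
    have := hτ.trans (min_le_right _ _)
    rw [le_div_iff₀ (by positivity)] at this
    linarith
  have hτ0 : 0 ≤ τ := by
    have := sq_le_nome h.modulus_nonneg h.modulus_lt_one
    have h2 : 0 ≤ Real.exp 8 * nome k := (sq_nonneg k).trans this
    have := nonneg_of_mul_nonneg_right h2 (Real.exp_pos 8)
    linarith [h.nome_le]
  have main := key hL hδ h.modulus_nonneg h.modulus_lt_one h.nome_le hτ1 h.sHol h.squareIntegral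
    hx Q (fun s => (hQs s).1) (fun s => (hQs s).2.1) hQ2
  set α : ℕ → ℝ := fun s => L.cornerAngle (x s).1 (x s).2 with hα
  set u : ℕ → ℂ := fun s => L.vert (x s).1 ((x s).2 + 2) - v with hu
  set D : ℕ → ℝ := fun s => colour i * (H P i - H (Q (x s).1 (x s).2) ((x s).2 + 2)) with hD
  have hun : ∀ s, ‖u s‖ ≤ 2 * δ := fun s => by
    have := norm_opp_sub_le hδ (x s).1 (x s).2
    rwa [hx.vert_eq] at this
  have hvu : ∀ s, v + u s = L.vert (x s).1 ((x s).2 + 2) := fun s => by simp [hu]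
  have cα : 0 ≤ C * τ := by positivity
  have hσ2 : |colour i| = 1 := by unfold colour; split_ifs <;> simp
  -- `D s` is the increment of `w = M - σ (H - c)`, so this is its approximate superharmonicity.
  have main' : ∑ s ∈ Finset.range n,
      (edgeWeight (Q (x s).1 (x s).2) (α s) * D s - C * τ * |D s|) ≤ 0 := by
    rw [Finset.sum_sub_distrib, ← Finset.mul_sum]
    have e1 : ∀ s, |H (Q (x s).1 (x s).2) ((x s).2 + 2) - H (Q (x s).1 (x s).2) (x s).2| = |D s| := by
      intro s
      rw [hval, hD]; simp only; rw [abs_mul, hσ2, one_mul, abs_sub_comm]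
    have e2 : ∀ s, edgeWeight (Q (x s).1 (x s).2) (L.cornerAngle (x s).1 (x s).2) *
          (colour (x s).2 * (H (Q (x s).1 (x s).2) ((x s).2 + 2) -
            H (Q (x s).1 (x s).2) (x s).2)) = -(edgeWeight (Q (x s).1 (x s).2) (α s) * D s) := by
      intro s
      rw [hval, hpar]; simp only [hD, hα]; ring
    simp only [e1, e2, Finset.sum_neg_distrib] at main
    linarith
  -- At an interior rhombus `D s` is at least the increment of `ψ`, and `y ↦ weight * y - C τ |y|`
  -- is increasing because `C τ` is below the weight. At a boundary half-rhombus `w` rises to `M`,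
  -- hence by at least `M / 2`, which exceeds what the Lipschitz bound allows for `ψ`, since `ℓ δ ≤
  -- ℓ₀ M`.
  have term : ∀ s, Real.tan (α s) * ((a * u s).re + (b * u s ^ 2).re + t * ‖u s‖ ^ 2) -
      C * τ * (ℓ * ‖u s‖) ≤ edgeWeight (Q (x s).1 (x s).2) (α s) * D s - C * τ * |D s| := by
    intro s
    obtain ⟨w1, w2, w3, w4, w5, -⟩ := edgeWeight_bounds hη (hL.cornerAngle (x s).1 (x s).2)
      (Q (x s).1 (x s).2)
    have htan : Real.sin η ≤ Real.tan (α s) := by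
      rw [Real.tan_eq_sin_div_cos, le_div_iff₀ (sη.trans_le w4)]
      have := Real.cos_le_one (α s)
      nlinarith
    have p1 := hψ (u s) (hun s)
    have p2 := hψ' (u s) (hun s)
    set G := ψ (v + u s) - ψ v with hG
    have q1 : Real.tan (α s) * ((a * u s).re + (b * u s ^ 2).re + t * ‖u s‖ ^ 2) ≤
        Real.tan (α s) * G := mul_le_mul_of_nonneg_left p1 (sη.le.trans htan)
    have q2 : C * τ * |G| ≤ C * τ * (ℓ * ‖u s‖) := mul_le_mul_of_nonneg_left p2 cα
    rcases hQ2 s with h' | ⟨h', hb⟩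
    · have hw : edgeWeight (Q (x s).1 (x s).2) (α s) = Real.tan (α s) := if_pos h'
      have hGD : G ≤ D s := by
        have := hmin _ (hQs s).1 (x s).2 h' (by rw [(hQs s).2.1, hx.vert_eq])
        rw [(hQs s).2.1] at this
        rw [hG, hvu]
        exact this
      rw [hw]
      have q3 : C * τ * (|D s| - |G|) ≤ C * τ * (D s - G) := by
        refine mul_le_mul_of_nonneg_left ?_ cα
        have := abs_sub_abs_le_abs_sub (D s) G
        rwa [abs_of_nonneg (by linarith : 0 ≤ D s - G)] at this
      have q4 : C * τ * (D s - G) ≤ Real.tan (α s) * (D s - G) :=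
        mul_le_mul_of_nonneg_right (by linarith) (by linarith)
      linarith
    · have hDs : D s = colour i * (H P i - c) := by
        have := (hb _ h').2.2.2.1
        simp only [hD]; rw [this]
      have hD0 : M / 2 ≤ D s := by rw [hDs]; exact hM
      rw [abs_of_nonneg (by linarith : 0 ≤ D s)]
      have q3 : Real.sin η / 2 * (M / 2) ≤
          (edgeWeight (Q (x s).1 (x s).2) (α s) - C * τ) * D s := by
        refine mul_le_mul ?_ hD0 (by linarith) ?_ <;> linarith
      have q4 : Real.tan (α s) * G ≤ 1 / Real.sin η * (ℓ * (2 * δ)) := by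
        have hG2 : |G| ≤ ℓ * (2 * δ) := p2.trans (mul_le_mul_of_nonneg_left (hun s) hℓ0)
        have := le_abs_self G
        calc Real.tan (α s) * G ≤ Real.tan (α s) * |G| :=
              mul_le_mul_of_nonneg_left this (sη.le.trans htan)
          _ ≤ _ := mul_le_mul w5 hG2 (abs_nonneg _) (by positivity)
      have q5 : 1 / Real.sin η * (ℓ * (2 * δ)) ≤ Real.sin η / 2 * (M / 2) := by
        rw [one_div, inv_mul_le_iff₀ sη]
        nlinarith
      have q6 : 0 ≤ C * τ * |G| := by positivity
      linarith
  have hsum := (Finset.sum_le_sum fun s (_ : s ∈ Finset.range n) => term s).trans main'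
  obtain ⟨i1, i2⟩ := hx.sum_tan_mul hL hη
  have j1 : ∑ s ∈ Finset.range n, Real.tan (α s) * (a * u s).re = 0 := by
    have := congrArg (fun z => (a * z).re) i1
    simp only [mul_zero, zero_re, Finset.mul_sum, re_sum] at this
    rw [← this]
    refine Finset.sum_congr rfl fun s _ => ?_
    rw [← re_ofReal_mul]; congr 1; simp only [hu, hα]; ring
  have j2 : ∑ s ∈ Finset.range n, Real.tan (α s) * (b * u s ^ 2).re = 0 := by
    have := congrArg (fun z => (b * z).re) i2
    simp only [mul_zero, zero_re, Finset.mul_sum, re_sum] at this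
    rw [← this]
    refine Finset.sum_congr rfl fun s _ => ?_
    rw [← re_ofReal_mul]; congr 1; simp only [hu, hα]; ring
  -- As `tan α ‖u‖ = 2 δ sin α ≥ 2 δ sin η`, the strictly subharmonic term beats the mass error. The
  -- linear and quadratic terms drop out of the sum, which is then positive although bounded by `0`.
  have each : ∀ s, 0 < Real.tan (α s) * (t * ‖u s‖ ^ 2) - C * τ * (ℓ * ‖u s‖) := by
    intro s
    obtain ⟨w1, w2, w3, w4, w5, -⟩ := edgeWeight_bounds hη (hL.cornerAngle (x s).1 (x s).2)
      (Q (x s).1 (x s).2)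
    have hc := sη.trans_le w4
    have hus : ‖u s‖ = 2 * δ * Real.cos (α s) := by
      have e := L.vert_opp_sub (x s).1 (x s).2
      rw [hx.vert_eq] at e
      simp only [hu, e, hα]
      rw [norm_mul, (L.side_eq _ _).1, norm_real, mul_one, Real.norm_eq_abs, abs_of_nonneg]
      positivity
    have hc' : 0 < Real.cos (α s) := hc
    have hup : 0 < ‖u s‖ := by rw [hus]; positivity
    have e1 : Real.tan (α s) * ‖u s‖ = 2 * δ * Real.sin (α s) := by
      rw [hus, Real.tan_eq_sin_div_cos]; field_simp
    have hlt' : C * τ * ℓ < t * δ * (2 * Real.sin η) := by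
      rw [div_mul_eq_mul_div, div_mul_eq_mul_div, div_lt_iff₀ (by positivity)] at hlt
      exact hlt
    have ht : 0 ≤ t * δ := by
      have : 0 ≤ C / (2 * Real.sin η) * τ * ℓ := by positivity
      linarith
    have : C * τ * ℓ < t * (2 * δ * Real.sin (α s)) := by
      have := mul_le_mul_of_nonneg_left w3 ht
      simp only [hα]
      linarith
    have := mul_lt_mul_of_pos_right this hup
    rw [← e1] at this
    linarith
  have hn : 0 < n := by
    rcases Nat.eq_zero_or_pos n with rfl | h0
    · have := hx.sum_angle
      simp at this
      exact absurd this.symm Real.pi_pos.ne'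
    · exact h0
  have hpos : 0 < ∑ s ∈ Finset.range n, (Real.tan (α s) * (t * ‖u s‖ ^ 2) - C * τ * (ℓ * ‖u s‖)) :=
    Finset.sum_pos (fun s _ => each s) (Finset.nonempty_range_iff.2 hn.ne')
  have : ∑ s ∈ Finset.range n, (Real.tan (α s) * ((a * u s).re + (b * u s ^ 2).re + t * ‖u s‖ ^ 2) -
      C * τ * (ℓ * ‖u s‖)) =
      ∑ s ∈ Finset.range n, (Real.tan (α s) * (t * ‖u s‖ ^ 2) - C * τ * (ℓ * ‖u s‖)) := by
    rw [← add_zero (∑ s ∈ Finset.range n, (Real.tan (α s) * (t * ‖u s‖ ^ 2) - C * τ * (ℓ * ‖u s‖))),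
      ← j1, ← add_zero (_ + ∑ s ∈ Finset.range n, Real.tan (α s) * (a * u s).re), ← j2,
      ← Finset.sum_add_distrib, ← Finset.sum_add_distrib]
    refine Finset.sum_congr rfl fun s _ => ?_
    ring
  linarith

end BoundaryProblem

end IsoradialLattice

/-! ### Lattice paths on which a nearly superharmonic function stays below a barrier. -/

namespace IsoradialLattice

variable {δ : ℝ} {L : IsoradialLattice δ}

theorem DiscreteDomain.segment_subset_region {Ω : L.DiscreteDomain} {Q : L.Piece}
    (hQ : Q ∈ Ω.pieces) (hQ2 : Q.2 = none) {j : Fin 4} (h0 : L.vert Q.1 j ∈ Ω.region)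
    (h1 : L.vert Q.1 (j + 2) ∈ Ω.region) :
    segment ℝ (L.vert Q.1 j) (L.vert Q.1 (j + 2)) ⊆ Ω.region := by
  rintro _ ⟨a, b, ha, hb, hab, rfl⟩
  obtain ⟨a0, b0, -, -, a2, b2, -⟩ := L.coord_vert Q.1 j
  rcases ha.eq_or_lt with rfl | ha
  · rw [zero_add] at hab
    rw [hab]; simpa using h1
  rcases hb.eq_or_lt with rfl | hb
  · rw [add_zero] at hab
    rw [hab]; simpa using h0
  refine DiscreteDomain.openRhombus_subset_region hQ hQ2 ((L.mem_openRhombus j).2 ?_)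
  rw [L.cs_affine _ _ _ _ _ _ hab, L.ct_affine _ _ _ _ _ _ hab, a0, b0, a2, b2]
  refine ⟨?_, ?_, ?_, ?_⟩ <;> linarith

theorem colour_add_two (j : Fin 4) : colour (j + 2) = colour j := by
  unfold colour; fin_cases j <;> simp

/-- `(P, i)` is an interior vertex of the domain, of the colour `σ`. -/
structure DiscreteDomain.IsNode (Ω : L.DiscreteDomain) (σ : ℝ) (P : L.Piece) (i : Fin 4) :
    Prop where
  mem : P ∈ Ω.pieces
  mem_verts : i ∈ P.verts
  isInterior : Ω.IsInterior (L.vert P.1 i)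
  colour_eq : colour i = σ

namespace BoundaryProblem

/-- If `M - σ (H - c)` is below a strictly subharmonic function at a vertex of `U`, it is so along a
lattice path that leads out of `U`. -/
theorem exists_path_of_lt {η : ℝ} (hη : 0 < η) : ∃ C τ₀ ℓ₀ : ℝ, 0 < C ∧ 0 < τ₀ ∧ 0 < ℓ₀ ∧
    ∀ {δ : ℝ} {L : IsoradialLattice δ} {τ k c : ℝ} {Ω : L.DiscreteDomain} {F : L.LatticeFunction}
      {H : L.Piece → Fin 4 → ℝ} {S : Set L.BoundaryElement}
      (_ : L.BoundaryProblem η τ k c Ω F H S) (_ : τ ≤ τ₀) {x₀ : ℂ} {r M σ : ℝ} (_ : 0 ≤ M)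
      (_ : ∀ y ∈ carrier (Ω.boundary \ S), r + 2 * δ ≤ dist y x₀)
      (_ : ∀ P i, Ω.IsNode σ P i → dist (L.vert P.1 i) x₀ < r → σ * (H P i - c) ≤ M)
      {ψ : ℂ → ℝ} {U V : Set ℂ} {t ℓ : ℝ} (_ : Convex ℝ V) (_ : ∀ y ∈ U, dist y x₀ < r - 2 * δ)
      (_ : ∀ y, dist y x₀ < r → ψ y ≤ M / 2) (_ : ∀ y, dist y x₀ < r → 0 < ψ y → y ∈ V)
      (_ : ∀ y ∈ U, ∃ a b : ℂ, ∀ h : ℂ, ‖h‖ ≤ 2 * δ →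
        (a * h).re + (b * h ^ 2).re + t * ‖h‖ ^ 2 ≤ ψ (y + h) - ψ y ∧
        |ψ (y + h) - ψ y| ≤ ℓ * ‖h‖)
      (_ : 0 ≤ ℓ) (_ : ℓ * δ ≤ ℓ₀ * M) (_ : C * τ * ℓ < t * δ)
      {P : L.Piece} {i : Fin 4} (_ : Ω.IsNode σ P i) (_ : L.vert P.1 i ∈ U)
      (_ : M - σ * (H P i - c) < ψ (L.vert P.1 i)),
      ∃ P' i', Ω.IsNode σ P' i' ∧ L.vert P'.1 i' ∉ U ∧ dist (L.vert P'.1 i') x₀ < r ∧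
        M - σ * (H P' i' - c) < ψ (L.vert P'.1 i') ∧
        (∃ y ∈ U, dist (L.vert P'.1 i') y ≤ 2 * δ) ∧
        JoinedIn (Ω.region ∩ V) (L.vert P.1 i) (L.vert P'.1 i') := by
  obtain ⟨C, τ₀, ℓ₀, hC, hτ₀, hℓ₀, key⟩ := no_local_min hη
  refine ⟨C, τ₀, ℓ₀, hC, hτ₀, hℓ₀, ?_⟩
  intro δ L τ k c Ω F H S hp hτ x₀ r M σ hM0 hfar hM ψ U V t ℓ hV hU hψM hψV hψ hℓ0 hℓ hlt P i hPi
    hiU hPψ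
  have hδ := hp.mesh_pos
  have hL := hp.angleBound
  have hreg : ∀ {P i}, Ω.IsNode σ P i → L.vert P.1 i ∈ Ω.region := fun h =>
    h.isInterior.mem_region hL hη hδ
  have hinV : ∀ {P i}, Ω.IsNode σ P i → dist (L.vert P.1 i) x₀ < r →
      M - σ * (H P i - c) < ψ (L.vert P.1 i) → L.vert P.1 i ∈ V := fun h hd hlt =>
    hψV _ hd (by linarith [hM _ _ h hd])
  by_contra hcon
  push Not at hcon
  classical
  -- The vertices of `U` that can be reached within `w < ψ`, where `w = M - σ (H - c)`. A minimum of
  -- `w - ψ` over this finite set would be local: neighbours outside the set have `w ≥ ψ`, or lie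
  -- outside `U` and end the desired path.
  set K : Finset (L.Piece × Fin 4) := (Ω.pieces ×ˢ (Finset.univ : Finset (Fin 4))).filter fun p =>
    Ω.IsNode σ p.1 p.2 ∧ L.vert p.1.1 p.2 ∈ U ∧ M - σ * (H p.1 p.2 - c) < ψ (L.vert p.1.1 p.2) ∧
      JoinedIn (Ω.region ∩ V) (L.vert P.1 i) (L.vert p.1.1 p.2) with hK
  have hPK : (P, i) ∈ K := by
    rw [hK, Finset.mem_filter]
    refine ⟨Finset.mem_product.2 ⟨hPi.mem, Finset.mem_univ _⟩, hPi, hiU, hPψ, JoinedIn.refl ?_⟩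
    exact ⟨hreg hPi, hinV hPi (by linarith [hU _ hiU]) hPψ⟩
  obtain ⟨⟨P', i'⟩, hP'K, hmin⟩ := K.exists_min_image
    (fun p => M - σ * (H p.1 p.2 - c) - ψ (L.vert p.1.1 p.2)) ⟨_, hPK⟩
  rw [hK, Finset.mem_filter] at hP'K
  obtain ⟨-, hN, hi'U, hlt', hjoin⟩ := hP'K
  simp only at hN hi'U hlt' hjoin hmin
  have hd' := hU _ hi'U
  obtain ⟨a, b, hab⟩ := hψ _ hi'U
  have hσ := hN.colour_eq
  have hfar' : ∀ y ∈ carrier (Ω.boundary \ S), 2 * δ < dist y (L.vert P'.1 i') := fun y hy => by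
    have h1 := hfar y hy
    have h2 := dist_triangle y (L.vert P'.1 i') x₀
    linarith
  have hMi := hψM _ (by linarith : dist (L.vert P'.1 i') x₀ < r)
  refine key hp hτ hN.mem hN.mem_verts hN.isInterior hfar' (M := M) (t := t) (ℓ := ℓ) (a := a)
    (b := b) (ψ := ψ) (by rw [hσ]; linarith) (fun h hh => (hab h hh).1) (fun h hh => (hab h hh).2)
    ?_ hM0 hℓ0 hℓ hlt
  intro Q hQ j hQ2 hQv
  rw [hσ]
  have hdo : dist (L.vert Q.1 (j + 2)) (L.vert P'.1 i') ≤ 2 * δ := by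
    rw [← hQv, dist_eq_norm]; exact norm_opp_sub_le hδ _ _
  have hdo' : dist (L.vert Q.1 (j + 2)) x₀ < r := by
    linarith [dist_triangle (L.vert Q.1 (j + 2)) (L.vert P'.1 i') x₀]
  have hvo : j + 2 ∈ Q.verts := by change Q.2 ≠ _; rw [hQ2]; simp
  have hψo := hψM _ hdo'
  -- An opposite vertex that is not interior has `H = c` there, so `w = M`, which is above `ψ ≤ M /
  -- 2`.
  rcases hp.squareIntegral.interior_or_eq hL hη hδ hp.boundaryValue hQ hvo (fun hy => by
    have := hfar _ hy; linarith) with heq | hvint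
  · rw [heq]; linarith
  · have hNo : Ω.IsNode σ Q (j + 2) := ⟨hQ, hvo, hvint, by
      rw [colour_add_two, ← hσ]; exact colour_congr (L.parity_eq hQv)⟩
    by_cases hlo : M - σ * (H Q (j + 2) - c) < ψ (L.vert Q.1 (j + 2))
    · have hVo := hinV hNo hdo' hlo
      have hVp := hinV hN (by linarith) hlt'
      have hseg : JoinedIn (Ω.region ∩ V) (L.vert P'.1 i') (L.vert Q.1 (j + 2)) := by
        refine JoinedIn.of_segment_subset (subset_inter ?_ (hV.segment_subset hVp hVo))
        rw [← hQv]
        exact DiscreteDomain.segment_subset_region hQ hQ2 (by rw [hQv]; exact hreg hN) (hreg hNo)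
      have hj := hjoin.trans hseg
      by_cases hoU : L.vert Q.1 (j + 2) ∈ U
      · have := hmin (Q, j + 2) (by
          rw [hK, Finset.mem_filter]
          exact ⟨Finset.mem_product.2 ⟨hQ, Finset.mem_univ _⟩, hNo, hoU, hlo, hj⟩)
        simp only at this
        linarith
      · exact absurd hj (hcon Q (j + 2) hNo hoU hdo' hlo ⟨_, hi'U, hdo⟩)
    · linarith

end BoundaryProblem

end IsoradialLattice

/-! ### Barriers -/

theorem norm_add_sq_sub (Y h : ℂ) :
    ‖Y + h‖ ^ 2 - ‖Y‖ ^ 2 = 2 * ((starRingEnd ℂ) Y * h).re + ‖h‖ ^ 2 := by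
  rw [← normSq_eq_norm_sq, ← normSq_eq_norm_sq, ← normSq_eq_norm_sq, normSq_add,
    show (starRingEnd ℂ) Y * h = (starRingEnd ℂ) (Y * (starRingEnd ℂ) h) by simp, conj_re]
  ring

theorem abs_re_conj_mul_le (Y h : ℂ) : |((starRingEnd ℂ) Y * h).re| ≤ ‖Y‖ * ‖h‖ := by
  refine (abs_re_le_norm _).trans ?_
  rw [norm_mul, norm_conj]

/-- Splits the square of a linear function into an isotropic part and the real part of a complex
square. The latter is discrete harmonic, so that only the isotropic part counts for subharmonicity.
-/
theorem four_mul_re_sq (Y h : ℂ) : 4 * ((starRingEnd ℂ) Y * h).re ^ 2 =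
    2 * ‖Y‖ ^ 2 * ‖h‖ ^ 2 + 2 * ((starRingEnd ℂ) Y ^ 2 * h ^ 2).re := by
  rw [← mul_pow, sq ((starRingEnd ℂ) Y * h), mul_re ((starRingEnd ℂ) Y * h)]
  have : ‖Y‖ ^ 2 * ‖h‖ ^ 2 = ((starRingEnd ℂ) Y * h).re ^ 2 + ((starRingEnd ℂ) Y * h).im ^ 2 := by
    rw [← mul_pow, ← norm_conj Y, ← norm_mul, ← normSq_eq_norm_sq, normSq_apply]; ring
  linarith

theorem quadratic_barrier {ε r δ : ℝ} (hε : 0 < ε) (hr : 0 < r) (hδ : 2 * δ ≤ r) {x₀ y : ℂ}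
    (hy : ‖y - x₀‖ < r / 2) : ∃ a b : ℂ, ∀ h : ℂ, ‖h‖ ≤ 2 * δ →
      (a * h).re + (b * h ^ 2).re + ε / r ^ 2 * ‖h‖ ^ 2 ≤
        ε * (1 / 4 + ‖y + h - x₀‖ ^ 2 / r ^ 2) - ε * (1 / 4 + ‖y - x₀‖ ^ 2 / r ^ 2) ∧
      |ε * (1 / 4 + ‖y + h - x₀‖ ^ 2 / r ^ 2) - ε * (1 / 4 + ‖y - x₀‖ ^ 2 / r ^ 2)| ≤
        2 * ε / r * ‖h‖ := by
  refine ⟨((2 * ε / r ^ 2 : ℝ) : ℂ) * (starRingEnd ℂ) (y - x₀), 0, fun h hh => ?_⟩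
  have e1 : ε * (1 / 4 + ‖y + h - x₀‖ ^ 2 / r ^ 2) - ε * (1 / 4 + ‖y - x₀‖ ^ 2 / r ^ 2) =
      ε / r ^ 2 * (2 * ((starRingEnd ℂ) (y - x₀) * h).re + ‖h‖ ^ 2) := by
    rw [← norm_add_sq_sub, show y - x₀ + h = y + h - x₀ by ring]; ring
  rw [e1, mul_assoc (ofReal _), re_ofReal_mul]
  constructor
  · simp only [zero_mul, zero_re]
    apply le_of_eq; ring
  · rw [abs_mul, abs_of_pos (by positivity), show 2 * ε / r * ‖h‖ = ε / r ^ 2 * (2 * r * ‖h‖) by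
      field_simp]
    refine mul_le_mul_of_nonneg_left ?_ (by positivity)
    have := abs_le.1 (abs_re_conj_mul_le (y - x₀) h)
    have hn := norm_nonneg h
    have : ‖y - x₀‖ * ‖h‖ ≤ r / 2 * ‖h‖ := by gcongr
    have : ‖h‖ ^ 2 ≤ r * ‖h‖ := by rw [sq]; gcongr; linarith
    rw [abs_le]
    constructor <;> linarith [sq_nonneg ‖h‖]

/-- With `μ = 32 / ρ²`, the second-order term of the Gaussian has isotropic part `μ² ‖Y‖² - μ`, at
least `μ` as soon as `‖Y‖ ≥ ρ / 4`. Half of this is given away for the third-order terms, which are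
small because `δ / ρ` is tiny; `exp (-128)` bounds the Gaussian from below in the ball of radius `2
ρ`. -/
theorem exp_barrier {ε ρ δ : ℝ} (hε : 0 < ε) (hρ : 0 < ρ) (hδ : 0 < δ) (hδρ : δ * 2000000 ≤ ρ)
    {κ : ℝ} {q y : ℂ} (hy : ρ / 4 ≤ ‖y - q‖) (hy' : ‖y - q‖ < 2 * ρ) :
    ∃ a b : ℂ, ∀ h : ℂ, ‖h‖ ≤ 2 * δ →
      (a * h).re + (b * h ^ 2).re + ε * Real.exp (-128) * 16 / ρ ^ 2 * ‖h‖ ^ 2 ≤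
        ε * (Real.exp (-(32 * ‖y + h - q‖ ^ 2 / ρ ^ 2)) - κ) -
          ε * (Real.exp (-(32 * ‖y - q‖ ^ 2 / ρ ^ 2)) - κ) ∧
      |ε * (Real.exp (-(32 * ‖y + h - q‖ ^ 2 / ρ ^ 2)) - κ) -
          ε * (Real.exp (-(32 * ‖y - q‖ ^ 2 / ρ ^ 2)) - κ)| ≤ 320 * ε / ρ * ‖h‖ := by
  set Y := y - q with hY
  set μ := 32 / ρ ^ 2 with hμ
  have hμ0 : 0 < μ := by positivity
  set E := Real.exp (-(32 * ‖Y‖ ^ 2 / ρ ^ 2)) with hE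
  have hE0 : 0 < E := Real.exp_pos _
  have hE1 : E ≤ 1 := Real.exp_le_one_iff.2 (by simp only [neg_nonpos]; positivity)
  have hE2 : Real.exp (-128) ≤ E := by
    refine Real.exp_le_exp.2 (neg_le_neg ?_)
    rw [div_le_iff₀ (by positivity)]
    nlinarith [norm_nonneg Y]
  refine ⟨((-(ε * E * (2 * μ)) : ℝ) : ℂ) * (starRingEnd ℂ) Y,
    ((ε * E * μ ^ 2 : ℝ) : ℂ) * (starRingEnd ℂ) Y ^ 2, fun h hh => ?_⟩
  have hn := norm_nonneg h
  set R := ((starRingEnd ℂ) Y * h).re with hR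
  set x := -(μ * (2 * R + ‖h‖ ^ 2)) with hx
  have e1 : ε * (Real.exp (-(32 * ‖y + h - q‖ ^ 2 / ρ ^ 2)) - κ) - ε * (E - κ) =
      ε * E * (Real.exp x - 1) := by
    have : Real.exp (-(32 * ‖y + h - q‖ ^ 2 / ρ ^ 2)) = E * Real.exp x := by
      rw [hE, ← Real.exp_add]
      congr 1
      rw [hx, hR, ← norm_add_sq_sub, show Y + h = y + h - q by rw [hY]; ring, hμ]
      ring
    rw [this]; ring
  have hRb : |R| ≤ ‖Y‖ * ‖h‖ := abs_re_conj_mul_le Y h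
  have hRb2 : ‖Y‖ * ‖h‖ ≤ 2 * ρ * ‖h‖ := by gcongr
  have hh2 : ‖h‖ ^ 2 ≤ 2 * δ * ‖h‖ := by rw [sq]; gcongr
  have hδ2 : 2 * δ * ‖h‖ ≤ ρ * ‖h‖ := by gcongr; linarith
  have hxb : |x| ≤ 160 / ρ * ‖h‖ := by
    rw [hx, abs_neg, abs_mul, abs_of_pos hμ0, show 160 / ρ * ‖h‖ = μ * (5 * ρ * ‖h‖) by
      rw [hμ]; field_simp; ring]
    refine mul_le_mul_of_nonneg_left ?_ hμ0.le
    have := abs_le.1 hRb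
    rw [abs_le]
    constructor <;> linarith [sq_nonneg ‖h‖]
  have hx1 : |x| ≤ 1 := by
    refine hxb.trans ?_
    rw [div_mul_eq_mul_div, div_le_one hρ]
    linarith
  have hexp := Real.exp_bound hx1 (n := 3) (by norm_num)
  simp only [Finset.sum_range_succ, Finset.range_zero, Finset.sum_empty, Nat.factorial] at hexp
  norm_num at hexp
  have hlow : x + x ^ 2 / 2 - |x| ^ 3 ≤ Real.exp x - 1 := by
    have := (abs_le.1 hexp).1
    have h3 : 0 ≤ |x| ^ 3 := by positivity
    linarith
  rw [e1]
  constructor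
  · have hx3 : |x| ^ 3 ≤ μ / 4 * ‖h‖ ^ 2 := by
      calc |x| ^ 3 ≤ (160 / ρ * ‖h‖) ^ 3 := by gcongr
        _ = (160 / ρ) ^ 3 * ‖h‖ * ‖h‖ ^ 2 := by ring
        _ ≤ (160 / ρ) ^ 3 * (2 * δ) * ‖h‖ ^ 2 := by gcongr
        _ ≤ μ / 4 * ‖h‖ ^ 2 := by
          gcongr
          rw [hμ, div_pow, div_mul_eq_mul_div, div_div, div_le_div_iff₀ (by positivity) (by positivity)]
          have : 0 < ρ ^ 2 := by positivity
          nlinarith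
    have hcross : μ ^ 2 * (2 * |R| * ‖h‖ ^ 2) ≤ μ / 4 * ‖h‖ ^ 2 := by
      have h1 : 2 * |R| ≤ 8 * ρ * δ := by
        have : 2 * ρ * ‖h‖ ≤ 2 * ρ * (2 * δ) := by gcongr
        linarith
      have h2 : μ * (8 * ρ * δ) ≤ 1 / 4 := by
        rw [hμ, div_mul_eq_mul_div, div_le_div_iff₀ (by positivity) (by positivity)]
        nlinarith
      calc μ ^ 2 * (2 * |R| * ‖h‖ ^ 2) ≤ μ ^ 2 * (8 * ρ * δ * ‖h‖ ^ 2) := by gcongr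
        _ = μ * (μ * (8 * ρ * δ)) * ‖h‖ ^ 2 := by ring
        _ ≤ μ * (1 / 4) * ‖h‖ ^ 2 := by gcongr
        _ = _ := by ring
    have hY2 : 2 * μ ≤ μ ^ 2 * ‖Y‖ ^ 2 := by
      have : 2 ≤ μ * ‖Y‖ ^ 2 := by
        rw [hμ, div_mul_eq_mul_div, le_div_iff₀ (by positivity)]
        nlinarith
      calc 2 * μ = μ * 2 := by ring
        _ ≤ μ * (μ * ‖Y‖ ^ 2) := by gcongr
        _ = _ := by ring
    have hfour := four_mul_re_sq Y h
    rw [← hR] at hfour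
    have hRR : -(|R| * ‖h‖ ^ 2) ≤ R * ‖h‖ ^ 2 := by
      rw [← neg_mul]; exact mul_le_mul_of_nonneg_right (neg_abs_le R) (sq_nonneg _)
    have hYY : 2 * μ * ‖h‖ ^ 2 ≤ μ ^ 2 * ‖Y‖ ^ 2 * ‖h‖ ^ 2 :=
      mul_le_mul_of_nonneg_right hY2 (sq_nonneg _)
    have hquart : 0 ≤ μ ^ 2 * (‖h‖ ^ 2) ^ 2 := by positivity
    have hRR' := mul_le_mul_of_nonneg_left hRR (by positivity : 0 ≤ 2 * μ ^ 2)
    have hx2 : x ^ 2 / 2 = μ ^ 2 * (‖Y‖ ^ 2 * ‖h‖ ^ 2 + ((starRingEnd ℂ) Y ^ 2 * h ^ 2).re +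
        2 * (R * ‖h‖ ^ 2) + (‖h‖ ^ 2) ^ 2 / 2) := by
      rw [hx]; linear_combination μ ^ 2 / 2 * hfour
    have hfin : -(2 * μ) * R + μ ^ 2 * ((starRingEnd ℂ) Y ^ 2 * h ^ 2).re + μ / 2 * ‖h‖ ^ 2 ≤
        Real.exp x - 1 := by
      refine le_trans ?_ hlow
      rw [hx2]
      have : x = -(2 * μ) * R - μ * ‖h‖ ^ 2 := by rw [hx]; ring
      rw [this] at hx3 ⊢
      linarith
    have := mul_le_mul_of_nonneg_left hfin (by positivity : 0 ≤ ε * E)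
    rw [mul_assoc (ofReal _), re_ofReal_mul, mul_assoc (ofReal _), re_ofReal_mul]
    have hlast : ε * Real.exp (-128) * 16 / ρ ^ 2 * ‖h‖ ^ 2 ≤ ε * E * (μ / 2 * ‖h‖ ^ 2) := by
      have : ε * E * (μ / 2 * ‖h‖ ^ 2) = ε * E * 16 / ρ ^ 2 * ‖h‖ ^ 2 := by rw [hμ]; ring
      rw [this]
      gcongr
    linarith
  · rw [abs_mul, abs_of_pos (by positivity)]
    have h2 : |Real.exp x - 1| ≤ 2 * |x| := Real.abs_exp_sub_one_le hx1
    calc ε * E * |Real.exp x - 1| ≤ ε * 1 * (2 * (160 / ρ * ‖h‖)) := by gcongr; linarith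
      _ = _ := by ring

/-! ### Propagation of smallness by Gaussian and quadratic barriers. -/

namespace IsoradialLattice

variable {δ : ℝ} {L : IsoradialLattice δ}

/-- The ball of radius `r` around `x₀` is far from the part of the boundary without prescribed value,
and `σ (H - c) ≤ M` in it. -/
structure DiscreteDomain.BoundedNear (Ω : L.DiscreteDomain) (H : L.Piece → Fin 4 → ℝ) (c : ℝ)
    (S : Set L.BoundaryElement) (σ : ℝ) (x₀ : ℂ) (r M : ℝ) : Prop where
  pos : 0 < M
  far : ∀ y ∈ carrier (Ω.boundary \ S), r + 2 * δ ≤ dist y x₀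
  le : ∀ P i, Ω.IsNode σ P i → dist (L.vert P.1 i) x₀ < r → σ * (H P i - c) ≤ M

/-- The factor that is lost in one step of a chain. -/
def stepFactor : ℝ := Real.exp (-32) - Real.exp (-128)

theorem stepFactor_pos : 0 < stepFactor := sub_pos.2 (Real.exp_lt_exp.2 (by norm_num))

theorem stepFactor_le_one : stepFactor ≤ 1 := by
  have h1 : Real.exp (-32) ≤ 1 := Real.exp_le_one_iff.2 (by norm_num)
  have h2 := Real.exp_pos (-128)
  unfold stepFactor; linarith

namespace BoundaryProblem

/-- The Gaussian barrier about `q` is lowered so as to vanish at distance `2 ρ`; at distance at most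
`ρ` it is at least `stepFactor * ε`, and it never exceeds `ε`. A path below it cannot leave the
annulus through the outer circle, where the barrier is not positive, and therefore enters the small
inner disc. -/
theorem exists_path_to_ball {η : ℝ} (hη : 0 < η) : ∃ κ : ℝ, 0 < κ ∧
    ∀ {δ : ℝ} {L : IsoradialLattice δ} {τ k c : ℝ} {Ω : L.DiscreteDomain} {F : L.LatticeFunction}
      {H : L.Piece → Fin 4 → ℝ} {S : Set L.BoundaryElement}
      (_ : L.BoundaryProblem η τ k c Ω F H S) {x₀ : ℂ} {r M σ : ℝ}
      (_ : Ω.BoundedNear H c S σ x₀ r M) {ρ ε : ℝ} {q : ℂ} (_ : τ ≤ κ) (_ : δ ≤ κ * ρ)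
      (_ : τ * ρ ≤ κ * δ) (_ : 0 < ε) (_ : ε ≤ M / 2) (_ : dist q x₀ + 2 * ρ + 2 * δ ≤ r)
      {P : L.Piece} {i : Fin 4} (_ : Ω.IsNode σ P i) (_ : dist (L.vert P.1 i) q ≤ ρ)
      (_ : M - σ * (H P i - c) < stepFactor * ε),
      ∃ P' i', Ω.IsNode σ P' i' ∧ dist (L.vert P'.1 i') q < ρ / 4 ∧ M - σ * (H P' i' - c) < ε ∧
        JoinedIn (Ω.region ∩ Metric.ball q (2 * ρ)) (L.vert P.1 i) (L.vert P'.1 i') := by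
  obtain ⟨C, τ₀, ℓ₀, hC, hτ₀, hℓ₀, key⟩ := exists_path_of_lt hη
  have he := Real.exp_pos (-128)
  refine ⟨min (min τ₀ (ℓ₀ / 160)) (min (1 / 2000000) (Real.exp (-128) / (40 * C))), by positivity,
    ?_⟩
  intro δ L τ k c Ω F H S hp x₀ r M σ hM ρ ε q hτ hδρ hτρ hε hεM hq P i hN hd hw
  have hδ := hp.mesh_pos
  set κ := min (min τ₀ (ℓ₀ / 160)) (min (1 / 2000000) (Real.exp (-128) / (40 * C))) with hκ
  have k1 : κ ≤ τ₀ := (min_le_left _ _).trans (min_le_left _ _)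
  have k2 : κ ≤ ℓ₀ / 160 := (min_le_left _ _).trans (min_le_right _ _)
  have k3 : κ ≤ 1 / 2000000 := (min_le_right _ _).trans (min_le_left _ _)
  have k4 : κ ≤ Real.exp (-128) / (40 * C) := (min_le_right _ _).trans (min_le_right _ _)
  have hκ0 : 0 < κ := by positivity
  have hρ : 0 < ρ := by
    by_contra hcon
    push Not at hcon
    nlinarith
  have hwε : stepFactor * ε ≤ ε := by
    have := mul_le_mul_of_nonneg_right stepFactor_le_one hε.le
    linarith
  by_cases hnear : dist (L.vert P.1 i) q < ρ / 4
  · refine ⟨P, i, hN, hnear, by linarith, JoinedIn.refl ⟨?_, ?_⟩⟩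
    · exact hN.isInterior.mem_region hp.angleBound hη hδ
    · rw [Metric.mem_ball]; linarith
  push Not at hnear
  set ψ : ℂ → ℝ := fun y => ε * (Real.exp (-(32 * ‖y - q‖ ^ 2 / ρ ^ 2)) - Real.exp (-128)) with hψ
  have hψε : ∀ y, ψ y ≤ ε := fun y => by
    have h1 : Real.exp (-(32 * ‖y - q‖ ^ 2 / ρ ^ 2)) ≤ 1 :=
      Real.exp_le_one_iff.2 (by simp only [neg_nonpos]; positivity)
    have := mul_le_mul_of_nonneg_left (by linarith : Real.exp (-(32 * ‖y - q‖ ^ 2 / ρ ^ 2)) -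
      Real.exp (-128) ≤ 1) hε.le
    simpa [hψ] using this
  have hψpos : ∀ y, 0 < ψ y → y ∈ Metric.ball q (2 * ρ) := fun y hy => by
    have h1 := (pos_iff_pos_of_mul_pos hy).1 hε
    rw [sub_pos, Real.exp_lt_exp, neg_lt_neg_iff, div_lt_iff₀ (by positivity)] at h1
    rw [Metric.mem_ball, dist_eq_norm]
    by_contra hcon
    push Not at hcon
    nlinarith [norm_nonneg (y - q)]
  have hκρ : κ * ρ ≤ 1 / 2000000 * ρ := by gcongr
  obtain ⟨P', i', hN', hU', hr', hw', -, hj⟩ := key hp (hτ.trans k1) hM.pos.le hM.far hM.le (ψ := ψ)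
    (U := {y | ρ / 4 ≤ ‖y - q‖ ∧ ‖y - q‖ < 2 * ρ}) (V := Metric.ball q (2 * ρ))
    (t := ε * Real.exp (-128) * 16 / ρ ^ 2) (ℓ := 320 * ε / ρ) (convex_ball _ _)
    (by
      rintro y ⟨-, hy⟩
      have := dist_triangle y q x₀
      rw [dist_eq_norm y q] at this
      linarith)
    (fun y _ => (hψε y).trans hεM) (fun y _ => hψpos y)
    (fun y hy => exp_barrier hε hρ hδ (by linarith) hy.1 hy.2) (by positivity)
    (by
      rw [div_mul_eq_mul_div, div_le_iff₀ hρ]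
      calc 320 * ε * δ ≤ 320 * (M / 2) * (κ * ρ) := by gcongr; linarith [hM.pos]
        _ ≤ 320 * (M / 2) * (ℓ₀ / 160 * ρ) := by
          have := hM.pos
          gcongr
        _ = _ := by ring)
    (by
      have h1 : 20 * C * (τ * ρ) < Real.exp (-128) * δ := by
        calc 20 * C * (τ * ρ) ≤ 20 * C * (κ * δ) := by gcongr
          _ ≤ 20 * C * (Real.exp (-128) / (40 * C) * δ) := by gcongr
          _ = Real.exp (-128) * δ / 2 := by field_simp; norm_num
          _ < _ := half_lt_self (by positivity)
      have e1 : C * τ * (320 * ε / ρ) = (16 * ε / ρ ^ 2) * (20 * C * (τ * ρ)) := by field_simp; ring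
      have e2 : ε * Real.exp (-128) * 16 / ρ ^ 2 * δ = (16 * ε / ρ ^ 2) * (Real.exp (-128) * δ) := by
        ring
      rw [e1, e2]
      exact mul_lt_mul_of_pos_left h1 (by positivity))
    hN ⟨by rwa [dist_eq_norm] at hnear, by rw [dist_eq_norm] at hd; linarith⟩
    (by
      refine hw.trans_le ?_
      rw [mul_comm, hψ]
      refine mul_le_mul_of_nonneg_left ?_ hε.le
      unfold stepFactor
      refine sub_le_sub_right (Real.exp_le_exp.2 (neg_le_neg ?_)) _
      rw [dist_eq_norm] at hd
      rw [div_le_iff₀ (by positivity)]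
      have := pow_le_pow_left₀ (norm_nonneg _) hd 2
      linarith)
  refine ⟨P', i', hN', ?_, hw'.trans_le (hψε _), hj⟩
  have hpos : 0 < ψ (L.vert P'.1 i') := by linarith [hM.le _ _ hN' hr']
  have hb := hψpos _ hpos
  rw [Metric.mem_ball, dist_eq_norm] at hb
  rw [dist_eq_norm]
  by_contra hcon
  push Not at hcon
  exact hU' ⟨hcon, hb⟩

/-- The barrier `ε (1 / 4 + |y - x₀|² / r²)` is at least `ε / 4` everywhere and still below `ε` just
outside the ball of radius `r / 2`. Smallness inside thus reaches the circle. -/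
theorem exists_exit {η : ℝ} (hη : 0 < η) : ∃ κ : ℝ, 0 < κ ∧
    ∀ {δ : ℝ} {L : IsoradialLattice δ} {τ k c : ℝ} {Ω : L.DiscreteDomain} {F : L.LatticeFunction}
      {H : L.Piece → Fin 4 → ℝ} {S : Set L.BoundaryElement}
      (_ : L.BoundaryProblem η τ k c Ω F H S) {x₀ : ℂ} {r M σ : ℝ}
      (_ : Ω.BoundedNear H c S σ x₀ r M) {ε : ℝ} (_ : τ ≤ κ) (_ : δ ≤ κ * r)
      (_ : τ * r ≤ κ * δ) (_ : 0 < ε) (_ : ε ≤ M / 4)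
      {P : L.Piece} {i : Fin 4} (_ : Ω.IsNode σ P i) (_ : dist (L.vert P.1 i) x₀ < r / 2)
      (_ : M - σ * (H P i - c) < ε / 4),
      ∃ P' i', Ω.IsNode σ P' i' ∧ r / 2 ≤ dist (L.vert P'.1 i') x₀ ∧
        dist (L.vert P'.1 i') x₀ ≤ r / 2 + 2 * δ ∧ M - σ * (H P' i' - c) < ε := by
  obtain ⟨C, τ₀, ℓ₀, hC, hτ₀, hℓ₀, key⟩ := exists_path_of_lt hη
  refine ⟨min (min τ₀ ℓ₀) (min (1 / 16) (1 / (4 * C))), by positivity, ?_⟩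
  intro δ L τ k c Ω F H S hp x₀ r M σ hM ε hτ hδr hτr hε hεM P i hN hd hw
  have hδ := hp.mesh_pos
  set κ := min (min τ₀ ℓ₀) (min (1 / 16) (1 / (4 * C))) with hκ
  have k1 : κ ≤ τ₀ := (min_le_left _ _).trans (min_le_left _ _)
  have k2 : κ ≤ ℓ₀ := (min_le_left _ _).trans (min_le_right _ _)
  have k3 : κ ≤ 1 / 16 := (min_le_right _ _).trans (min_le_left _ _)
  have k4 : κ ≤ 1 / (4 * C) := (min_le_right _ _).trans (min_le_right _ _)
  have hκ0 : 0 < κ := by positivity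
  have hr : 0 < r := by linarith [dist_nonneg (x := L.vert P.1 i) (y := x₀)]
  have hκr : κ * r ≤ 1 / 16 * r := by gcongr
  have hMp := hM.pos
  set ψ : ℂ → ℝ := fun y => ε * (1 / 4 + ‖y - x₀‖ ^ 2 / r ^ 2) with hψ
  have hψb : ∀ y, ∀ s : ℝ, 0 ≤ s → dist y x₀ ≤ s * r → ψ y ≤ ε * (1 / 4 + s ^ 2) := by
    intro y s hs hy
    rw [dist_eq_norm] at hy
    refine mul_le_mul_of_nonneg_left ?_ hε.le
    have : ‖y - x₀‖ ^ 2 / r ^ 2 ≤ s ^ 2 := by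
      rw [div_le_iff₀ (by positivity), ← mul_pow]
      exact pow_le_pow_left₀ (norm_nonneg _) hy 2
    linarith
  obtain ⟨P', i', hN', hU', hr', hw', ⟨y, hy, hyd⟩, -⟩ := key hp (hτ.trans k1) hMp.le hM.far hM.le
    (ψ := ψ) (U := {y | ‖y - x₀‖ < r / 2}) (V := univ) (t := ε / r ^ 2) (ℓ := 2 * ε / r) convex_univ
    (by
      intro y hy
      replace hy : ‖y - x₀‖ < r / 2 := hy
      rw [dist_eq_norm]
      linarith)
    (fun y hy => by
      have := hψb y 1 zero_le_one (by linarith)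
      linarith) (fun _ _ _ => mem_univ _)
    (fun y hy => quadratic_barrier hε hr (by linarith) hy) (by positivity)
    (by
      rw [div_mul_eq_mul_div, div_le_iff₀ hr]
      calc 2 * ε * δ ≤ 2 * (M / 4) * (κ * r) := by gcongr
        _ ≤ 2 * (M / 4) * (ℓ₀ * r) := by gcongr
        _ = ℓ₀ * M * r / 2 := by ring
        _ ≤ _ := half_le_self (by positivity))
    (by
      have h1 : 2 * C * (τ * r) < δ := by
        calc 2 * C * (τ * r) ≤ 2 * C * (κ * δ) := by gcongr
          _ ≤ 2 * C * (1 / (4 * C) * δ) := by gcongr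
          _ = δ / 2 := by field_simp; norm_num
          _ < _ := half_lt_self (by positivity)
      have e1 : C * τ * (2 * ε / r) = (ε / r ^ 2) * (2 * C * (τ * r)) := by field_simp
      rw [e1]
      exact mul_lt_mul_of_pos_left h1 (by positivity))
    hN (by rw [dist_eq_norm] at hd; exact hd)
    (by
      refine hw.trans_le ?_
      have : 0 ≤ ‖L.vert P.1 i - x₀‖ ^ 2 / r ^ 2 := by positivity
      simp only [hψ]
      nlinarith)
  have hy : ‖y - x₀‖ < r / 2 := hy
  have hle : dist (L.vert P'.1 i') x₀ ≤ r / 2 + 2 * δ := by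
    have := dist_triangle (L.vert P'.1 i') y x₀
    rw [dist_eq_norm y x₀] at this
    linarith
  refine ⟨P', i', hN', ?_, hle, ?_⟩
  · have : ¬ ‖L.vert P'.1 i' - x₀‖ < r / 2 := hU'
    rw [dist_eq_norm]; linarith
  · have := hψb (L.vert P'.1 i') (5 / 8) (by norm_num) (by linarith)
    nlinarith

end BoundaryProblem

end IsoradialLattice

/-! ### Crossing paths -/

/-- The set where the cosine is non-negative consists of separated intervals, and a continuous
argument cannot jump from one to another. -/
theorem abs_sub_le_of_cos_nonneg {θ : ℝ → ℝ} (hθ : Continuous θ) {φ : ℝ}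
    (hcos : ∀ s, 0 ≤ Real.cos (θ s - φ)) {a : ℝ} (ha : |θ a - φ| ≤ Real.pi / 2) (b : ℝ) :
    |θ b - φ| ≤ Real.pi / 2 := by
  have hpi := Real.pi_pos
  by_contra hcon
  push Not at hcon
  have hb : Real.pi ≤ |θ b - φ| := by
    by_contra h
    push Not at h
    have := Real.cos_neg_of_pi_div_two_lt_of_lt hcon (by linarith)
    rw [Real.cos_abs] at this
    linarith [hcos b]
  obtain ⟨s, hs⟩ := mem_range_of_exists_le_of_exists_ge (f := fun s => |θ s - φ|) (c := Real.pi)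
    (by fun_prop) ⟨a, by linarith⟩ ⟨b, hb⟩
  have := hcos s
  rw [← Real.cos_abs, show |θ s - φ| = Real.pi from hs, Real.cos_pi] at this
  linarith

/-- A path from the left to the right side of a rectangle meets every path from its bottom to its
top. -/
theorem exists_eq_of_crossing {f g : ℝ → ℂ} (hf : Continuous f) (hg : Continuous g) {a b c d : ℝ}
    (hf0 : (f 0).re ≤ a) (hf1 : b ≤ (f 1).re) (hfim : ∀ s, (f s).im ∈ Icc c d)
    (hg0 : (g 0).im ≤ c) (hg1 : d ≤ (g 1).im) (hgre : ∀ t, (g t).re ∈ Icc a b) :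
    ∃ s t, f s = g t := by
  by_contra hcon
  push Not at hcon
  have hpi := Real.pi_pos
  have hsc : IsSimplyConnected (univ : Set (ℝ × ℝ)) := by
    have : ContractibleSpace (univ : Set (ℝ × ℝ)) :=
      (convex_univ (𝕜 := ℝ) (E := ℝ × ℝ)).contractibleSpace ⟨0, mem_univ _⟩
    exact inferInstanceAs (SimplyConnectedSpace (univ : Set (ℝ × ℝ)))
  -- If the paths were disjoint, `f s - g t` would have a continuous argument on the plane. On the
  -- four sides of the unit square this difference stays in the left, lower, right and upper
  -- half-plane in turn, so the argument would gain `2 π` along the closed boundary.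
  obtain ⟨h, hc, he⟩ := Complex.exists_continuousOn_eqOn_exp_comp hsc isOpen_univ
    (g := fun p : ℝ × ℝ => f p.1 - g p.2) (by fun_prop) (by
      rintro ⟨p, -, hp⟩
      exact hcon p.1 p.2 (sub_eq_zero.1 hp))
  rw [continuousOn_univ] at hc
  obtain ⟨m, hm, -⟩ := existsUnique_add_zsmul_mem_Ioc Real.two_pi_pos (h (0, 0)).im (-Real.pi)
  set θ : ℝ × ℝ → ℝ := fun p => (h p).im + m • (2 * Real.pi) with hθ
  have hθc : Continuous θ := by fun_prop
  have hre : ∀ s t, (f s - g t).re = Real.exp (h (s, t)).re * Real.cos (θ (s, t)) := fun s t => by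
    have := he (mem_univ (s, t))
    simp only [Function.comp] at this
    rw [← this, exp_re, hθ]
    simp only [zsmul_eq_mul, Real.cos_add_int_mul_two_pi]
  have him : ∀ s t, (f s - g t).im = Real.exp (h (s, t)).re * Real.sin (θ (s, t)) := fun s t => by
    have := he (mem_univ (s, t))
    simp only [Function.comp] at this
    rw [← this, exp_im, hθ]
    simp only [zsmul_eq_mul, Real.sin_add_int_mul_two_pi]
  have cos_le : ∀ s t, (f s - g t).re ≤ 0 → Real.cos (θ (s, t)) ≤ 0 := fun s t h' => by
    rw [hre] at h'; exact nonpos_of_mul_nonpos_right h' (Real.exp_pos _)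
  have cos_ge : ∀ s t, 0 ≤ (f s - g t).re → 0 ≤ Real.cos (θ (s, t)) := fun s t h' => by
    rw [hre] at h'; exact nonneg_of_mul_nonneg_right h' (Real.exp_pos _)
  have sin_le : ∀ s t, (f s - g t).im ≤ 0 → Real.sin (θ (s, t)) ≤ 0 := fun s t h' => by
    rw [him] at h'; exact nonpos_of_mul_nonpos_right h' (Real.exp_pos _)
  have sin_ge : ∀ s t, 0 ≤ (f s - g t).im → 0 ≤ Real.sin (θ (s, t)) := fun s t h' => by
    rw [him] at h'; exact nonneg_of_mul_nonneg_right h' (Real.exp_pos _)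
  have left : ∀ t, Real.cos (θ (0, t)) ≤ 0 := fun t => cos_le _ _ (by
    rw [sub_re]; linarith [(hgre t).1])
  have right : ∀ t, 0 ≤ Real.cos (θ (1, t)) := fun t => cos_ge _ _ (by
    rw [sub_re]; linarith [(hgre t).2])
  have bottom : ∀ s, 0 ≤ Real.sin (θ (s, 0)) := fun s => sin_ge _ _ (by
    rw [sub_im]; linarith [(hfim s).1])
  have top : ∀ s, Real.sin (θ (s, 1)) ≤ 0 := fun s => sin_le _ _ (by
    rw [sub_im]; linarith [(hfim s).2])
  have hm' : θ (0, 0) ∈ Ioc (-Real.pi) Real.pi := by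
    simp only [hθ]
    refine ⟨hm.1, ?_⟩
    have := hm.2
    linarith
  have p00 : 0 ≤ θ (0, 0) := by
    by_contra hneg
    push Not at hneg
    linarith [Real.sin_neg_of_neg_of_neg_pi_lt hneg hm'.1, bottom 0]
  have q00 : Real.pi / 2 ≤ θ (0, 0) := by
    by_contra hneg
    push Not at hneg
    linarith [Real.cos_pos_of_mem_Ioo ⟨by linarith, hneg⟩, left 0]
  have p01 := abs_sub_le_of_cos_nonneg (θ := fun t => θ (0, t)) (by fun_prop) (φ := Real.pi)
    (fun t => by rw [Real.cos_sub_pi]; linarith [left t]) (a := 0)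
    (by rw [abs_le]; constructor <;> linarith [hm'.2]) 1
  rw [abs_le] at p01
  have q01 : Real.pi ≤ θ (0, 1) := by
    by_contra hneg
    push Not at hneg
    linarith [Real.sin_pos_of_pos_of_lt_pi (by linarith) hneg, top 0]
  have p11 := abs_sub_le_of_cos_nonneg (θ := fun s => θ (s, 1)) (by fun_prop)
    (φ := Real.pi + Real.pi / 2)
    (fun s => by
      rw [← sub_sub, Real.cos_sub_pi_div_two, Real.sin_sub_pi]; linarith [top s]) (a := 0)
    (by rw [abs_le]; constructor <;> linarith [p01.2]) 1
  rw [abs_le] at p11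
  have q11 : Real.pi + Real.pi / 2 ≤ θ (1, 1) := by
    by_contra hneg
    push Not at hneg
    linarith [Real.cos_neg_of_pi_div_two_lt_of_lt (by linarith : Real.pi / 2 < θ (1, 1))
      (by linarith), right 1]
  have p10 := abs_sub_le_of_cos_nonneg (θ := fun t => θ (1, t)) (by fun_prop)
    (φ := 2 * Real.pi) (fun t => by rw [Real.cos_sub_two_pi]; exact right t) (a := 1)
    (by rw [abs_le]; constructor <;> linarith [p11.2]) 0
  rw [abs_le] at p10
  have q10 : 2 * Real.pi ≤ θ (1, 0) := by
    by_contra hneg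
    push Not at hneg
    have := Real.sin_neg_of_neg_of_neg_pi_lt (x := θ (1, 0) - 2 * Real.pi) (by linarith)
      (by linarith)
    rw [Real.sin_sub_two_pi] at this
    linarith [bottom 1]
  have p00' := abs_sub_le_of_cos_nonneg (θ := fun s => θ (s, 0)) (by fun_prop)
    (φ := 2 * Real.pi + Real.pi / 2)
    (fun s => by rw [← sub_sub, Real.cos_sub_pi_div_two, Real.sin_sub_two_pi]; exact bottom s)
    (a := 1) (by rw [abs_le]; constructor <;> linarith [p10.2]) 0
  rw [abs_le] at p00'
  linarith [hm'.2]

/-! ### Branches of the logarithm along paths -/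

theorem norm_le_of_norm_exp_sub_one_le {μ : ℂ} {t : ℝ} (h : ‖exp μ - 1‖ ≤ t) (hμ : ‖μ‖ < 1 / 2) :
    ‖μ‖ ≤ 2 * t := by
  have h1 := Complex.norm_exp_sub_one_sub_id_le (x := μ) (by linarith)
  have h2 : ‖μ‖ ≤ ‖exp μ - 1‖ + ‖exp μ - 1 - μ‖ := by
    have := norm_sub_le (exp μ - 1) (exp μ - 1 - μ)
    rwa [sub_sub_cancel] at this
  nlinarith [norm_nonneg μ]

/-- In the ball, `exp (l z - w)` is within `t` of 1, so `‖l z - w‖` is either at most `2 t` or at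
least `1 / 2`. As `2 t ≤ 1 / 4`, continuity along the path excludes a change from the first to the
second. -/
theorem JoinedIn.log_near {A : Set ℂ} {l : ℂ → ℂ} (hl : ContinuousOn l A) {x₀ : ℂ}
    (hexp : ∀ z ∈ A, exp (l z) = z - x₀) {w : ℂ} {ρ t : ℝ} (hρ : ρ ≤ t * ‖exp w‖) (ht : t ≤ 1 / 8)
    {y y' : ℂ} (hj : JoinedIn (A ∩ Metric.ball (x₀ + exp w) ρ) y y') (hy : ‖l y - w‖ < 1 / 2) :
    JoinedIn (A ∩ {z | ‖l z - w‖ ≤ 2 * t}) y y' := by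
  obtain ⟨γ, hγ⟩ := hj
  have hew : 0 < ‖exp w‖ := norm_pos_iff.2 (exp_ne_zero w)
  have key : ∀ s, ‖l (γ s) - w‖ < 1 / 2 → ‖l (γ s) - w‖ ≤ 2 * t := by
    intro s hs
    refine norm_le_of_norm_exp_sub_one_le ?_ hs
    obtain ⟨h1, h2⟩ := hγ s
    rw [exp_sub, hexp _ h1, div_sub_one (exp_ne_zero w), norm_div, div_le_iff₀ hew]
    rw [Metric.mem_ball, dist_eq_norm] at h2
    rw [sub_sub]
    linarith
  have hc : Continuous fun s => ‖l (γ s) - w‖ := by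
    have : Continuous fun s => l (γ s) := hl.comp_continuous γ.continuous fun s => (hγ s).1
    exact (this.sub continuous_const).norm
  refine ⟨γ, fun s => ⟨(hγ s).1, key s ?_⟩⟩
  by_contra hcon
  push Not at hcon
  have h0 : ‖l (γ 0) - w‖ ≤ 2 * t := key 0 (by rwa [γ.source])
  obtain ⟨s', hs'⟩ := mem_range_of_exists_le_of_exists_ge hc (c := 3 / 8) ⟨0, by linarith⟩
    ⟨s, by linarith⟩
  have hs' : ‖l (γ s') - w‖ = 3 / 8 := hs'
  have := key s' (by rw [hs']; norm_num)
  linarith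

theorem JoinedIn.exists_continuous {A : Set ℂ} {y y' : ℂ} (hj : JoinedIn A y y') :
    ∃ f : ℝ → ℂ, Continuous f ∧ f 0 = y ∧ f 1 = y' ∧ ∀ t, f t ∈ A := by
  obtain ⟨γ, hγ⟩ := hj
  refine ⟨γ.extend, γ.continuous_extend, γ.extend_zero, γ.extend_one, fun t => ?_⟩
  have : γ.extend t ∈ range γ := by rw [← γ.extend_range]; exact mem_range_self t
  obtain ⟨s, hs⟩ := this
  rw [← hs]; exact hγ s

/-! ### Chains of discs around a boundary point, followed in the logarithmic coordinate. -/

namespace IsoradialLattice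

variable {δ : ℝ} {L : IsoradialLattice δ}

theorem norm_exp_add_bounds {w u : ℂ} {r : ℝ} (h1 : r / 2 ≤ ‖exp w‖)
    (h2 : ‖exp w‖ ≤ r / 2 + r / 1000) (hu : |u.re| ≤ 1 / 5) :
    2 / 5 * r ≤ ‖exp (w + u)‖ ∧ ‖exp (w + u)‖ ≤ 63 / 100 * r := by
  have hu := abs_le.1 hu
  have e1 : 4 / 5 ≤ Real.exp u.re := by linarith [Real.add_one_le_exp u.re]
  have e2 : Real.exp u.re ≤ 5 / 4 := by
    have h3 := Real.add_one_le_exp (-u.re)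
    rw [Real.exp_neg] at h3
    have hp := Real.exp_pos u.re
    have h4 : 4 / 5 ≤ (Real.exp u.re)⁻¹ := by linarith
    rw [le_inv_comm₀ (by norm_num) hp] at h4
    norm_num at h4
    linarith
  have hw := norm_nonneg (exp w)
  rw [exp_add, norm_mul, norm_exp u]
  constructor <;> nlinarith

namespace BoundaryProblem

/-- The discs are centred at `x₀ + exp (w + j u)`, along a straight line in the logarithmic
coordinate, and each step applies the Gaussian barrier with `ρ = r / 100`. Following the branch `l`,
not only positions in the plane, records how often the path has wound around `x₀`. The bound on the
real parts keeps the discs inside the ball of radius `r` and away from `x₀`. -/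
theorem exists_chain {η : ℝ} (hη : 0 < η) : ∃ κ : ℝ, 0 < κ ∧
    ∀ {δ : ℝ} {L : IsoradialLattice δ} {τ k c : ℝ} {Ω : L.DiscreteDomain} {F : L.LatticeFunction}
      {H : L.Piece → Fin 4 → ℝ} {S : Set L.BoundaryElement}
      (_ : L.BoundaryProblem η τ k c Ω F H S) {x₀ : ℂ} {r M σ : ℝ}
      (_ : Ω.BoundedNear H c S σ x₀ r M) (_ : τ ≤ κ) (_ : δ ≤ κ * r) (_ : τ * r ≤ κ * δ)
      {l : ℂ → ℂ} (_ : ContinuousOn l Ω.region) (_ : ∀ z ∈ Ω.region, exp (l z) = z - x₀)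
      {P : L.Piece} {i : Fin 4} (_ : Ω.IsNode σ P i) (_ : r / 2 ≤ dist (L.vert P.1 i) x₀)
      (_ : dist (L.vert P.1 i) x₀ ≤ r / 2 + 2 * δ) {u : ℂ} (_ : ‖u‖ ≤ 1 / 200) (n : ℕ)
      (_ : ∀ j : ℕ, j ≤ n → |(j * u).re| ≤ 1 / 5) (ε : ℝ) (_ : 0 < ε) (_ : ε ≤ M / 2)
      (_ : M - σ * (H P i - c) < stepFactor ^ n * ε),
      ∃ y, ‖l y - (l (L.vert P.1 i) + n * u)‖ ≤ 1 / 10 ∧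
        JoinedIn (Ω.region ∩ {z | ∃ j : ℕ, j ≤ n ∧ ‖l z - (l (L.vert P.1 i) + j * u)‖ ≤ 1 / 10})
          (L.vert P.1 i) y := by
  obtain ⟨κ, hκ, key⟩ := exists_path_to_ball hη
  refine ⟨min (κ / 100) (1 / 10000), by positivity, ?_⟩
  intro δ L τ k c Ω F H S hp x₀ r M σ hM hτ hδr hτr l hl hexp P i hN hr1 hr2 u hu n hun
  have hδ := hp.mesh_pos
  have k1 : min (κ / 100) (1 / 10000) ≤ κ / 100 := min_le_left _ _
  have k2 : min (κ / 100) (1 / 10000 : ℝ) ≤ 1 / 10000 := min_le_right _ _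
  have hr : 0 < r := by
    by_contra hcon
    push Not at hcon
    have : 0 < min (κ / 100) (1 / 10000 : ℝ) := by positivity
    nlinarith
  have hδr1 : δ ≤ κ * (r / 100) := by
    have := mul_le_mul_of_nonneg_right k1 hr.le
    linarith
  have hδr2 : δ ≤ r / 10000 := by
    have := mul_le_mul_of_nonneg_right k2 hr.le
    linarith
  have hτr1 : τ * (r / 100) ≤ κ * δ := by
    have := mul_le_mul_of_nonneg_right k1 hδ.le
    have : 0 < κ * δ := by positivity
    linarith
  have hτ1 : τ ≤ κ := by linarith
  set w := l (L.vert P.1 i) with hw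
  have hreg := hN.isInterior.mem_region hp.angleBound hη hδ
  have hew : exp w = L.vert P.1 i - x₀ := hexp _ hreg
  have hwn : ‖exp w‖ = dist (L.vert P.1 i) x₀ := by rw [hew, dist_eq_norm]
  have hb : ∀ j : ℕ, j ≤ n → 2 / 5 * r ≤ ‖exp (w + j * u)‖ ∧ ‖exp (w + j * u)‖ ≤ 63 / 100 * r :=
    fun j hj => norm_exp_add_bounds (by rw [hwn]; exact hr1) (by rw [hwn]; linarith) (hun j hj)
  suffices hmain : ∀ m : ℕ, m ≤ n → ∀ ε : ℝ, 0 < ε → ε ≤ M / 2 →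
      M - σ * (H P i - c) < stepFactor ^ m * ε →
      ∃ P' i', Ω.IsNode σ P' i' ∧ dist (L.vert P'.1 i') (x₀ + exp (w + m * u)) ≤ r / 400 ∧
        M - σ * (H P' i' - c) < ε ∧ ‖l (L.vert P'.1 i') - (w + m * u)‖ ≤ 1 / 10 ∧
        JoinedIn (Ω.region ∩ {z | ∃ j : ℕ, j ≤ m ∧ ‖l z - (w + j * u)‖ ≤ 1 / 10})
          (L.vert P.1 i) (L.vert P'.1 i') by
    intro ε h1 h2 h3
    obtain ⟨P', i', -, -, -, h4, h5⟩ := hmain n le_rfl ε h1 h2 h3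
    exact ⟨_, h4, h5⟩
  intro m
  induction m with
  | zero =>
    intro _ ε _ _ hlt
    refine ⟨P, i, hN, ?_, by simpa using hlt, by simp [hw], JoinedIn.refl ⟨hreg, 0, le_rfl, ?_⟩⟩
    · simp [hew]; positivity
    · simp [hw]
  | succ m ih =>
    intro hm ε hε hεM hlt
    have hsf := stepFactor_pos
    have hsf1 := stepFactor_le_one
    obtain ⟨P', i', hN', hd', hw', hl', hj'⟩ := ih (by omega) (stepFactor * ε) (by positivity)
      (by nlinarith) (by rwa [pow_succ, mul_assoc] at hlt)
    -- Consecutive centres are at most `3 ρ / 4` apart and the reached vertex is within `ρ / 4` of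
    -- the old centre, so it is within `ρ` of the new one.
    have hdist : dist (x₀ + exp (w + m * u)) (x₀ + exp (w + (m + 1 : ℕ) * u)) ≤ 3 / 4 * (r / 100) := by
      rw [dist_comm, dist_eq_norm, add_sub_add_left_eq_sub,
        show w + ((m + 1 : ℕ) : ℂ) * u = (w + m * u) + u by push_cast; ring, exp_add,
        ← mul_sub_one, norm_mul]
      have h1 := Complex.norm_exp_sub_one_le (x := u) (by linarith)
      have h2 := (hb m (by omega)).2
      have := norm_nonneg (exp (w + m * u))
      calc ‖exp (w + m * u)‖ * ‖exp u - 1‖ ≤ 63 / 100 * r * (2 * (1 / 200)) := by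
            gcongr; linarith
        _ ≤ _ := by linarith
    have hbm := hb (m + 1) hm
    obtain ⟨P'', i'', hN'', hd'', hw'', hj''⟩ := key hp hM (ρ := r / 100) (ε := ε)
      (q := x₀ + exp (w + (m + 1 : ℕ) * u)) hτ1 hδr1 hτr1 hε hεM
      (by rw [dist_eq_norm, add_sub_cancel_left]; linarith [hbm.2]) hN'
      (by
        have := dist_triangle (L.vert P'.1 i') (x₀ + exp (w + m * u))
          (x₀ + exp (w + (m + 1 : ℕ) * u))
        linarith) hw'
    -- The path stays within `2 ρ = r / 50` of the new centre, which is `1 / 20` of its least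
    -- distance `2 r / 5` to `x₀`. Hence the tolerance `1 / 10` in the logarithm.
    have hlog := JoinedIn.log_near hl hexp (w := w + (m + 1 : ℕ) * u) (t := 1 / 20)
      (by linarith [hbm.1]) (by norm_num) hj'' (by
        have : l (L.vert P'.1 i') - (w + ((m + 1 : ℕ) : ℂ) * u) =
          (l (L.vert P'.1 i') - (w + m * u)) - u := by push_cast; ring
        rw [this]
        have := norm_sub_le (l (L.vert P'.1 i') - (w + m * u)) u
        linarith)
    refine ⟨P'', i'', hN'', by linarith, hw'', ?_, ?_⟩
    · have := hlog.target_mem.2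
      have : ‖l (L.vert P''.1 i'') - (w + ((m + 1 : ℕ) : ℂ) * u)‖ ≤ 2 * (1 / 20) := this
      linarith
    · refine (hj'.mono ?_).trans (hlog.mono ?_)
      · rintro z ⟨h1, j, h2, h3⟩
        exact ⟨h1, j, by omega, h3⟩
      · rintro z ⟨h1, h2⟩
        have h2 : ‖l z - (w + ((m + 1 : ℕ) : ℂ) * u)‖ ≤ 2 * (1 / 20) := h2
        exact ⟨h1, m + 1, le_rfl, by linarith⟩

/-- The number of steps of a chain that winds once around a point. -/
def chainLength : ℕ := 1400

/-- At a vertex at distance about `r / 2` from a boundary point, `σ (H - c)` is not close to its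
upper bound. -/
theorem le_sub_of_dist {η : ℝ} (hη : 0 < η) : ∃ κ : ℝ, 0 < κ ∧
    ∀ {δ : ℝ} {L : IsoradialLattice δ} {τ k c : ℝ} {Ω : L.DiscreteDomain} {F : L.LatticeFunction}
      {H : L.Piece → Fin 4 → ℝ} {S : Set L.BoundaryElement}
      (_ : L.BoundaryProblem η τ k c Ω F H S) {x₀ : ℂ} {r M σ : ℝ}
      (_ : Ω.BoundedNear H c S σ x₀ r M) (_ : x₀ ∉ Ω.region) (_ : τ ≤ κ) (_ : δ ≤ κ * r)
      (_ : τ * r ≤ κ * δ)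
      {P : L.Piece} {i : Fin 4} (_ : Ω.IsNode σ P i) (_ : r / 2 ≤ dist (L.vert P.1 i) x₀)
      (_ : dist (L.vert P.1 i) x₀ ≤ r / 2 + 2 * δ),
      stepFactor ^ chainLength * (M / 2) ≤ M - σ * (H P i - c) := by
  obtain ⟨κ, hκ, key⟩ := exists_chain hη
  refine ⟨κ, hκ, ?_⟩
  intro δ L τ k c Ω F H S hp x₀ r M σ hM hx₀ hτ hδr hτr P i hN hr1 hr2
  by_contra hcon
  push Not at hcon
  have hMp := hM.pos
  have hopen : IsOpen Ω.region := by
    refine IsOpen.sdiff isOpen_interior ?_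
    refine Set.Finite.isClosed_biUnion Ω.pieces.finite_toSet fun Q _ => ?_
    rcases hQ : Q.2 with _ | j
    · have : Q.cut = ∅ := by
        ext x; simp [Piece.cut, hQ]
      rw [this]; exact isClosed_empty
    · have : Q.cut = segment ℝ (L.vert Q.1 (j - 1)) (L.vert Q.1 (j + 1)) := by
        ext x; simp [Piece.cut, hQ]
      rw [this]
      rw [segment_eq_image]
      exact (isCompact_Icc.image (by fun_prop)).isClosed
  obtain ⟨l, hl, hle⟩ := Complex.exists_continuousOn_eqOn_exp_comp Ω.simplyConnected hopen
    (g := fun z => z - x₀) (by fun_prop) (by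
      rintro ⟨z, hz, h0⟩
      exact hx₀ (by rwa [← sub_eq_zero.1 h0]))
  have hexp : ∀ z ∈ Ω.region, exp (l z) = z - x₀ := fun z hz => hle hz
  set w := l (L.vert P.1 i) with hw
  have hstep : ∀ n : ℕ, n ≤ chainLength → M - σ * (H P i - c) < stepFactor ^ n * (M / 2) := by
    intro n hn
    refine hcon.trans_le ?_
    have := pow_le_pow_of_le_one stepFactor_pos.le stepFactor_le_one hn
    gcongr
  have hch := fun u hu n hn hn' => key hp hM hτ hδr hτr hl hexp hN hr1 hr2 (u := u) hu n hn (M / 2)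
    (by positivity) le_rfl (hstep n hn')
  rw [← hw] at hch
  -- 40 steps change the log-radius by `1 / 5`, which is twice the tolerance, so the radial path
  -- crosses the whole strip of half-width `1 / 10`. 1400 steps turn by the angle 7, which exceeds
  -- `2 π` by more than twice the tolerance.
  obtain ⟨y₁, hy₁, hj₁⟩ := hch (-(1 / 200 : ℝ) : ℝ) (by rw [norm_real]; norm_num) 40 (fun j hj => by
    have : (j : ℝ) ≤ 40 := by exact_mod_cast hj
    rw [← ofReal_natCast, re_ofReal_mul, ofReal_re, abs_le]; constructor <;> linarith) (by norm_num [chainLength])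
  obtain ⟨y₂, hy₂, hj₂⟩ := hch ((1 / 200 : ℝ) : ℝ) (by rw [norm_real]; norm_num) 40 (fun j hj => by
    have : (j : ℝ) ≤ 40 := by exact_mod_cast hj
    have : (0 : ℝ) ≤ j := by positivity
    rw [← ofReal_natCast, re_ofReal_mul, ofReal_re, abs_le]; constructor <;> linarith) (by norm_num [chainLength])
  obtain ⟨y₃, hy₃, hj₃⟩ := hch (((1 / 200 : ℝ) : ℂ) * I) (by rw [norm_mul, norm_real]; norm_num) 1400
    (fun j hj => by simp) (by norm_num [chainLength])
  have hrad : JoinedIn (Ω.region ∩ {z | |(l z - w).im| ≤ 1 / 10}) y₁ y₂ := by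
    refine (hj₁.symm.mono ?_).trans (hj₂.mono ?_)
    all_goals
      rintro z ⟨h1, j, -, h3⟩
      refine ⟨h1, ?_⟩
      have h4 := (abs_im_le_norm _).trans h3
      have e : ∀ s : ℝ, (l z - (w + j * (s : ℂ))).im = (l z - w).im := fun s => by
        rw [sub_im, add_im, sub_im, ← ofReal_natCast, im_ofReal_mul, ofReal_im]; ring
      rw [e] at h4
      exact h4
  have hccw : JoinedIn (Ω.region ∩ {z | |(l z - w).re| ≤ 1 / 10}) (L.vert P.1 i) y₃ := by
    refine hj₃.mono ?_
    rintro z ⟨h1, j, -, h3⟩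
    refine ⟨h1, ?_⟩
    have h4 := (abs_re_le_norm _).trans h3
    have e : (l z - (w + j * (((1 / 200 : ℝ) : ℂ) * I))).re = (l z - w).re := by simp
    rw [e] at h4
    exact h4
  obtain ⟨f, hf, hf0, hf1, hfA⟩ := hrad.exists_continuous
  obtain ⟨g, hg, hg0, hg1, hgA⟩ := hccw.exists_continuous
  have hlf : Continuous fun t => l (f t) := hl.comp_continuous hf fun t => (hfA t).1
  have hlg : Continuous fun t => l (g t) := hl.comp_continuous hg fun t => (hgA t).1
  have hpi1 := Real.pi_gt_three
  have hpi2 := Real.pi_lt_d2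
  -- The lifted radial path, raised by `2 π i`, joins left and right of a small rectangle, which the
  -- lifted circular path crosses from below to above.
  obtain ⟨s, t, hst⟩ := exists_eq_of_crossing (f := fun s => l (f s) + 2 * Real.pi * I)
    (g := fun t => l (g t)) (hlf.add continuous_const) hlg (a := w.re - 1 / 10) (b := w.re + 1 / 10)
    (c := w.im + 2 * Real.pi - 1 / 10) (d := w.im + 2 * Real.pi + 1 / 10)
    (by
      have := (abs_le.1 ((abs_re_le_norm _).trans hy₁)).2
      simp [hf0] at this ⊢
      linarith)
    (by
      have := (abs_le.1 ((abs_re_le_norm _).trans hy₂)).1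
      simp [hf1] at this ⊢
      linarith)
    (fun s => by
      have : |(l (f s) - w).im| ≤ 1 / 10 := (hfA s).2
      rw [abs_le, sub_im] at this
      simp
      constructor <;> linarith [this.1, this.2])
    (by rw [hg0]; linarith)
    (by
      have := (abs_le.1 ((abs_im_le_norm _).trans hy₃)).1
      simp [hg1] at this ⊢
      linarith)
    (fun t => by
      have : |(l (g t) - w).re| ≤ 1 / 10 := (hgA t).2
      rw [abs_le, sub_re] at this
      constructor <;> linarith [this.1, this.2])
  -- Exponentiating shows that both paths are at the same point of the domain, where `l` has only
  -- one value; so the shift by `2 π i` would be zero.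
  have h1 := congrArg exp hst
  rw [exp_add, exp_two_pi_mul_I, mul_one, hexp _ (hfA s).1, hexp _ (hgA t).1, sub_left_inj] at h1
  rw [h1, add_eq_left] at hst
  exact Complex.two_pi_I_ne_zero hst

/-- The oscillation decreases by a fixed factor towards the boundary. -/
theorem le_of_dist_lt {η : ℝ} (hη : 0 < η) : ∃ κ : ℝ, 0 < κ ∧
    ∀ {δ : ℝ} {L : IsoradialLattice δ} {τ k c : ℝ} {Ω : L.DiscreteDomain} {F : L.LatticeFunction}
      {H : L.Piece → Fin 4 → ℝ} {S : Set L.BoundaryElement}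
      (_ : L.BoundaryProblem η τ k c Ω F H S) {x₀ : ℂ} {r M σ : ℝ}
      (_ : Ω.BoundedNear H c S σ x₀ r M) (_ : x₀ ∉ Ω.region) (_ : τ ≤ κ) (_ : δ ≤ κ * r)
      (_ : τ * r ≤ κ * δ)
      {P : L.Piece} {i : Fin 4} (_ : Ω.IsNode σ P i) (_ : dist (L.vert P.1 i) x₀ < r / 2),
      σ * (H P i - c) ≤ (1 - stepFactor ^ chainLength / 16) * M := by
  obtain ⟨κ₁, hκ₁, key₁⟩ := le_sub_of_dist hη
  obtain ⟨κ₂, hκ₂, key₂⟩ := exists_exit hη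
  refine ⟨min κ₁ κ₂, by positivity, ?_⟩
  intro δ L τ k c Ω F H S hp x₀ r M σ hM hx₀ hτ hδr hτr P i hN hd
  have hδ := hp.mesh_pos
  have hMp := hM.pos
  have hr : 0 < r := by linarith [dist_nonneg (x := L.vert P.1 i) (y := x₀)]
  have k1 := min_le_left κ₁ κ₂
  have k2 := min_le_right κ₁ κ₂
  have h1 := mul_le_mul_of_nonneg_right k1 hr.le
  have h2 := mul_le_mul_of_nonneg_right k2 hr.le
  have h3 := mul_le_mul_of_nonneg_right k1 hδ.le
  have h4 := mul_le_mul_of_nonneg_right k2 hδ.le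
  have hs0 : 0 < stepFactor ^ chainLength := pow_pos stepFactor_pos _
  have hs1 : stepFactor ^ chainLength ≤ 1 := pow_le_one₀ stepFactor_pos.le stepFactor_le_one
  by_contra hcon
  push Not at hcon
  set s := stepFactor ^ chainLength with hs
  -- A deficit below `s M / 16` inside would lead to a deficit below `s M / 4` near the circle of
  -- radius `r / 2`, where at least `s M / 2` is known.
  obtain ⟨P', i', hN', hd1, hd2, hw'⟩ := key₂ hp hM (ε := s * (M / 4)) (hτ.trans k2) (hδr.trans h2)
    (hτr.trans h4) (by positivity) (by nlinarith) hN hd (by linarith)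
  have := key₁ hp hM hx₀ (hτ.trans k1) (hδr.trans h1) (hτr.trans h3) hN' hd1 hd2
  have : 0 < s * M := by positivity
  linarith

end BoundaryProblem

end IsoradialLattice

namespace IsoradialLattice

variable {δ : ℝ} {L : IsoradialLattice δ}

/-! ### The boundary estimate -/

/-- The factor by which the oscillation decreases when the distance is halved. -/
def decayFactor : ℝ := 1 - stepFactor ^ BoundaryProblem.chainLength / 16

theorem decayFactor_mem : decayFactor ∈ Ioo (1 / 2 : ℝ) 1 := by
  have hs0 : 0 < stepFactor ^ BoundaryProblem.chainLength := pow_pos stepFactor_pos _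
  have hs1 : stepFactor ^ BoundaryProblem.chainLength ≤ 1 :=
    pow_le_one₀ stepFactor_pos.le stepFactor_le_one
  constructor <;> unfold decayFactor <;> linarith

/-- The exponent of the boundary estimate. -/
def decayExponent : ℝ := Real.logb (1 / 2) decayFactor

theorem half_rpow_decayExponent : (1 / 2 : ℝ) ^ decayExponent = decayFactor :=
  Real.rpow_logb (by norm_num) (by norm_num) (by linarith [decayFactor_mem.1])

theorem decayExponent_pos : 0 < decayExponent :=
  Real.logb_pos_of_base_lt_one (by norm_num) (by norm_num) (by linarith [decayFactor_mem.1])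
    decayFactor_mem.2

/-- Holds since the factor per halving is at least `1 / 2`; it serves to bound the power of `1 + m
d` in the end. -/
theorem decayExponent_le_one : decayExponent ≤ 1 := by
  have h : (1 / 2 : ℝ) ^ (1 : ℝ) ≤ (1 / 2 : ℝ) ^ decayExponent := by
    rw [half_rpow_decayExponent, Real.rpow_one]; exact decayFactor_mem.1.le
  exact (Real.rpow_le_rpow_left_iff_of_base_lt_one (by norm_num) (by norm_num)).1 h

namespace BoundaryProblem

/-- The bound in each ball is the hypothesis for the ball of half the radius. The mass condition
only improves at smaller radii, whereas the mesh condition is needed at the smallest one. -/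
theorem le_pow_mul {η : ℝ} (hη : 0 < η) : ∃ κ : ℝ, 0 < κ ∧
    ∀ {δ : ℝ} {L : IsoradialLattice δ} {τ k c : ℝ} {Ω : L.DiscreteDomain} {F : L.LatticeFunction}
      {H : L.Piece → Fin 4 → ℝ} {S : Set L.BoundaryElement}
      (_ : L.BoundaryProblem η τ k c Ω F H S) {x₀ : ℂ} {r M σ : ℝ}
      (_ : Ω.BoundedNear H c S σ x₀ r M) (_ : 0 < r) (_ : x₀ ∉ Ω.region) (_ : τ ≤ κ)
      (_ : τ * r ≤ κ * δ) (j : ℕ) (_ : δ ≤ κ * (r / 2 ^ j)) {P : L.Piece} {i : Fin 4}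
      (_ : Ω.IsNode σ P i) (_ : dist (L.vert P.1 i) x₀ < r / 2 ^ j),
      σ * (H P i - c) ≤ decayFactor ^ j * M := by
  obtain ⟨κ, hκ, key⟩ := le_of_dist_lt hη
  refine ⟨κ, hκ, ?_⟩
  intro δ L τ k c Ω F H S hp x₀ r M σ hM hr hx₀ hτ hτr j
  have hd0 : 0 < decayFactor := by linarith [decayFactor_mem.1]
  induction j with
  | zero =>
    intro _ P i hN hd
    simpa using hM.le P i hN (by simpa using hd)
  | succ j ih =>
    intro hδ P i hN hd
    have hr' : 0 < r / 2 ^ j := by positivity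
    have e : r / 2 ^ (j + 1) = r / 2 ^ j / 2 := by rw [pow_succ, div_div]
    rw [e] at hδ hd
    have hle : r / 2 ^ j ≤ r := div_le_self hr.le (one_le_pow₀ (by norm_num))
    have hδ' : δ ≤ κ * (r / 2 ^ j) := by
      have : 0 < κ * (r / 2 ^ j) := by positivity
      linarith
    have hτ0 : 0 ≤ τ := by
      have := sq_le_nome hp.modulus_nonneg hp.modulus_lt_one
      have h2 : 0 ≤ Real.exp 8 * nome k := (sq_nonneg k).trans this
      have := nonneg_of_mul_nonneg_right h2 (Real.exp_pos 8)
      linarith [hp.nome_le]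
    have hB : Ω.BoundedNear H c S σ x₀ (r / 2 ^ j) (decayFactor ^ j * M) :=
      ⟨by have := hM.pos; positivity, fun y hy => by linarith [hM.far y hy],
        fun P i hN hd => ih hδ' hN hd⟩
    have := key hp hB hx₀ hτ hδ' ((mul_le_mul_of_nonneg_left hle hτ0).trans hτr) hN hd
    rw [pow_succ', mul_assoc]
    exact this

theorem le_rpow_mul {η : ℝ} (hη : 0 < η) : ∃ κ A : ℝ, 0 < κ ∧ 0 < A ∧
    ∀ {δ : ℝ} {L : IsoradialLattice δ} {τ k c : ℝ} {Ω : L.DiscreteDomain} {F : L.LatticeFunction}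
      {H : L.Piece → Fin 4 → ℝ} {S : Set L.BoundaryElement}
      (_ : L.BoundaryProblem η τ k c Ω F H S) {x₀ : ℂ} {r M σ : ℝ} (_ : 0 < M)
      (_ : ∀ y ∈ carrier (Ω.boundary \ S), r + 2 * δ ≤ dist y x₀)
      (_ : ∀ P i, Ω.IsNode σ P i → σ * (H P i - c) ≤ M) (_ : 0 < r) (_ : x₀ ∉ Ω.region) (_ : τ ≤ κ)
      (_ : τ * r ≤ κ * δ) {ρ : ℝ} (_ : δ ≤ ρ) {P : L.Piece} {i : Fin 4}
      (_ : Ω.IsNode σ P i) (_ : dist (L.vert P.1 i) x₀ ≤ ρ),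
      σ * (H P i - c) ≤ (A * (ρ / r)) ^ decayExponent * M := by
  obtain ⟨κ, hκ, key⟩ := le_pow_mul hη
  -- The `1 / κ` keeps the last radius, which is at least `A ρ`, large compared with the mesh; the
  -- `2` makes the closed ball of radius `ρ` fit strictly inside. Rounding to powers of two costs
  -- another factor 2.
  set A := max 2 (1 / κ) with hA
  have hA2 : 2 ≤ A := le_max_left _ _
  have hA0 : 0 < A := by linarith
  have hκA : 1 ≤ κ * A := by
    have := mul_le_mul_of_nonneg_left (le_max_right 2 (1 / κ)) hκ.le
    rwa [mul_one_div_cancel hκ.ne'] at this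
  refine ⟨κ, 2 * A, hκ, by positivity, ?_⟩
  intro δ L τ k c Ω F H S hp x₀ r M σ hM hfar hle hr hx₀ hτ hτr ρ hδρ P i hN hd
  have hρ : 0 < ρ := hp.mesh_pos.trans_le hδρ
  by_cases hcase : r ≤ A * ρ
  · have h1 : (1 : ℝ) ≤ (2 * A * (ρ / r)) ^ decayExponent := by
      refine Real.one_le_rpow ?_ decayExponent_pos.le
      rw [← mul_div_assoc, le_div_iff₀ hr]
      have : 0 < A * ρ := by positivity
      linarith
    have := hle P i hN
    nlinarith
  · push Not at hcase
    obtain ⟨j, hj1, hj2⟩ := exists_nat_pow_near (x := r / (A * ρ)) (y := 2)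
      (by rw [le_div_iff₀ (by positivity)]; linarith) (by norm_num)
    have hp2 : (0 : ℝ) < 2 ^ j := by positivity
    have h1 : A * ρ ≤ r / 2 ^ j := by
      rw [le_div_iff₀ (by positivity)] at hj1 ⊢
      linarith
    have hB : Ω.BoundedNear H c S σ x₀ r M := ⟨hM, hfar, fun P i hN _ => hle P i hN⟩
    have h2 := key hp hB hr hx₀ hτ hτr j (by
        calc δ ≤ 1 * ρ := by linarith
          _ ≤ κ * A * ρ := by gcongr
          _ = κ * (A * ρ) := by ring
          _ ≤ _ := by gcongr) hN (by nlinarith)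
    refine h2.trans (mul_le_mul_of_nonneg_right ?_ hM.le)
    rw [← half_rpow_decayExponent, ← Real.rpow_natCast, ← Real.rpow_mul (by norm_num), mul_comm,
      Real.rpow_mul (by norm_num), Real.rpow_natCast]
    refine Real.rpow_le_rpow (by positivity) ?_ decayExponent_pos.le
    rw [div_lt_iff₀ (by positivity), pow_succ] at hj2
    rw [one_div, inv_pow, ← one_div, ← mul_div_assoc, div_le_div_iff₀ hp2 hr]
    linarith

theorem abs_sub_le_osc {η τ k c : ℝ} {Ω : L.DiscreteDomain} {F : L.LatticeFunction}
    {H : L.Piece → Fin 4 → ℝ} {S : Set L.BoundaryElement} (h : L.BoundaryProblem η τ k c Ω F H S)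
    (hS : S.Nonempty) {P : L.Piece} (hP : P ∈ Ω.pieces) {i : Fin 4} (hi : i ∈ P.verts) :
    |H P i - c| ≤ osc Ω H := by
  have hfin : {x : ℝ | ∃ P ∈ Ω.pieces, ∃ i ∈ P.verts, x = H P i}.Finite := by
    refine ((Ω.pieces ×ˢ (Finset.univ : Finset (Fin 4))).finite_toSet.image
      fun p => H p.1 p.2).subset ?_
    rintro x ⟨Q, hQ, j, -, rfl⟩
    exact ⟨(Q, j), by simpa using hQ, rfl⟩
  have hc : c ∈ {x : ℝ | ∃ P ∈ Ω.pieces, ∃ i ∈ P.verts, x = H P i} := by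
    obtain ⟨b, hb⟩ := hS
    have hv := h.boundaryValue b hb
    have hb' := h.subset_boundary hb
    rcases b with Q | ⟨Q, j⟩
    · obtain ⟨hQ, hQ2⟩ := hb'
      obtain ⟨j, hj⟩ := Option.ne_none_iff_exists'.1 hQ2
      refine ⟨Q, hQ, j - 1, ?_, (hv j hj).2.1.symm⟩
      change Q.2 ≠ some (j - 1 + 2)
      rw [hj]
      intro h'
      rw [Option.some_inj] at h'
      clear * - h'
      revert j; decide
    · exact ⟨Q, hb'.1, j, hb'.2.1.1, hv.1.symm⟩
  rw [← Real.dist_eq]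
  exact Metric.dist_le_diam_of_mem hfin.isBounded ⟨P, hP, i, hi, rfl⟩ hc

theorem mesh_le_infDist {η τ k c : ℝ} {Ω : L.DiscreteDomain} {F : L.LatticeFunction}
    {H : L.Piece → Fin 4 → ℝ} {S : Set L.BoundaryElement} (h : L.BoundaryProblem η τ k c Ω F H S)
    {v : ℂ} (hv : Ω.IsInterior v) {b : L.BoundaryElement} (hb : b ∈ Ω.boundary) {y : ℂ}
    (hy : y ∈ b.seg) : δ * Real.sin (2 * η) / 2 ≤ dist v y := by
  by_contra hcon
  push Not at hcon
  refine DiscreteDomain.seg_disjoint_region h.angleBound h.eta_pos h.mesh_pos hb hy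
    (hv.ball_subset_region h.angleBound h.eta_pos h.mesh_pos ?_)
  rwa [Metric.mem_ball, dist_comm]

/-- The estimate of the distance of `H` to its boundary value at an interior vertex. -/
theorem abs_sub_le_of_dist {η : ℝ} (hη : 0 < η) : ∃ κ A : ℝ, 0 < κ ∧ 0 < A ∧
    ∀ {δ : ℝ} {L : IsoradialLattice δ} {τ k c : ℝ} {Ω : L.DiscreteDomain} {F : L.LatticeFunction}
      {H : L.Piece → Fin 4 → ℝ} {S : Set L.BoundaryElement}
      (_ : L.BoundaryProblem η τ k c Ω F H S) (_ : S.Nonempty) {x₀ : ℂ} {r : ℝ}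
      (_ : 0 < osc Ω H) (_ : ∀ y ∈ carrier (Ω.boundary \ S), r + 2 * δ ≤ dist y x₀) (_ : 0 < r)
      (_ : x₀ ∉ Ω.region) (_ : τ ≤ κ) (_ : τ * r ≤ κ * δ) {ρ : ℝ} (_ : δ ≤ ρ) (_ : ρ < r)
      {P : L.Piece} {i : Fin 4} (_ : P ∈ Ω.pieces) (_ : i ∈ P.verts)
      (_ : Ω.IsInterior (L.vert P.1 i)) (_ : dist (L.vert P.1 i) x₀ + δ ≤ ρ),
      |H P i - c| ≤ (A * (ρ / r)) ^ decayExponent * osc Ω H := by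
  obtain ⟨κ, A, hκ, hA, key⟩ := le_rpow_mul hη
  refine ⟨κ, A, hκ, hA, ?_⟩
  intro δ L τ k c Ω F H S hp hS x₀ r hosc hfar hr hx₀ hτ hτr ρ hδρ hρr P i hP hi hvint hd
  have hδ := hp.mesh_pos
  have hL := hp.angleBound
  have hbound : ∀ σ P i, Ω.IsNode σ P i → σ * (H P i - c) ≤ osc Ω H := by
    intro σ P i hN
    have h1 := hp.abs_sub_le_osc hS hN.mem hN.mem_verts
    have h2 : |σ| = 1 := by rw [← hN.colour_eq]; unfold colour; split_ifs <;> simp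
    calc σ * (H P i - c) ≤ |σ * (H P i - c)| := le_abs_self _
      _ = |H P i - c| := by rw [abs_mul, h2, one_mul]
      _ ≤ _ := h1
  have est : ∀ σ P i, Ω.IsNode σ P i → dist (L.vert P.1 i) x₀ ≤ ρ →
      σ * (H P i - c) ≤ (A * (ρ / r)) ^ decayExponent * osc Ω H := fun σ P i hN hd =>
    key hp hosc hfar (hbound σ) hr hx₀ hτ hτr hδρ hN hd
  set B := (A * (ρ / r)) ^ decayExponent * osc Ω H with hB
  have hB0 : 0 ≤ B := by
    have : 0 ≤ ρ := hδ.le.trans hδρ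
    positivity
  have upper := est (colour i) P i ⟨hP, hi, hvint, rfl⟩ (by linarith)
  have hside : P.HasSide i := by
    obtain ⟨Q, hQ, hQ1, hQ2⟩ := hvint.piece P.1 i rfl
    have := DiscreteDomain.piece_unique hQ hP hQ1.symm hQ2 hi
    rw [this]
    exact (hasSide_first hQ2).1
  have hinc := hp.squareIntegral.increment P hP i hside
  have hnn : 0 ≤ 2 * δ * ‖F.atSide P i‖ ^ 2 := by positivity
  have hcol : colour i * (H P i - H P (i + 1)) = 2 * δ * ‖F.atSide P i‖ ^ 2 := by
    rw [← hinc]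
    unfold colour primalEnd dualEnd
    split_ifs <;> ring
  have hcol' : colour (i + 1) = -colour i := by
    unfold colour; clear * -; fin_cases i <;> simp
  have hdn : dist (L.vert P.1 (i + 1)) x₀ ≤ ρ := by
    have h1 := dist_triangle (L.vert P.1 (i + 1)) (L.vert P.1 i) x₀
    rw [dist_eq_norm (L.vert P.1 (i + 1)) (L.vert P.1 i), (norm_side_sub P.1 i).1] at h1
    linarith
  -- The neighbour has the opposite colour, and `H` is monotone along the corner between them. So
  -- its one-sided bound is the missing bound at the vertex itself, which is why `ρ` leaves room for
  -- one more `δ`.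
  have lower : colour (i + 1) * (H P (i + 1) - c) ≤ B := by
    rcases hp.squareIntegral.interior_or_eq hL hη hδ hp.boundaryValue hP hside.2 (fun hy => by
      have := hfar _ hy; linarith) with heq | hvint'
    · rw [heq, sub_self, mul_zero]; exact hB0
    · exact est _ P (i + 1) ⟨hP, hside.2, hvint', rfl⟩ hdn
  rw [hcol'] at lower
  have hlow : -(colour i * (H P i - c)) ≤ B := by linarith
  have h2 : |colour i| = 1 := by unfold colour; split_ifs <;> simp
  rw [← one_mul |H P i - c|, ← h2, ← abs_mul, abs_le]
  constructor <;> linarith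

end BoundaryProblem

end IsoradialLattice

end

/-! ### Choice of the scale and conclusion. -/

/-- Source of the mass factor: for an exponent at most 1, `(1 + x)^β ≤ 1 + x ≤ 2 (1 + x²)`. -/
theorem rpow_mul_div_le {a ρ x d β : ℝ} (ha : 0 ≤ a) (hρ : 0 ≤ ρ) (hd : 0 < d) (hx : 0 ≤ x)
    (hβ : β ≤ 1) :
    (a * (ρ * (1 + x) / d)) ^ β ≤ 2 * a ^ β * (1 + x ^ 2) * (ρ / d) ^ β := by
  have hpow : (1 + x) ^ β ≤ 2 * (1 + x ^ 2) := by
    calc (1 + x) ^ β ≤ (1 + x) ^ (1 : ℝ) := Real.rpow_le_rpow_of_exponent_le (by linarith) hβ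
      _ = 1 + x := Real.rpow_one _
      _ ≤ _ := by nlinarith [sq_nonneg (x - 1 / 2)]
  rw [show ρ * (1 + x) / d = (1 + x) * (ρ / d) by ring, Real.mul_rpow ha (by positivity),
    Real.mul_rpow (by positivity) (by positivity)]
  calc a ^ β * ((1 + x) ^ β * (ρ / d) ^ β) ≤ a ^ β * (2 * (1 + x ^ 2) * (ρ / d) ^ β) := by gcongr
    _ = _ := by ring

set_option maxHeartbeats 1000000 in
theorem proposition3p9 :
    ∃ β₀ : ℝ, 0 < β₀ ∧ ∀ η : ℝ, 0 < η → ∃ C : ℝ, 0 < C ∧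
      ∀ (δ : ℝ), 0 < δ → ∀ (L : IsoradialLattice δ), L.AngleBound η →
      ∀ (k m : ℝ), 0 ≤ k → k < 1 → 0 ≤ m → nome k ≤ m * δ →
      ∀ (Ω : L.DiscreteDomain) (F : L.LatticeFunction) (H : L.Piece → Fin 4 → ℝ),
        IsoradialLattice.IsMassiveSHol k Ω F → IsoradialLattice.IsSquareIntegral Ω F H →
      ∀ (S : Set L.BoundaryElement) (c : ℝ), S ⊆ Ω.boundary → S.Nonempty →
        (∀ s ∈ S, IsoradialLattice.HasBoundaryValue k F H c s) →
      ∀ P ∈ Ω.pieces, ∀ i ∈ P.verts,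
        0 < Metric.infDist (L.vert P.1 i) (IsoradialLattice.carrier (Ω.boundary \ S)) →
        |H P i - c| ≤ C * IsoradialLattice.osc Ω H *
          (1 + (m * Metric.infDist (L.vert P.1 i)
            (IsoradialLattice.carrier (Ω.boundary \ S))) ^ 2) *
          (Metric.infDist (L.vert P.1 i) (IsoradialLattice.carrier S) /
            Metric.infDist (L.vert P.1 i) (IsoradialLattice.carrier (Ω.boundary \ S))) ^ β₀ := by
  refine ⟨IsoradialLattice.decayExponent, IsoradialLattice.decayExponent_pos, fun η hη => ?_⟩
  by_cases hηpi : Real.pi / 4 < η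
  · refine ⟨1, one_pos, ?_⟩
    intro δ _ L hL k m _ _ _ _ Ω F H _ _ S c _ _ _ P
    have := hL P.1
    linarith [this.1, this.2]
  push Not at hηpi
  obtain ⟨κ, A, hκ, hA, key⟩ := IsoradialLattice.BoundaryProblem.abs_sub_le_of_dist hη
  set β := IsoradialLattice.decayExponent with hβ
  have hβ0 : 0 < β := IsoradialLattice.decayExponent_pos
  have hβ1 : β ≤ 1 := IsoradialLattice.decayExponent_le_one
  -- An interior vertex is at distance at least `c₁ δ` from the boundary, so that its distance to
  -- `S` controls the mesh.
  set c₁ := Real.sin (2 * η) / 2 with hc₁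
  have hc₁0 : 0 < c₁ := by
    have := Real.sin_pos_of_pos_of_lt_pi (by linarith : 0 < 2 * η) (by linarith [Real.pi_pos])
    positivity
  have hc₁1 : c₁ ≤ 1 / 2 := by
    have := Real.sin_le_one (2 * η)
    linarith
  set κ' := min κ (1 / 2) with hκ'
  have hκ'0 : 0 < κ' := by positivity
  have hκ'1 : κ' ≤ κ := min_le_left _ _
  have hκ'2 : κ' ≤ 1 / 2 := min_le_right _ _
  set R₀ := κ' * c₁ / 16 with hR₀
  have hR₀0 : 0 < R₀ := by positivity
  set a := max (1 / R₀) (A * (2 + 1 / c₁) / κ') with ha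
  have ha1 : 1 / R₀ ≤ a := le_max_left _ _
  have ha2 : A * (2 + 1 / c₁) / κ' ≤ a := le_max_right _ _
  have ha0 : 0 < a := by
    have : 0 < 1 / R₀ := by positivity
    linarith
  refine ⟨2 * a ^ β, by positivity, ?_⟩
  intro δ hδ L hL k m hk0 hk1 hm hq Ω F H hF hH S c hSb hS hSv P hP i hi hd
  set v := L.vert P.1 i with hv
  set d := Metric.infDist v (IsoradialLattice.carrier (Ω.boundary \ S)) with hdd
  set ρ := Metric.infDist v (IsoradialLattice.carrier S) with hρd
  have hp : L.BoundaryProblem η (m * δ) k c Ω F H S :=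
    ⟨hL, hη, hδ, hk0, hk1, hq, hF, hH, hSb, hSv⟩
  have hosc0 : 0 ≤ IsoradialLattice.osc Ω H := Metric.diam_nonneg
  have hρ0 : 0 ≤ ρ := Metric.infDist_nonneg
  have hvc : v ∉ IsoradialLattice.carrier (Ω.boundary \ S) := fun h => by
    rw [hdd, Metric.infDist_zero_of_mem h] at hd
    exact lt_irrefl _ hd
  have hle := hp.abs_sub_le_osc hS hP hi
  rcases hH.interior_or_eq hL hη hδ hSv hP hi hvc with heq | hvint
  · rw [heq, sub_self, abs_zero]
    positivity
  rcases hosc0.eq_or_lt with hosc | hosc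
  · rw [← hosc] at hle ⊢
    simpa using hle
  -- Up to `κ'`, the ratio of `ρ` to the scale `r` below. When it is at least `R₀`, the bound by the
  -- oscillation suffices.
  set R := ρ * (1 + m * d) / d with hR
  have hmd : 0 ≤ m * d := by positivity
  have hR0 : 0 ≤ R := by positivity
  have main : |H P i - c| ≤ IsoradialLattice.osc Ω H * (a * R) ^ β := by
    by_cases hcase : R₀ ≤ R
    · have h1 : (1 : ℝ) ≤ (a * R) ^ β := by
        refine Real.one_le_rpow ?_ hβ0.le
        calc (1 : ℝ) = 1 / R₀ * R₀ := by field_simp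
          _ ≤ a * R := by gcongr
      nlinarith
    push Not at hcase
    have hne : (IsoradialLattice.carrier S).Nonempty := by
      obtain ⟨b, hb⟩ := hS
      have hb' := hSb hb
      rcases b with Q | ⟨Q, j⟩
      · obtain ⟨j, hj⟩ := Option.ne_none_iff_exists'.1 hb'.2
        exact ⟨_, mem_iUnion₂.2 ⟨_, hb, ⟨j, hj, left_mem_segment _ _ _⟩⟩⟩
      · exact ⟨_, mem_iUnion₂.2 ⟨_, hb, left_mem_segment _ _ _⟩⟩
    have hρδ : δ * c₁ ≤ ρ := by
      refine (Metric.le_infDist hne).2 fun y hy => ?_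
      obtain ⟨b, hb, hy⟩ := mem_iUnion₂.1 hy
      have := hp.mesh_le_infDist hvint (hSb hb) hy
      rw [hc₁]; linarith
    have hρp : 0 < ρ := lt_of_lt_of_le (by positivity) hρδ
    obtain ⟨x₀, hx₀S, hx₀⟩ := (Metric.infDist_lt_iff hne).1 (by linarith : ρ < 2 * ρ)
    have hx₀r : x₀ ∉ Ω.region :=
      Set.disjoint_left.1 (IsoradialLattice.carrier_disjoint_region hL hη hδ hSb) hx₀S
    -- Of order `min (d, 1 / m)`: far from the rest of the boundary, and with `m r ≤ κ`, as the
    -- barriers require.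
    set r := κ' * d / (1 + m * d) with hr
    have h1md : 0 < 1 + m * d := by linarith
    have hrp : 0 < r := by positivity
    have hRlt : ρ * (1 + m * d) < R₀ * d := by rwa [hR, div_lt_iff₀ hd] at hcase
    have hρd' : ρ < R₀ * d := by
      have : 0 ≤ ρ * (m * d) := by positivity
      linarith
    have hR₀c : R₀ ≤ c₁ / 32 := by rw [hR₀]; nlinarith
    have hδd : δ ≤ d / 32 := by
      have h1 : δ * c₁ < c₁ / 32 * d := by
        have : R₀ * d ≤ c₁ / 32 * d := by gcongr
        linarith
      have h2 : δ * c₁ < d / 32 * c₁ := by linarith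
      exact (lt_of_mul_lt_mul_right h2 hc₁0.le).le
    have hρ64 : ρ ≤ d / 32 := by
      have : R₀ * d ≤ 1 / 32 * d := by gcongr; linarith
      linarith
    have hrd : r ≤ d / 2 := by
      rw [hr, div_le_iff₀ h1md]
      have : κ' * d ≤ 1 / 2 * d := by gcongr
      have : 0 ≤ d / 2 * (m * d) := by positivity
      linarith
    have hmr : m * r ≤ κ := by
      rw [hr, ← mul_div_assoc, div_le_iff₀ h1md]
      have : κ' * (m * d) ≤ κ * (m * d) := by gcongr
      linarith
    have hmδ : m * δ ≤ κ := by
      have h1 : m * (δ * c₁) * 1 ≤ m * ρ := by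
        rw [mul_one]; gcongr
      have h2 : m * (ρ * (1 + m * d)) ≤ m * (R₀ * d) := by gcongr
      have h3 : m * ρ * (1 + m * d) ≤ R₀ * (1 + m * d) := by linarith
      have h4 : m * ρ ≤ R₀ := le_of_mul_le_mul_right h3 h1md
      have h5 : m * δ * c₁ ≤ κ * c₁ := by
        have : κ' * c₁ ≤ κ * c₁ := by gcongr
        have : 0 < κ' * c₁ := by positivity
        linarith
      exact le_of_mul_le_mul_right h5 hc₁0
    have hfar : ∀ y ∈ IsoradialLattice.carrier (Ω.boundary \ S), r + 2 * δ ≤ dist y x₀ := by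
      intro y hy
      have h1 : d ≤ dist v y := Metric.infDist_le_dist_of_mem hy
      have h2 := dist_triangle v x₀ y
      rw [dist_comm x₀ y] at h2
      linarith
    -- Room for the distance `2 ρ` to the chosen `x₀` on `S` and one further mesh, as `δ ≤ ρ / c₁`.
    set ρ' := (2 + 1 / c₁) * ρ with hρ'
    have hδρ : δ ≤ 1 / c₁ * ρ := by
      rw [one_div, le_inv_mul_iff₀ hc₁0]; linarith
    have hρ'r : ρ' / r = (2 + 1 / c₁) / κ' * R := by
      rw [hρ', hr, hR]; field_simp
    have hlt : ρ' < r := by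
      have : ρ' / r < 1 := by
        rw [hρ'r]
        calc (2 + 1 / c₁) / κ' * R < (2 + 1 / c₁) / κ' * R₀ := by gcongr
          _ = (2 * c₁ + 1) / 16 := by rw [hR₀]; field_simp
          _ < 1 := by linarith
      rwa [div_lt_one hrp] at this
    have := key hp hS hosc hfar hrp hx₀r hmδ (by
      have := mul_le_mul_of_nonneg_right hmr hδ.le
      linarith) (ρ := ρ') (by linarith) hlt hP hi hvint (by
        rw [← hv]; linarith)
    rw [hρ'r] at this
    refine this.trans ?_
    rw [mul_comm]
    refine mul_le_mul_of_nonneg_left (Real.rpow_le_rpow (by positivity) ?_ hβ0.le) hosc0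
    calc A * ((2 + 1 / c₁) / κ' * R) = A * (2 + 1 / c₁) / κ' * R := by ring
      _ ≤ a * R := by gcongr
  calc |H P i - c| ≤ IsoradialLattice.osc Ω H * (a * R) ^ β := main
    _ ≤ IsoradialLattice.osc Ω H * (2 * a ^ β * (1 + (m * d) ^ 2) * (ρ / d) ^ β) :=
        mul_le_mul_of_nonneg_left (rpow_mul_div_le ha0.le hρ0 hd hmd hβ1) hosc0
    _ = _ := by ring
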